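/- Let $X$ be a closed (that is, compact, Hausdorff, without boundary) smooth manifold and let $\xi\in H^1(X;\mathbb Z)$. For $a\in\mathbb C^*$ let $E_a\to X$ be the complex flat line bundle whose monodromy along every loop $\gamma$ in $X$ is multiplication by $a^{\langle \xi,\gamma\rangle}$. Call a complex number $b\neq 0$ a Dirichlet unit if $b$ and $b^{-1}$ are both algebraic integers. Suppose that for some $a\in\mathbb C^*$ which is not a Dirichlet unit, $H^i(X;E_a)\neq 0$ for at least one $i\ge 0$. Then every smooth closed 1-form $\omega$ on $X$ whose de Rham cohomology class is the image of $\xi$ in $H^1(X;\mathbb R)$ has at least one critical point, i.e. there is a point $p\in X$ with $\omega_p=0$. -/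

import Mathlib

open CategoryTheory
open scoped Manifold ContDiff

noncomputable section

namespace FlatLine

/-! ### Singular simplices -/

/-- The standard topological `n`-simplex. -/
abbrev Simplex (n : ℕ) : Type := stdSimplex ℝ (Fin (n + 1))

/-- The initial vertex `e₀` of the standard simplex. -/
abbrev vertexZero (n : ℕ) : Simplex n := stdSimplex.vertex 0

/-- The `i`-th face inclusion `Δⁿ → Δⁿ⁺¹`, which omits the vertex `i`. -/
def faceMap {n : ℕ} (i : Fin (n + 2)) : C(Simplex n, Simplex (n + 1)) :=
  ⟨stdSimplex.map i.succAbove, stdSimplex.continuous_map _⟩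

/-- The straight segment from `p` to `q` in the standard simplex. -/
def segmentPath {n : ℕ} (p q : Simplex n) : Path p q where
  toFun t := ⟨(1 - (t : ℝ)) • (p : Fin (n + 1) → ℝ) + (t : ℝ) • (q : Fin (n + 1) → ℝ),
    convex_stdSimplex ℝ (Fin (n + 1)) p.2 q.2 (sub_nonneg.2 t.2.2) t.2.1 (by ring)⟩
  continuous_toFun := by
    refine Continuous.subtype_mk ?_ _
    fun_prop
  source' := by
    ext i
    change (1 - ((0 : unitInterval) : ℝ)) * p i + ((0 : unitInterval) : ℝ) * q i = p i
    simp
  target' := by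
    ext i
    change (1 - ((1 : unitInterval) : ℝ)) * p i + ((1 : unitInterval) : ℝ) * q i = q i
    simp

instance (n : ℕ) : ContractibleSpace (Simplex n) :=
  (convex_stdSimplex ℝ (Fin (n + 1))).contractibleSpace ⟨_, (vertexZero n).2⟩

theorem faceMap_faceMap {n : ℕ} (i : Fin (n + 3)) (j : Fin (n + 2)) :
    (faceMap (i.succAbove j)).comp (faceMap (j.predAbove i)) = (faceMap i).comp (faceMap j) := by
  ext1 x
  simp only [faceMap, ContinuousMap.comp_apply, ContinuousMap.coe_mk, stdSimplex.map_comp_apply]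
  congr 1
  funext k
  simp [Fin.succAbove_succAbove_succAbove_predAbove]

/-- A map on pairs of faces of a simplex that depends only on the composite face has vanishing
alternating sum. -/
theorem alternating_sum_eq_zero {M : Type*} [AddCommGroup M] {n : ℕ}
    (F : C(Simplex n, Simplex (n + 2)) → M) :
    ∑ i : Fin (n + 3), ∑ j : Fin (n + 2),
      ((-1 : ℤ) ^ (i : ℕ) * (-1) ^ (j : ℕ)) • F ((faceMap i).comp (faceMap j)) = 0 := by
  rw [← Fintype.sum_prod_type']
  refine Finset.sum_involution (fun p _ => (p.1.succAbove p.2, p.2.predAbove p.1)) ?_ ?_ ?_ ?_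
  · rintro ⟨i, j⟩ -
    dsimp only
    rw [faceMap_faceMap, ← pow_add, ← pow_add, Fin.neg_one_pow_succAbove_add_predAbove, neg_smul,
      add_neg_cancel]
  · rintro ⟨i, j⟩ - - h
    exact Fin.succAbove_ne i j (congrArg Prod.fst h)
  · intro _ _
    exact Finset.mem_univ _
  · rintro ⟨i, j⟩ -
    simp [Fin.succAbove_succAbove_predAbove, Fin.predAbove_predAbove_succAbove]

/-! ### Singular cohomology with constant coefficients -/

section Singular

variable (X : Type*) [TopologicalSpace X] (A : Type*) [AddCommGroup A]

/-- Singular `n`-cochains of `X` with values in `A`. -/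
abbrev SingularCochain (n : ℕ) : Type _ := C(Simplex n, X) → A

/-- The singular coboundary `(δc)(σ) = ∑ᵢ (-1)ⁱ c(σ ∘ δᵢ)`. -/
def singularCoboundary (n : ℕ) : SingularCochain X A n →+ SingularCochain X A (n + 1) where
  toFun c σ := ∑ i : Fin (n + 2), (-1 : ℤ) ^ (i : ℕ) • c (σ.comp (faceMap i))
  map_zero' := by
    funext σ
    simp
  map_add' c d := by
    funext σ
    simp [smul_add, Finset.sum_add_distrib]

theorem singularCoboundary_comp (n : ℕ) (c : SingularCochain X A n) :
    singularCoboundary X A (n + 1) (singularCoboundary X A n c) = 0 := by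
  funext σ
  simpa [singularCoboundary, Finset.smul_sum, smul_smul, ContinuousMap.comp_assoc] using
    alternating_sum_eq_zero (fun θ => c (σ.comp θ))

/-- Singular cocycles. -/
def singularCocycles (n : ℕ) : AddSubgroup (SingularCochain X A n) :=
  (singularCoboundary X A n).ker

/-- Singular coboundaries. -/
def singularCoboundaries : (n : ℕ) → AddSubgroup (SingularCochain X A n)
  | 0 => ⊥
  | n + 1 => (singularCoboundary X A n).range

/-- The singular cohomology group `Hⁿ(X; A)`. -/
abbrev SingularCohomology (n : ℕ) : Type _ :=
  singularCocycles X A n ⧸ (singularCoboundaries X A n).addSubgroupOf (singularCocycles X A n)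

end Singular

section Paths

variable {X : Type*} [TopologicalSpace X]

/-- A path regarded as a singular `1`-simplex, with `e₀ ↦ γ(0)` and `e₁ ↦ γ(1)`. -/
def pathSimplex {x y : X} (γ : Path x y) : C(Simplex 1, X) where
  toFun p := γ ⟨p 1, stdSimplex.zero_le p 1, stdSimplex.le_one p 1⟩
  continuous_toFun := γ.continuous.comp
    (Continuous.subtype_mk ((continuous_apply (1 : Fin 2)).comp continuous_subtype_val) _)

variable {A : Type*} [AddCommGroup A]

/-- The cocycle identity on a singular `2`-simplex. -/
theorem cocycle_apply (z : singularCocycles X A 1) (τ : C(Simplex 2, X)) :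
    z.1 (τ.comp (faceMap 0)) + z.1 (τ.comp (faceMap 2)) = z.1 (τ.comp (faceMap 1)) := by
  have h := congrFun (AddMonoidHom.mem_ker.1 z.2) τ
  simp [singularCoboundary, Fin.sum_univ_three] at h
  rw [← sub_eq_zero, ← h]
  abel

theorem faceMap_apply (i : Fin 3) (p : Simplex 1) (k : Fin 3) :
    (faceMap i p : Simplex 2) k = ∑ j : Fin 2, if i.succAbove j = k then p j else 0 := by
  change (stdSimplex.map i.succAbove p) k = _
  rw [stdSimplex.map_coe, FunOnFinite.linearMap_apply_apply, Finset.sum_filter]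

theorem cocycle_refl (z : singularCocycles X A 1) (x : X) :
    z.1 (pathSimplex (Path.refl x)) = 0 := by
  have h := cocycle_apply z (ContinuousMap.const (Simplex 2) x)
  exact add_eq_left.1 h

/-- The cocycle identity on a singular `2`-simplex whose edges are given by paths. -/
theorem cocycle_triangle (z : singularCocycles X A 1) (τ : C(Simplex 2, X)) {a b c : X}
    (γ₀ : Path b c) (γ₁ : Path a c) (γ₂ : Path a b)
    (h₀ : ∀ p, τ (faceMap 0 p) = pathSimplex γ₀ p)
    (h₁ : ∀ p, τ (faceMap 1 p) = pathSimplex γ₁ p)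
    (h₂ : ∀ p, τ (faceMap 2 p) = pathSimplex γ₂ p) :
    z.1 (pathSimplex γ₀) + z.1 (pathSimplex γ₂) = z.1 (pathSimplex γ₁) := by
  have e₀ : τ.comp (faceMap 0) = pathSimplex γ₀ := ContinuousMap.ext h₀
  have e₁ : τ.comp (faceMap 1) = pathSimplex γ₁ := ContinuousMap.ext h₁
  have e₂ : τ.comp (faceMap 2) = pathSimplex γ₂ := ContinuousMap.ext h₂
  rw [← e₀, ← e₁, ← e₂, cocycle_apply]

/-- The coordinate `x₂` on the triangle. -/
def coordTwo : C(Simplex 2, unitInterval) where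
  toFun p := ⟨p 2, stdSimplex.zero_le p 2, stdSimplex.le_one p 2⟩
  continuous_toFun :=
    Continuous.subtype_mk ((continuous_apply (2 : Fin 3)).comp continuous_subtype_val) _

/-- The coordinate `x₁ + x₂` on the triangle. -/
def coordOneTwo : C(Simplex 2, unitInterval) where
  toFun p := ⟨p 1 + p 2, add_nonneg (stdSimplex.zero_le p 1) (stdSimplex.zero_le p 2), by
    have h := stdSimplex.sum_eq_one p
    have h0 := stdSimplex.zero_le p 0
    rw [Fin.sum_univ_three] at h
    linarith⟩
  continuous_toFun :=
    Continuous.subtype_mk (((continuous_apply (1 : Fin 3)).comp continuous_subtype_val).add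
      ((continuous_apply (2 : Fin 3)).comp continuous_subtype_val)) _

/-- The coordinate `x₁ / 2 + x₂` on the triangle. -/
def coordHalf : C(Simplex 2, unitInterval) where
  toFun p := ⟨p 1 / 2 + p 2, add_nonneg (div_nonneg (stdSimplex.zero_le p 1) zero_le_two)
    (stdSimplex.zero_le p 2), by
    have h := stdSimplex.sum_eq_one p
    have h0 := stdSimplex.zero_le p 0
    have h1 := stdSimplex.zero_le p 1
    rw [Fin.sum_univ_three] at h
    linarith⟩
  continuous_toFun :=
    Continuous.subtype_mk ((((continuous_apply (1 : Fin 3)).comp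
      continuous_subtype_val).div_const 2).add
      ((continuous_apply (2 : Fin 3)).comp continuous_subtype_val)) _

theorem cocycle_trans (z : singularCocycles X A 1) {x y w : X} (γ : Path x y) (δ : Path y w) :
    z.1 (pathSimplex (γ.trans δ)) = z.1 (pathSimplex γ) + z.1 (pathSimplex δ) := by
  have h := cocycle_triangle z ((γ.trans δ).toContinuousMap.comp coordHalf) δ (γ.trans δ) γ
    ?_ ?_ ?_
  · rw [← h]
    abel
  · intro p
    have hp := stdSimplex.add_eq_one p
    have h0 := stdSimplex.zero_le p 1
    have e : ((coordHalf (faceMap 0 p) : unitInterval) : ℝ) = p 0 / 2 + p 1 := by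
      simp [coordHalf, faceMap_apply, Fin.sum_univ_two]
    change (γ.trans δ) (coordHalf (faceMap 0 p)) = δ _
    rw [Path.trans_apply]
    split_ifs with hle
    · rw [e] at hle
      have h1 : p 1 = 0 := by linarith
      have h2 : p 0 = 1 := by linarith
      convert γ.target.trans δ.source.symm using 2
      · ext
        simp [e, h1, h2]
      · ext
        simp [h1]
    · congr 1
      ext
      simp only [e]
      linarith
  · intro p
    change (γ.trans δ) (coordHalf (faceMap 1 p)) = (γ.trans δ) _
    congr 1
    ext
    simp [coordHalf, faceMap_apply, Fin.sum_univ_two, Fin.succAbove, Fin.lt_def]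
  · intro p
    have e : ((coordHalf (faceMap 2 p) : unitInterval) : ℝ) = p 1 / 2 := by
      simp [coordHalf, faceMap_apply, Fin.sum_univ_two, Fin.succAbove, Fin.lt_def]
    have h1 := stdSimplex.le_one p 1
    change (γ.trans δ) (coordHalf (faceMap 2 p)) = γ _
    rw [Path.trans_apply, dif_pos (by rw [e]; linarith)]
    congr 1
    ext
    simp only [e]
    linarith

theorem cocycle_homotopic (z : singularCocycles X A 1) {x y : X} {γ δ : Path x y}
    (h : γ.Homotopic δ) : z.1 (pathSimplex γ) = z.1 (pathSimplex δ) := by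
  obtain ⟨F⟩ := h
  let D : Path x y :=
    { toFun := fun t => F (t, t)
      continuous_toFun := by fun_prop
      source' := F.source 0
      target' := F.target 1 }
  have h₁ := cocycle_triangle z
    (F.toContinuousMap.comp (coordOneTwo.prodMk coordTwo)) δ D (Path.refl x) ?_ ?_ ?_
  · have h₂ := cocycle_triangle z
      (F.toContinuousMap.comp (coordTwo.prodMk coordOneTwo)) (Path.refl y) D γ ?_ ?_ ?_
    · rw [cocycle_refl, add_zero] at h₁
      rw [cocycle_refl, zero_add] at h₂
      rw [h₁, h₂]
    · intro p
      have hp := stdSimplex.add_eq_one p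
      change F (coordTwo (faceMap 0 p), coordOneTwo (faceMap 0 p)) = y
      rw [show coordOneTwo (faceMap 0 p) = 1 by
        ext
        simpa [coordOneTwo, faceMap_apply, Fin.sum_univ_two] using hp]
      exact F.target _
    · intro p
      change F (coordTwo (faceMap 1 p), coordOneTwo (faceMap 1 p)) = F (_, _)
      congr 2 <;> ext <;> simp [coordOneTwo, coordTwo, faceMap_apply, Fin.sum_univ_two,
        Fin.succAbove, Fin.lt_def]
    · intro p
      change F (coordTwo (faceMap 2 p), coordOneTwo (faceMap 2 p)) = γ _
      rw [show coordTwo (faceMap 2 p) = 0 by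
        ext
        simp [coordTwo, faceMap_apply, Fin.sum_univ_two, Fin.succAbove, Fin.lt_def]]
      refine (F.apply_zero _).trans ?_
      change γ _ = γ _
      congr 1
      ext
      simp [coordOneTwo, faceMap_apply, Fin.sum_univ_two, Fin.succAbove, Fin.lt_def]
  · intro p
    have hp := stdSimplex.add_eq_one p
    change F (coordOneTwo (faceMap 0 p), coordTwo (faceMap 0 p)) = δ _
    rw [show coordOneTwo (faceMap 0 p) = 1 by
      ext
      simpa [coordOneTwo, faceMap_apply, Fin.sum_univ_two] using hp]
    refine (F.apply_one _).trans ?_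
    change δ _ = δ _
    congr 1
    ext
    simp [coordTwo, faceMap_apply, Fin.sum_univ_two]
  · intro p
    change F (coordOneTwo (faceMap 1 p), coordTwo (faceMap 1 p)) = F (_, _)
    congr 2 <;> ext <;> simp [coordOneTwo, coordTwo, faceMap_apply, Fin.sum_univ_two,
      Fin.succAbove, Fin.lt_def]
  · intro p
    change F (coordOneTwo (faceMap 2 p), coordTwo (faceMap 2 p)) = x
    rw [show coordTwo (faceMap 2 p) = 0 by
      ext
      simp [coordTwo, faceMap_apply, Fin.sum_univ_two, Fin.succAbove, Fin.lt_def]]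
    exact F.source _

/-- The value of a `1`-cocycle on a homotopy class of paths. -/
def cocycleValue (z : singularCocycles X A 1) {x y : X} (γ : Path.Homotopic.Quotient x y) : A :=
  Quotient.lift (fun γ : Path x y => z.1 (pathSimplex γ)) (fun _ _ h => cocycle_homotopic z h) γ

theorem coboundary_loop (c : SingularCochain X A 0) {x : X} (γ : Path x x) :
    singularCoboundary X A 0 c (pathSimplex γ) = 0 := by
  have e : (pathSimplex γ).comp (faceMap 0) = (pathSimplex γ).comp (faceMap 1) := by
    ext p
    have hp : p = vertexZero 0 := Subsingleton.elim _ _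
    have h (i : Fin 2) : (faceMap i p : Simplex 1) = stdSimplex.vertex (i.succAbove 0) := by
      rw [hp]
      exact stdSimplex.map_vertex _ _
    change pathSimplex γ (faceMap 0 p) = pathSimplex γ (faceMap 1 p)
    rw [h 0, h 1]
    have h0 : pathSimplex γ (stdSimplex.vertex 0) = x := by
      refine Eq.trans ?_ γ.source
      change γ _ = γ _
      congr 1
    have h1 : pathSimplex γ (stdSimplex.vertex 1) = x := by
      refine Eq.trans ?_ γ.target
      change γ _ = γ _
      congr 1
    exact h1.trans h0.symm
  simp [singularCoboundary, Fin.sum_univ_two, e]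

/-- The pairing `⟨ξ, γ⟩` of a class `ξ ∈ H¹(X; A)` with a loop `γ`: the value of any cocycle
representing `ξ` on the loop. -/
def pairing (ξ : SingularCohomology X A 1) {x : X} (γ : Path x x) : A :=
  QuotientAddGroup.lift _
    ((Pi.evalAddMonoidHom (fun _ : C(Simplex 1, X) => A) (pathSimplex γ)).comp
      (singularCocycles X A 1).subtype)
    (by
      rintro z ⟨c, hc⟩
      change z.1 (pathSimplex γ) = 0
      rw [show z.1 = singularCoboundary X A 0 c from hc.symm]
      exact coboundary_loop c γ) ξ

theorem pairing_mk (z : singularCocycles X A 1) {x : X} (γ : Path x x) :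
    pairing (QuotientAddGroup.mk z) γ = z.1 (pathSimplex γ) := rfl

end Paths

/-! ### Local systems and their cohomology -/

section LocalSystem

variable {X : Type*} [TopologicalSpace X]

/-- A flat complex vector bundle on `X`, given by its parallel transport: a functor from the
fundamental groupoid of `X` to complex vector spaces. -/
abbrev FlatBundle (X : Type*) [TopologicalSpace X] : Type _ :=
  FundamentalGroupoid X ⥤ ModuleCat.{0} ℂ

/-- Parallel transport along a path. -/
def FlatBundle.transport (E : FlatBundle X) {x y : X} (γ : Path x y) :
    E.obj ⟨x⟩ →ₗ[ℂ] E.obj ⟨y⟩ :=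
  (E.map (X := ⟨x⟩) (Y := ⟨y⟩) (Path.Homotopic.Quotient.mk γ)).hom

theorem FlatBundle.transport_homotopic (E : FlatBundle X) {x y : X} {γ δ : Path x y}
    (h : γ.Homotopic δ) : E.transport γ = E.transport δ := by
  unfold FlatBundle.transport
  rw [Path.Homotopic.Quotient.eq.2 h]

theorem FlatBundle.transport_trans (E : FlatBundle X) {x y w : X} (γ : Path x y) (δ : Path y w)
    (v : E.obj ⟨x⟩) : E.transport (γ.trans δ) v = E.transport δ (E.transport γ v) := by
  have h := E.map_comp (X := ⟨x⟩) (Y := ⟨y⟩) (Z := ⟨w⟩) (Path.Homotopic.Quotient.mk γ)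
    (Path.Homotopic.Quotient.mk δ)
  exact congrArg (fun f => f.hom v) h

/-- Singular `n`-cochains with values in `E`: they assign to a singular simplex `s` a vector in the
fibre of `E` over the initial vertex of `s`. -/
abbrev FlatBundle.Cochain (E : FlatBundle X) (n : ℕ) : Type _ :=
  (s : C(Simplex n, X)) → E.obj ⟨s (vertexZero n)⟩

/-- The coboundary `(δc)(s) = ∑ᵢ (-1)ⁱ c(s ∘ δᵢ)`, where the value of `c` at the `i`-th face is
transported, inside the simplex `s`, from the initial vertex of the face to that of `s`
(only for `i = 0` do they differ). -/
def FlatBundle.coboundary (E : FlatBundle X) (n : ℕ) : E.Cochain n →ₗ[ℂ] E.Cochain (n + 1) where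
  toFun c s := ∑ i : Fin (n + 2), (-1 : ℤ) ^ (i : ℕ) •
    E.transport ((segmentPath (faceMap i (vertexZero n)) (vertexZero (n + 1))).map s.continuous)
      (c (s.comp (faceMap i)))
  map_add' c d := by
    funext s
    simp [smul_add, Finset.sum_add_distrib]
  map_smul' r c := by
    funext s
    simp [Finset.smul_sum, smul_comm r]

theorem FlatBundle.coboundary_comp (E : FlatBundle X) (n : ℕ) (c : E.Cochain n) :
    E.coboundary (n + 1) (E.coboundary n c) = 0 := by
  funext s
  have key := alternating_sum_eq_zero (n := n) (fun θ => E.transport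
    ((segmentPath (θ (vertexZero n)) (vertexZero (n + 2))).map s.continuous) (c (s.comp θ)))
  refine Eq.trans ?_ key
  simp only [FlatBundle.coboundary, LinearMap.coe_mk, AddHom.coe_mk, map_sum, map_zsmul,
    Finset.smul_sum, smul_smul]
  refine Finset.sum_congr rfl fun i _ => Finset.sum_congr rfl fun j _ => ?_
  congr 1
  refine (E.transport_trans _ _ _).symm.trans ?_
  have h : ((segmentPath (faceMap j (vertexZero n)) (vertexZero (n + 1))).map
      (s.comp (faceMap i)).continuous).trans
      ((segmentPath (faceMap i (vertexZero (n + 1))) (vertexZero (n + 2))).map s.continuous) =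
      (((segmentPath (faceMap j (vertexZero n)) (vertexZero (n + 1))).map
        (faceMap i).continuous).trans
        (segmentPath (faceMap i (vertexZero (n + 1))) (vertexZero (n + 2)))).map s.continuous := by
    rw [Path.map_trans]
    rfl
  have h' := E.transport_homotopic ((SimplyConnectedSpace.paths_homotopic
    (((segmentPath (faceMap j (vertexZero n)) (vertexZero (n + 1))).map
        (faceMap i).continuous).trans
        (segmentPath (faceMap i (vertexZero (n + 1))) (vertexZero (n + 2))))
    (segmentPath (faceMap i (faceMap j (vertexZero n))) (vertexZero (n + 2)))).map s)
  rw [← h] at h'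
  exact congrArg (fun f : E.obj ⟨s (faceMap i (faceMap j (vertexZero n)))⟩ →ₗ[ℂ]
    E.obj ⟨s (vertexZero (n + 2))⟩ => f (c (s.comp ((faceMap i).comp (faceMap j))))) h'

/-- Cocycles with values in `E`. -/
def FlatBundle.cocycles (E : FlatBundle X) (n : ℕ) : Submodule ℂ (E.Cochain n) :=
  (E.coboundary n).ker

/-- Coboundaries with values in `E`. -/
def FlatBundle.coboundaries (E : FlatBundle X) : (n : ℕ) → Submodule ℂ (E.Cochain n)
  | 0 => ⊥
  | n + 1 => (E.coboundary n).range

/-- The cohomology `Hⁿ(X; E)` of `X` with coefficients in the flat bundle `E`. -/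
abbrev FlatBundle.Cohomology (E : FlatBundle X) (n : ℕ) : Type _ :=
  E.cocycles n ⧸ (E.coboundaries n).submoduleOf (E.cocycles n)

/-- The flat line bundle `E_a` of a class `ξ ∈ H¹(X; ℤ)` and a nonzero complex number `a`. Its
fibres are `ℂ`; its parallel transport along a path `γ` is the multiplication by `a ^ z(γ)`, where
`z` is a cocycle representing `ξ`. Its monodromy is computed in `flatLineBundle_monodromy`. -/
def flatLineBundle (ξ : SingularCohomology X ℤ 1) (a : ℂˣ) : FlatBundle X where
  obj _ := ModuleCat.of ℂ ℂ
  map γ := ModuleCat.ofHom (LinearMap.lsmul ℂ ℂ ((a ^ cocycleValue ξ.out γ : ℂˣ) : ℂ))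
  map_id x := by
    have h : cocycleValue ξ.out (𝟙 x) = 0 := cocycle_refl ξ.out x.as
    rw [h]
    ext
    simp
  map_comp {x y w} γ δ := by
    have h : cocycleValue ξ.out (γ ≫ δ) = cocycleValue ξ.out γ + cocycleValue ξ.out δ := by
      obtain ⟨γ⟩ := γ
      obtain ⟨δ⟩ := δ
      exact cocycle_trans ξ.out γ δ
    rw [h, zpow_add]
    ext
    simp [mul_comm]

/-- The monodromy of `E_a` along any loop `γ` is the multiplication by `a ^ ⟨ξ, γ⟩`. -/
theorem flatLineBundle_monodromy (ξ : SingularCohomology X ℤ 1) (a : ℂˣ) {x : X} (γ : Path x x)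
    (v : ℂ) : (flatLineBundle ξ a).transport γ v = (a : ℂ) ^ pairing ξ γ * v := by
  have h : pairing ξ γ = ξ.out.1 (pathSimplex γ) := by
    conv_lhs => rw [← QuotientAddGroup.out_eq' ξ]
    rfl
  rw [h, ← Units.val_zpow_eq_zpow_val]
  rfl

end LocalSystem

/-- A Dirichlet unit: a nonzero complex number such that it and its inverse are algebraic
integers. -/
def IsDirichletUnit (b : ℂ) : Prop :=
  b ≠ 0 ∧ IsIntegral ℤ b ∧ IsIntegral ℤ b⁻¹

/-! ### Closed one-forms on manifolds -/

section OneForm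

variable {n : ℕ} {X : Type*} [TopologicalSpace X] [ChartedSpace (EuclideanSpace ℝ (Fin n)) X]
  [IsManifold (𝓡 n) ∞ X]

/-- Smooth one-forms: smooth sections of the cotangent bundle. -/
abbrev OneForm (n : ℕ) (X : Type*) [TopologicalSpace X]
    [ChartedSpace (EuclideanSpace ℝ (Fin n)) X] [IsManifold (𝓡 n) ∞ X] : Type _ :=
  Cₛ^∞⟮𝓡 n; EuclideanSpace ℝ (Fin n) →L[ℝ] ℝ,
    fun x : X => TangentSpace (𝓡 n) x →L[ℝ] Bundle.Trivial X ℝ x⟯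

/-- The coordinate expression of a one-form in the preferred chart at `x₀`: its pullback under the
inverse of the chart. -/
def OneForm.inChart (θ : OneForm n X) (x₀ : X) (y : EuclideanSpace ℝ (Fin n)) :
    EuclideanSpace ℝ (Fin n) →L[ℝ] ℝ :=
  (θ ((extChartAt (𝓡 n) x₀).symm y)).comp
    (mfderiv (𝓡 n) (𝓡 n) (extChartAt (𝓡 n) x₀).symm y)

/-- A one-form is closed if `dθ = 0` in the charts, where
`dθ(u, v) = (∂_u θ)(v) - (∂_v θ)(u)`. -/
def OneForm.IsClosed (θ : OneForm n X) : Prop :=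
  ∀ x₀ : X, ∀ y ∈ (extChartAt (𝓡 n) x₀).target, ∀ u v : EuclideanSpace ℝ (Fin n),
    fderiv ℝ (θ.inChart x₀) y u v - fderiv ℝ (θ.inChart x₀) y v u = 0

/-- The integral `∫_γ θ` of a one-form along a smooth path. -/
def OneForm.pathIntegral (θ : OneForm n X) {x y : X} (γ : Path x y) : ℝ :=
  ∫ t in (0 : ℝ)..1, θ (γ.extend t)
    (mfderivWithin 𝓘(ℝ, ℝ) (𝓡 n) γ.extend (Set.Icc 0 1) t (1 : ℝ))

/-- A smooth path in `X`. -/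
def IsSmoothPath (n : ℕ) {X : Type*} [TopologicalSpace X]
    [ChartedSpace (EuclideanSpace ℝ (Fin n)) X] {x y : X} (γ : Path x y) : Prop :=
  ContMDiffOn 𝓘(ℝ, ℝ) (𝓡 n) ∞ γ.extend (Set.Icc 0 1)

/-- The closed form `θ` lies in the integral class `ξ`: the de Rham class of `θ` is the image of
`ξ` in `H¹(X; ℝ) = Hom(H₁(X), ℝ)`, that is, the period of `θ` along every smooth loop `γ` is
`⟨ξ, γ⟩`. -/
def OneForm.LiesIn (θ : OneForm n X) (ξ : SingularCohomology X ℤ 1) : Prop :=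
  ∀ (x : X) (γ : Path x x), IsSmoothPath n γ → θ.pathIntegral γ = ((pairing ξ γ : ℤ) : ℝ)

/-- The point `p` is a critical point of `θ`, that is, `θ_p = 0`. -/
def OneForm.IsCriticalPoint (θ : OneForm n X) (p : X) : Prop := θ p = 0

end OneForm

end FlatLine

end

/-!
If `θ` has no zeros, then `X` can be pushed upwards along `θ`: there are homotopies of the identity
along whose tracks the integral of `θ` is as large as one likes. A cohomology class with values in
`E_a` is unchanged by such a push, whereas transport along a track on which the cocycle `z` of `ξ`
takes the value `m` is multiplication by `a ^ m`. Hence every class is divisible by a high power of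
`a⁻¹` (or, pushing downwards, of `a`) inside a lattice of classes with values in `ℤ[a⁻¹]`, and this
is impossible for a nonzero class unless `a` is integral (respectively, `a⁻¹` is). To say that `a`
is no Dirichlet unit is to say that one of the two fails.

In detail, let `z` be a singular cocycle in the class `ξ`, let `b` be a nonzero complex number, and
let the twisted complex be that of cochains with values in the line bundle with transport `b ^ z`.
The complexes of `(z, b)` and `(-z, b⁻¹)` coincide, so it suffices to show that it is acyclic if `b`
is not integral (`mem_twistedBoundaries`). Four ingredients are combined.

* Height charts. Near each point `θ` has a primitive, by the Poincaré lemma, and it increases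
  strictly in a constant direction, since `θ` does not vanish. That the periods of `θ` are those of
  `ξ` means that the integral of `θ` along smooth paths is `z - δg` for some function `g` on points,
  and all that is used of `θ` in the sequel is recorded in the structure `HeightChart`. Moves inside
  charts, repeated along a finite cover of `X`, lift all points by any given amount
  (`exists_raise`).

* Straightening. By linear interpolation in charts, a small singular simplex is deformed, naturally
  with respect to faces and with bounded rise, to one that depends only on the points of a finite
  net next to its vertices (`exists_isStraightening_univ`). So a cocycle is cohomologous, on small
  simplices, to one which is determined by its values on finitely many simplices.

* Extension from small simplices. A cocycle on small simplices extends to all simplices, and a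
  cocycle that bounds on small simplices bounds (`exists_extension`). The extension is obtained by
  iterated subdivision; its value on a simplex `σ` is an integral combination of the transported
  values on affine subsimplices of `σ`. Subdivision and the prism operator are both instances of
  `coneOperator`.

* Algebra. Consider the classes of the cocycles whose values on the finitely many straight simplices
  lie in a fixed finitely generated `ℤ[b⁻¹]`-submodule of `ℂ`; they form a finitely generated
  module `Q`. Pulling a cocycle back by a sufficiently high push, straightening and extending shows
  `Q = b⁻¹ Q`, because the exponents that occur are large compared to the bounded errors. If `Q`
  were nonzero, Nakayama's lemma would give a relation making `b` integral
  (`class_eq_zero_of_lattice`).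

This argument needs neither the finite generation of the homology of `X` nor a fibration over the
circle.
-/

noncomputable section

namespace FlatLine

/-! ### Cochains on tuples of points and cone operators -/

section Tuples

variable {R M : Type*} [CommRing R] [AddCommGroup M] [Module R M] {K L K' L' : Type*}

/-- The alternating sum over the faces of a tuple of points: the coboundary of the function `κ` on
`(n + 1)`-tuples, that is, on ordered `n`-simplices with vertices in `L`. -/
def tupleCoboundary {n : ℕ} (κ : (Fin (n + 1) → L) → M) (v : Fin (n + 2) → L) : M :=
  ∑ i : Fin (n + 2), (-1 : ℤ) ^ (i : ℕ) • κ (v ∘ i.succAbove)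

theorem tupleCoboundary_sub {n : ℕ} (κ κ' : (Fin (n + 1) → L) → M) :
    tupleCoboundary (κ - κ') = tupleCoboundary κ - tupleCoboundary κ' := by
  funext v
  simp [tupleCoboundary, smul_sub, Finset.sum_sub_distrib]

theorem tupleCoboundary_tupleCoboundary {n : ℕ} (κ : (Fin (n + 1) → L) → M) :
    tupleCoboundary (tupleCoboundary κ) = 0 := by
  funext v
  simp only [tupleCoboundary, Finset.smul_sum, smul_smul, Pi.zero_apply]
  rw [← Fintype.sum_prod_type']
  refine Finset.sum_involution (fun p _ => (p.1.succAbove p.2, p.2.predAbove p.1)) ?_ ?_ ?_ ?_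
  · rintro ⟨i, j⟩ -
    dsimp only
    have h : (v ∘ (i.succAbove j).succAbove) ∘ (j.predAbove i).succAbove =
        (v ∘ i.succAbove) ∘ j.succAbove := by
      funext k
      simp [Fin.succAbove_succAbove_succAbove_predAbove]
    rw [h, ← pow_add, ← pow_add, Fin.neg_one_pow_succAbove_add_predAbove, neg_smul,
      add_neg_cancel]
  · rintro ⟨i, j⟩ - - h
    exact Fin.succAbove_ne i j (congrArg Prod.fst h)
  · intro _ _
    exact Finset.mem_univ _
  · rintro ⟨i, j⟩ -
    simp [Fin.succAbove_succAbove_predAbove, Fin.predAbove_predAbove_succAbove]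

theorem tupleCoboundary_zero_apply (κ : (Fin 1 → L) → M) (v : Fin 2 → L) :
    tupleCoboundary κ v = κ (fun _ => v 1) - κ fun _ => v 0 := by
  change ∑ i : Fin 2, (-1 : ℤ) ^ (i : ℕ) • κ (v ∘ i.succAbove) = _
  rw [Fin.sum_univ_two, sub_eq_add_neg, Fin.val_zero, pow_zero, one_smul, Fin.val_one, pow_one,
    neg_smul, one_smul]
  have e (i : Fin 2) : v ∘ i.succAbove = fun _ => v (i.succAbove 0) := by
    funext j
    rw [Subsingleton.elim j 0]
    rfl
  rw [e, e]
  rfl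

variable (R M) in
/-- The dual of the cone operator: the value of a function on the cone with apex `p` over a
tuple. -/
def coneDual {n : ℕ} (p : L) : ((Fin (n + 2) → L) → M) →ₗ[R] ((Fin (n + 1) → L) → M) where
  toFun κ w := κ (Fin.cons p w)
  map_add' _ _ := rfl
  map_smul' _ _ := rfl

theorem coneDual_tupleCoboundary {n : ℕ} (p : L) (κ : (Fin (n + 2) → L) → M) :
    coneDual R M p (tupleCoboundary κ) = κ - tupleCoboundary (coneDual R M p κ) := by
  funext w
  simp only [coneDual, LinearMap.coe_mk, AddHom.coe_mk, tupleCoboundary, Pi.sub_apply]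
  rw [Fin.sum_univ_succ, sub_eq_add_neg, ← Finset.sum_neg_distrib]
  congr 1
  · simp only [Fin.val_zero, pow_zero, one_smul]
    congr 1
  · refine Finset.sum_congr rfl fun i _ => ?_
    rw [Fin.val_succ, pow_succ, mul_neg_one, neg_smul]
    congr 3
    funext j
    refine Fin.cases ?_ (fun j => ?_) j
    · simp
    · simp [Fin.succ_succAbove_succ]

theorem coneDual_tupleCoboundary_zero (p : L) (κ : (Fin 1 → L) → M) :
    coneDual R M p (tupleCoboundary κ) = κ - fun _ => κ (fun _ => p) := by
  funext w
  change tupleCoboundary κ (Fin.cons p w) = κ w - κ fun _ => p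
  rw [tupleCoboundary_zero_apply]
  congr 2
  funext j
  rw [Subsingleton.elim j 0]
  rfl

/-- The operator of degree `-1` on cochains that is dual to `Q(v) = cone_{p(v)} (ψ(v) - Q(∂v))`,
where `p(v)` is a chosen apex and `ψ` is (dual to) an operator of degree `0`. With `ψ = i₁ - i₀` it is
the prism operator, with `ψ = id` and barycentres as apices the subdivision homotopy. -/
def coneOperator (ψ : ∀ n, (Fin (n + 1) → K) → (((Fin (n + 1) → L) → M) →ₗ[R] M))
    (apex : ∀ n, (Fin (n + 1) → K) → L) :
    ∀ n, (Fin (n + 1) → K) → (((Fin (n + 2) → L) → M) →ₗ[R] M)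
  | 0, v => ψ 0 v ∘ₗ coneDual R M (apex 0 v)
  | n + 1, v => (ψ (n + 1) v - ∑ i : Fin (n + 2), (-1 : ℤ) ^ (i : ℕ) •
      coneOperator ψ apex n (v ∘ i.succAbove)) ∘ₗ coneDual R M (apex (n + 1) v)

/-- The operator `ψ - ∂Q - Q∂` of degree `0`, where `Q` is `coneOperator ψ apex`, in the form
`v ↦ cone_{p(v)} ∘ ∂`. -/
def coneRemainder (ψ : ∀ n, (Fin (n + 1) → K) → (((Fin (n + 1) → L) → M) →ₗ[R] M))
    (apex : ∀ n, (Fin (n + 1) → K) → L) :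
    ∀ n, (Fin (n + 1) → K) → (((Fin (n + 1) → L) → M) →ₗ[R] M)
  | 0, v => { toFun := fun κ => ψ 0 v (fun _ => κ (fun _ => apex 0 v))
              map_add' := fun κ κ' => (ψ 0 v).map_add (fun _ => κ _) (fun _ => κ' _)
              map_smul' := fun r κ => (ψ 0 v).map_smul r (fun _ => κ _) }
  | n + 1, v => (∑ i : Fin (n + 2), (-1 : ℤ) ^ (i : ℕ) •
      coneRemainder ψ apex n (v ∘ i.succAbove)) ∘ₗ coneDual R M (apex (n + 1) v)

variable (ψ : ∀ n, (Fin (n + 1) → K) → (((Fin (n + 1) → L) → M) →ₗ[R] M))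
  (apex : ∀ n, (Fin (n + 1) → K) → L)

theorem coneOperator_zero_add (v : Fin 1 → K) (κ : (Fin 1 → L) → M) :
    coneOperator ψ apex 0 v (tupleCoboundary κ) = ψ 0 v κ - coneRemainder ψ apex 0 v κ := by
  simp only [coneOperator, LinearMap.comp_apply, coneDual_tupleCoboundary_zero, map_sub]
  rfl

theorem coneOperator_succ_apply (n : ℕ) (v : Fin (n + 2) → K) (κ : (Fin (n + 3) → L) → M) :
    coneOperator ψ apex (n + 1) v κ = ψ (n + 1) v (coneDual R M (apex (n + 1) v) κ) -
      tupleCoboundary (fun w => coneOperator ψ apex n w (coneDual R M (apex (n + 1) v) κ)) v := by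
  simp [coneOperator, tupleCoboundary]

theorem coneRemainder_succ_apply (n : ℕ) (v : Fin (n + 2) → K) (κ : (Fin (n + 2) → L) → M) :
    coneRemainder ψ apex (n + 1) v κ =
      tupleCoboundary (fun w => coneRemainder ψ apex n w (coneDual R M (apex (n + 1) v) κ)) v := by
  simp [coneRemainder, tupleCoboundary]

/-- The homotopy formula `∂Q + Q∂ = ψ - (ψ - ∂Q - Q∂)` for the cone operators. -/
theorem coneOperator_homotopy
    (hψ : ∀ n (v : Fin (n + 2) → K) (κ : (Fin (n + 1) → L) → M),
      ψ (n + 1) v (tupleCoboundary κ) = tupleCoboundary (fun w => ψ n w κ) v) (n : ℕ) :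
    ∀ (v : Fin (n + 2) → K) (κ : (Fin (n + 2) → L) → M),
      tupleCoboundary (fun w => coneOperator ψ apex n w κ) v +
        coneOperator ψ apex (n + 1) v (tupleCoboundary κ) =
      ψ (n + 1) v κ - coneRemainder ψ apex (n + 1) v κ := by
  induction n with
  | zero =>
    intro v κ
    rw [coneOperator_succ_apply, coneRemainder_succ_apply, coneDual_tupleCoboundary, map_sub, hψ]
    set c := coneDual R M (apex 1 v) κ
    have e : (fun w => coneOperator ψ apex 0 w (κ - tupleCoboundary c)) =
        (fun w => coneOperator ψ apex 0 w κ) - ((fun w => ψ 0 w c) -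
          fun w => coneRemainder ψ apex 0 w c) := by
      funext w
      simp only [map_sub, Pi.sub_apply, coneOperator_zero_add]
    rw [e]
    simp only [tupleCoboundary_sub, Pi.sub_apply]
    abel
  | succ n ih =>
    intro v κ
    rw [coneOperator_succ_apply, coneRemainder_succ_apply, coneDual_tupleCoboundary, map_sub, hψ]
    set c := coneDual R M (apex (n + 2) v) κ
    have e : (fun w => coneOperator ψ apex (n + 1) w (κ - tupleCoboundary c)) =
        (fun w => coneOperator ψ apex (n + 1) w κ) - ((fun w => ψ (n + 1) w c) -
          (fun w => coneRemainder ψ apex (n + 1) w c) -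
          tupleCoboundary (fun w => coneOperator ψ apex n w c)) := by
      funext w
      simp only [map_sub, Pi.sub_apply, ← ih w c]
      abel
    rw [e]
    simp only [tupleCoboundary_sub, Pi.sub_apply, tupleCoboundary_tupleCoboundary]
    simp only [Pi.zero_apply]
    abel

variable {ψ apex}

/-- Cone operators are natural under maps that respect the data `ψ` and the apices. -/
theorem coneOperator_comp {ψ' : ∀ n, (Fin (n + 1) → K') → (((Fin (n + 1) → L') → M) →ₗ[R] M)}
    {apex' : ∀ n, (Fin (n + 1) → K') → L'} (A : K → K') (B : L → L')
    (hap : ∀ n v, apex' n (A ∘ v) = B (apex n v))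
    (hψ : ∀ n v (κ : (Fin (n + 1) → L') → M), ψ' n (A ∘ v) κ = ψ n v (fun w => κ (B ∘ w)))
    (n : ℕ) : ∀ (v : Fin (n + 1) → K) (κ : (Fin (n + 2) → L') → M),
      coneOperator ψ' apex' n (A ∘ v) κ = coneOperator ψ apex n v (fun w => κ (B ∘ w)) := by
  have hc (n : ℕ) (p : L) (κ : (Fin (n + 2) → L') → M) :
      (fun w => coneDual R M (B p) κ (B ∘ w)) = coneDual R M p (fun w => κ (B ∘ w)) := by
    funext w
    exact congrArg κ (Fin.comp_cons B p w).symm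
  induction n with
  | zero =>
    intro v κ
    simp only [coneOperator, LinearMap.comp_apply, hap, hψ]
    rw [hc]
  | succ n ih =>
    intro v κ
    rw [coneOperator_succ_apply, coneOperator_succ_apply, hap, hψ, hc]
    congr 1
    refine Finset.sum_congr rfl fun i _ => ?_
    dsimp only
    rw [Function.comp_assoc, ih, hc]

/-- If `ψ` respects additive subgroups, then the values of the cone operator on a cochain lie in the
subgroup generated by the values of the cochain. -/
theorem coneOperator_mem (N : AddSubgroup M)
    (hψ : ∀ n v (κ : (Fin (n + 1) → L) → M), (∀ w, κ w ∈ N) → ψ n v κ ∈ N) (n : ℕ) :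
    ∀ (v : Fin (n + 1) → K) (κ : (Fin (n + 2) → L) → M), (∀ w, κ w ∈ N) →
      coneOperator ψ apex n v κ ∈ N := by
  induction n with
  | zero =>
    intro v κ h
    exact hψ _ _ _ fun w => h _
  | succ n ih =>
    intro v κ h
    rw [coneOperator_succ_apply]
    refine N.sub_mem (hψ _ _ _ fun w => h _) (N.sum_mem fun i _ => N.zsmul_mem (ih _ _ ?_) _)
    exact fun w => h _

/-- The tuples that occur in the iterated cone `v ↦ cone_{p(v)} ∘ ∂`; for barycentres as apices
these are the simplices of the barycentric subdivision. -/
inductive IsSubdivision (apex : ∀ n, (Fin (n + 1) → K) → K) :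
    ∀ n, (Fin (n + 1) → K) → (Fin (n + 1) → K) → Prop
  | zero (v : Fin 1 → K) : IsSubdivision apex 0 (fun _ => apex 0 v) v
  | succ (n : ℕ) (v : Fin (n + 2) → K) (i : Fin (n + 2)) (w : Fin (n + 1) → K) :
      IsSubdivision apex n w (v ∘ i.succAbove) →
      IsSubdivision apex (n + 1) (Fin.cons (apex (n + 1) v) w) v

/-- The remainder of the cone operator vanishes on cochains that vanish on the subdivision. -/
theorem coneRemainder_eq_zero {a : ∀ n, (Fin (n + 1) → K) → K} (j : K → L)
    (hψ : ∀ v (κ : (Fin 1 → L) → M), ψ 0 v κ = κ (j ∘ v))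
    (hap : ∀ n v, apex n v = j (a n v)) (n : ℕ) :
    ∀ (v : Fin (n + 1) → K) (κ : (Fin (n + 1) → L) → M),
      (∀ w, IsSubdivision a n w v → κ (j ∘ w) = 0) → coneRemainder ψ apex n v κ = 0 := by
  induction n with
  | zero =>
    intro v κ h
    simp only [coneRemainder, LinearMap.coe_mk, AddHom.coe_mk, hψ, hap]
    exact h _ (.zero v)
  | succ n ih =>
    intro v κ h
    rw [coneRemainder_succ_apply]
    refine Finset.sum_eq_zero fun i _ => ?_
    dsimp only
    rw [ih, smul_zero]
    intro w hw
    have := h _ (.succ n v i w hw)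
    rwa [Fin.comp_cons, ← hap] at this

/-- The remainder of the cone operator vanishes if `ψ` kills constants in degree `0`. -/
theorem coneRemainder_eq_zero_of_const (hψ : ∀ v (m : M), ψ 0 v (fun _ => m) = 0) (n : ℕ) :
    ∀ (v : Fin (n + 1) → K) (κ : (Fin (n + 1) → L) → M), coneRemainder ψ apex n v κ = 0 := by
  induction n with
  | zero => exact fun v κ => hψ _ _
  | succ n ih =>
    intro v κ
    rw [coneRemainder_succ_apply]
    simp [ih, tupleCoboundary]

end Tuples

/-! ### Affine simplices -/

section Affine

/-- The affine singular simplex of `Δⁿ` with the given vertices. -/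
def affineSimplex {m n : ℕ} (v : Fin (m + 1) → Simplex n) : C(Simplex m, Simplex n) where
  toFun t := ⟨fun k => ∑ i, t i * v i k,
    fun k => Finset.sum_nonneg fun i _ => mul_nonneg (stdSimplex.zero_le t i)
      (stdSimplex.zero_le (v i) k), by
    rw [Finset.sum_comm]
    simp_rw [← Finset.mul_sum, stdSimplex.sum_eq_one, mul_one]
    exact stdSimplex.sum_eq_one t⟩
  continuous_toFun := by
    refine Continuous.subtype_mk (continuous_pi fun k => continuous_finsetSum _ fun i _ => ?_) _
    exact ((continuous_apply i).comp continuous_subtype_val).mul continuous_const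

theorem affineSimplex_apply {m n : ℕ} (v : Fin (m + 1) → Simplex n) (t : Simplex m)
    (k : Fin (n + 1)) : affineSimplex v t k = ∑ i, t i * v i k := rfl

theorem stdSimplex_vertex_apply {n : ℕ} (i j : Fin (n + 1)) :
    (stdSimplex.vertex i : Simplex n) j = if j = i then 1 else 0 := by
  change (Pi.single i (1 : ℝ) : Fin (n + 1) → ℝ) j = _
  rw [Pi.single_apply]

/-- The tuple of the vertices of the standard simplex. -/
def vertices (n : ℕ) : Fin (n + 1) → Simplex n := fun i => stdSimplex.vertex i

theorem affineSimplex_vertex {m n : ℕ} (v : Fin (m + 1) → Simplex n) (i : Fin (m + 1)) :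
    affineSimplex v (stdSimplex.vertex i) = v i := by
  ext k
  change affineSimplex v (stdSimplex.vertex i) k = v i k
  simp [affineSimplex_apply, stdSimplex_vertex_apply]

theorem affineSimplex_vertices (n : ℕ) : affineSimplex (vertices n) = ContinuousMap.id _ := by
  ext t k
  change affineSimplex (vertices n) t k = t k
  simp [affineSimplex_apply, vertices, stdSimplex_vertex_apply]

theorem affineSimplex_affineSimplex {l m n : ℕ} (v : Fin (m + 1) → Simplex n)
    (w : Fin (l + 1) → Simplex m) (t : Simplex l) :
    affineSimplex v (affineSimplex w t) = affineSimplex (affineSimplex v ∘ w) t := by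
  ext k
  change affineSimplex v (affineSimplex w t) k = affineSimplex (affineSimplex v ∘ w) t k
  simp only [affineSimplex_apply, Finset.sum_mul, Finset.mul_sum, Function.comp_apply]
  rw [Finset.sum_comm]
  simp only [mul_assoc]

theorem affineSimplex_comp_affineSimplex {l m n : ℕ} (v : Fin (m + 1) → Simplex n)
    (w : Fin (l + 1) → Simplex m) :
    (affineSimplex v).comp (affineSimplex w) = affineSimplex (affineSimplex v ∘ w) :=
  ContinuousMap.ext fun t => affineSimplex_affineSimplex v w t

theorem faceMap_eq_affineSimplex {n : ℕ} (i : Fin (n + 2)) :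
    faceMap i = affineSimplex (vertices (n + 1) ∘ i.succAbove) := by
  ext t k
  change (stdSimplex.map i.succAbove t) k = affineSimplex (vertices (n + 1) ∘ i.succAbove) t k
  rw [stdSimplex.map_coe, FunOnFinite.linearMap_apply_apply, Finset.sum_filter]
  simp [affineSimplex_apply, vertices, stdSimplex_vertex_apply, eq_comm]

theorem affineSimplex_comp_faceMap {m n : ℕ} (v : Fin (m + 2) → Simplex n) (i : Fin (m + 2)) :
    (affineSimplex v).comp (faceMap i) = affineSimplex (v ∘ i.succAbove) := by
  rw [faceMap_eq_affineSimplex, affineSimplex_comp_affineSimplex]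
  congr 1
  funext j
  exact affineSimplex_vertex v _

theorem faceMap_vertices {n : ℕ} (i : Fin (n + 2)) :
    faceMap i ∘ vertices n = vertices (n + 1) ∘ i.succAbove := by
  funext j
  rw [faceMap_eq_affineSimplex]
  exact affineSimplex_vertex _ _

/-- The barycentre of a tuple of points of `Δⁿ`. -/
def tupleBarycenter {n : ℕ} (m : ℕ) (v : Fin (m + 1) → Simplex n) : Simplex n :=
  affineSimplex v stdSimplex.barycenter

theorem tupleBarycenter_comp {n l : ℕ} (m : ℕ) (u : Fin (n + 1) → Simplex l)
    (v : Fin (m + 1) → Simplex n) :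
    tupleBarycenter m (affineSimplex u ∘ v) = affineSimplex u (tupleBarycenter m v) :=
  (affineSimplex_affineSimplex u v _).symm

/-- The affine singular simplex of the prism `I × Δⁿ` with the given vertices. -/
def prismSimplex {m n : ℕ} (w : Fin (m + 1) → unitInterval × Simplex n) :
    C(Simplex m, unitInterval × Simplex n) where
  toFun t := (⟨∑ i, t i * (w i).1, Finset.sum_nonneg fun i _ =>
      mul_nonneg (stdSimplex.zero_le t i) (w i).1.2.1, by
      refine (Finset.sum_le_sum fun i _ => mul_le_of_le_one_right (stdSimplex.zero_le t i)
        (w i).1.2.2).trans (stdSimplex.sum_eq_one t).le⟩,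
    affineSimplex (fun i => (w i).2) t)
  continuous_toFun := by
    refine Continuous.prodMk (Continuous.subtype_mk (continuous_finsetSum _ fun i _ => ?_) _)
      (ContinuousMap.continuous _)
    exact ((continuous_apply i).comp continuous_subtype_val).mul continuous_const

theorem prismSimplex_vertex {m n : ℕ} (w : Fin (m + 1) → unitInterval × Simplex n)
    (i : Fin (m + 1)) : prismSimplex w (stdSimplex.vertex i) = w i := by
  refine Prod.ext (Subtype.ext ?_) (affineSimplex_vertex _ i)
  change ∑ j, (stdSimplex.vertex i : Simplex m) j * ((w j).1 : ℝ) = (w i).1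
  simp [stdSimplex_vertex_apply]

theorem prismSimplex_comp_faceMap {m n : ℕ} (w : Fin (m + 2) → unitInterval × Simplex n)
    (i : Fin (m + 2)) : (prismSimplex w).comp (faceMap i) = prismSimplex (w ∘ i.succAbove) := by
  ext1 t
  refine Prod.ext (Subtype.ext ?_)
    (congrArg (fun f => f t) (affineSimplex_comp_faceMap (fun i => (w i).2) i))
  change ∑ j, (faceMap i t : Simplex (m + 1)) j * ((w j).1 : ℝ) =
    ∑ j, t j * ((w (i.succAbove j)).1 : ℝ)
  rw [faceMap_eq_affineSimplex]
  simp only [affineSimplex_apply, vertices, Function.comp_apply, stdSimplex_vertex_apply,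
    Finset.sum_mul]
  rw [Finset.sum_comm]
  simp

theorem prismSimplex_const {m n : ℕ} (s : unitInterval) (v : Fin (m + 1) → Simplex n)
    (t : Simplex m) : prismSimplex (fun i => (s, v i)) t = (s, affineSimplex v t) := by
  refine Prod.ext (Subtype.ext ?_) rfl
  change ∑ j, t j * (s : ℝ) = s
  rw [← Finset.sum_mul, stdSimplex.sum_eq_one, one_mul]

/-- The map of prisms induced by a face inclusion. -/
def prismFace {n : ℕ} (i : Fin (n + 2)) :
    C(unitInterval × Simplex n, unitInterval × Simplex (n + 1)) :=
  (ContinuousMap.id _).prodMap (faceMap i)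

theorem prismFace_comp_prismSimplex {m n : ℕ} (i : Fin (n + 2))
    (w : Fin (m + 1) → unitInterval × Simplex n) :
    (prismFace i).comp (prismSimplex w) = prismSimplex (prismFace i ∘ w) := by
  ext1 t
  refine Prod.ext rfl ?_
  change faceMap i (affineSimplex (fun j => (w j).2) t) =
    affineSimplex (fun j => faceMap i (w j).2) t
  rw [faceMap_eq_affineSimplex]
  exact affineSimplex_affineSimplex _ _ _

end Affine

/-! ### Twisted cochains -/

instance : ContractibleSpace unitInterval :=
  (convex_Icc (0 : ℝ) 1).contractibleSpace ⟨0, by simp⟩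

section Twisted

variable {X : Type*} [TopologicalSpace X] (z : singularCocycles X ℤ 1)
variable {Y Y' : Type*} [TopologicalSpace Y] [SimplyConnectedSpace Y]
  [TopologicalSpace Y'] [SimplyConnectedSpace Y']

/-- The value of the cocycle `z` on the image under `F : Y → X` of any path from `p` to `q`; it does
not depend on the path because `Y` is simply connected. -/
def displacement (F : C(Y, X)) (p q : Y) : ℤ :=
  z.1 (pathSimplex ((PathConnectedSpace.somePath p q).map F.continuous))

theorem displacement_eq (F : C(Y, X)) {p q : Y} (γ : Path p q) :
    displacement z F p q = z.1 (pathSimplex (γ.map F.continuous)) :=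
  cocycle_homotopic z ((SimplyConnectedSpace.paths_homotopic _ γ).map F)

theorem displacement_add (F : C(Y, X)) (p q r : Y) :
    displacement z F p q + displacement z F q r = displacement z F p r := by
  rw [displacement_eq z F ((PathConnectedSpace.somePath p q).trans
    (PathConnectedSpace.somePath q r)), Path.map_trans, cocycle_trans]
  rfl

@[simp]
theorem displacement_self (F : C(Y, X)) (p : Y) : displacement z F p p = 0 := by
  have := displacement_add z F p p p
  omega

theorem displacement_comp (F : C(Y, X)) (A : C(Y', Y)) (p q : Y') :
    displacement z (F.comp A) p q = displacement z F (A p) (A q) := by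
  rw [displacement_eq z F ((PathConnectedSpace.somePath p q).map A.continuous)]
  rfl

variable (b : ℂˣ)

/-- The coboundary of cochains with values in the line bundle whose parallel transport is
`b ^ z`, all fibres being identified with `ℂ`. -/
def twistedCoboundary {n : ℕ} (c : C(Simplex n, X) → ℂ) (s : C(Simplex (n + 1), X)) : ℂ :=
  ∑ i : Fin (n + 2), (-1 : ℤ) ^ (i : ℕ) •
    (((b ^ displacement z s (faceMap i (vertexZero n)) (vertexZero (n + 1)) : ℂˣ) : ℂ) *
      c (s.comp (faceMap i)))

/-- The pull-back of a twisted cochain to a simply connected space, where the line bundle is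
trivialized by parallel transport to the fibre over `p₀`. -/
def pullback (F : C(Y, X)) (p₀ : Y) {n : ℕ} (c : C(Simplex n, X) → ℂ) (τ : C(Simplex n, Y)) : ℂ :=
  ((b ^ displacement z F (τ (vertexZero n)) p₀ : ℂˣ) : ℂ) * c (F.comp τ)

theorem sum_pullback (F : C(Y, X)) (p₀ : Y) {n : ℕ} (c : C(Simplex n, X) → ℂ)
    (τ : C(Simplex (n + 1), Y)) :
    ∑ i : Fin (n + 2), (-1 : ℤ) ^ (i : ℕ) • pullback z b F p₀ c (τ.comp (faceMap i)) =
      pullback z b F p₀ (twistedCoboundary z b c) τ := by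
  simp only [pullback, twistedCoboundary, Finset.mul_sum]
  refine Finset.sum_congr rfl fun i _ => ?_
  rw [displacement_comp, ContinuousMap.comp_apply, ← displacement_add z F _ (τ (vertexZero (n + 1))),
    zpow_add, Units.val_mul, mul_smul_comm]
  congr 1
  rw [← mul_assoc, mul_comm ((_ : ℂˣ) : ℂ) ((_ : ℂˣ) : ℂ)]
  rfl

theorem pullback_comp (F : C(Y, X)) (A : C(Y', Y)) (p₀ : Y') {n : ℕ} (c : C(Simplex n, X) → ℂ)
    (τ : C(Simplex n, Y')) :
    pullback z b (F.comp A) p₀ c τ = pullback z b F (A p₀) c (A.comp τ) := by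
  simp only [pullback, displacement_comp]
  rfl

theorem pullback_base (F : C(Y, X)) (p₀ p₁ : Y) {n : ℕ} (c : C(Simplex n, X) → ℂ)
    (τ : C(Simplex n, Y)) :
    ((b ^ displacement z F p₀ p₁ : ℂˣ) : ℂ) * pullback z b F p₀ c τ = pullback z b F p₁ c τ := by
  simp only [pullback]
  rw [← mul_assoc, ← Units.val_mul, ← zpow_add, add_comm, displacement_add]

/-- The pull-back of a twisted cochain to the affine simplices of a prism. -/
def prismPullback {n : ℕ} (F : C(unitInterval × Simplex n, X)) {m : ℕ} (c : C(Simplex m, X) → ℂ)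
    (w : Fin (m + 1) → unitInterval × Simplex n) : ℂ :=
  pullback z b F (0, vertexZero n) c (prismSimplex w)

theorem tupleCoboundary_prismPullback {n : ℕ} (F : C(unitInterval × Simplex n, X)) {m : ℕ}
    (c : C(Simplex m, X) → ℂ) :
    tupleCoboundary (prismPullback z b F c) = prismPullback z b F (twistedCoboundary z b c) := by
  funext w
  simp only [prismPullback, ← sum_pullback, prismSimplex_comp_faceMap]
  rfl

/-- Natural operators on cochains: if the cone operators on prisms over `Δⁿ` are natural with
respect to faces, then so are the operators that they induce on twisted cochains of `X` through a
family `H` of prisms in `X`, and the homotopy formula carries over. -/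
theorem twistedCoboundary_coneOperator
    (ψ : ∀ n m, (Fin (m + 1) → Simplex n) → (((Fin (m + 1) → unitInterval × Simplex n) → ℂ) →ₗ[ℂ] ℂ))
    (apex : ∀ n m, (Fin (m + 1) → Simplex n) → unitInterval × Simplex n)
    (hψ : ∀ n m (v : Fin (m + 2) → Simplex n) (κ : (Fin (m + 1) → unitInterval × Simplex n) → ℂ),
      ψ n (m + 1) v (tupleCoboundary κ) = tupleCoboundary (fun w => ψ n m w κ) v)
    (hψA : ∀ n (i : Fin (n + 2)) m v (κ : (Fin (m + 1) → unitInterval × Simplex (n + 1)) → ℂ),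
      ψ (n + 1) m (faceMap i ∘ v) κ = ψ n m v (fun w => κ (prismFace i ∘ w)))
    (hap : ∀ n (i : Fin (n + 2)) m v, apex (n + 1) m (faceMap i ∘ v) = prismFace i (apex n m v))
    (H : ∀ n, C(Simplex n, X) → C(unitInterval × Simplex n, X)) {n : ℕ}
    (σ : C(Simplex (n + 1), X))
    (hnat : ∀ i, H n (σ.comp (faceMap i)) = (H (n + 1) σ).comp (prismFace i))
    (h0 : ∀ x, H (n + 1) σ (0, x) = σ x) (c : C(Simplex (n + 1), X) → ℂ) :
    twistedCoboundary z b (fun τ => coneOperator (ψ n) (apex n) n (vertices n)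
        (prismPullback z b (H n τ) c)) σ +
      coneOperator (ψ (n + 1)) (apex (n + 1)) (n + 1) (vertices (n + 1))
        (prismPullback z b (H (n + 1) σ) (twistedCoboundary z b c)) =
      ψ (n + 1) (n + 1) (vertices (n + 1)) (prismPullback z b (H (n + 1) σ) c) -
      coneRemainder (ψ (n + 1)) (apex (n + 1)) (n + 1) (vertices (n + 1))
        (prismPullback z b (H (n + 1) σ) c) := by
  rw [← coneOperator_homotopy _ _ (hψ _), tupleCoboundary_prismPullback]
  congr 1
  refine Finset.sum_congr rfl fun i _ => ?_
  congr 1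
  dsimp only
  rw [← faceMap_vertices, coneOperator_comp (faceMap i) (prismFace i) (hap n i) (hψA n i), hnat,
    ← smul_eq_mul, ← LinearMap.map_smul]
  congr 1
  funext w
  have e : σ = (H (n + 1) σ).comp ((ContinuousMap.const _ 0).prodMk (ContinuousMap.id _)) :=
    ContinuousMap.ext fun x => (h0 x).symm
  have e' : displacement z σ (faceMap i (vertexZero n)) (vertexZero (n + 1)) =
      displacement z (H (n + 1) σ) (prismFace i (0, vertexZero n)) (0, vertexZero (n + 1)) := by
    conv_lhs => rw [e, displacement_comp]
    rfl
  rw [Pi.smul_apply, smul_eq_mul, e']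
  simp only [prismPullback]
  rw [pullback_comp, pullback_base, prismFace_comp_prismSimplex]

/-- Evaluation of functions at a point, as a linear map. -/
def evalAt {T : Type*} (t : T) : (T → ℂ) →ₗ[ℂ] ℂ := LinearMap.proj (φ := fun _ => ℂ) t

theorem evalAt_apply {T : Type*} (t : T) (f : T → ℂ) : evalAt t f = f t := rfl

/-- In positive degrees, deforming the simplices of a family by a natural homotopy changes a twisted
cocycle by a coboundary on that family. -/
theorem exists_twistedCoboundary_of_homotopy {S : ∀ n, Set C(Simplex n, X)}
    (H : ∀ n, C(Simplex n, X) → C(unitInterval × Simplex n, X))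
    (hnat : ∀ n, ∀ σ ∈ S (n + 1), ∀ i,
      H n (σ.comp (faceMap i)) = (H (n + 1) σ).comp (prismFace i))
    (h0 : ∀ n, ∀ σ ∈ S n, ∀ x, H n σ (0, x) = σ x) {n : ℕ} (c : C(Simplex (n + 1), X) → ℂ)
    (hc : twistedCoboundary z b c = 0) :
    ∃ k : C(Simplex n, X) → ℂ, ∀ σ ∈ S (n + 1), twistedCoboundary z b k σ =
      ((b ^ displacement z (H (n + 1) σ) (1, vertexZero (n + 1)) (0, vertexZero (n + 1)) : ℂˣ) : ℂ) *
        c ((H (n + 1) σ).comp ((ContinuousMap.const _ 1).prodMk (ContinuousMap.id _))) - c σ := by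
  let ψ : ∀ n m, (Fin (m + 1) → Simplex n) →
      (((Fin (m + 1) → unitInterval × Simplex n) → ℂ) →ₗ[ℂ] ℂ) := fun n m v =>
    evalAt (fun i => (1, v i)) - evalAt (fun i => (0, v i))
  let apex : ∀ n m, (Fin (m + 1) → Simplex n) → unitInterval × Simplex n := fun n m v => (0, v 0)
  refine ⟨fun τ => coneOperator (ψ n) (apex n) n (vertices n) (prismPullback z b (H n τ) c), ?_⟩
  intro σ hσ
  have key := twistedCoboundary_coneOperator z b ψ apex ?_ ?_ ?_ H σ (hnat n σ hσ) (h0 _ σ hσ) c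
  · have hz : prismPullback z b (H (n + 1) σ) (twistedCoboundary z b c) = 0 := by
      funext w
      simp [prismPullback, pullback, hc]
    rw [hz, map_zero, add_zero, coneRemainder_eq_zero_of_const, sub_zero] at key
    · rw [key]
      simp only [ψ, LinearMap.sub_apply, evalAt_apply, prismPullback, pullback]
      have hs (s : unitInterval) : prismSimplex (fun i => (s, vertices (n + 1) i)) =
          (ContinuousMap.const _ s).prodMk (ContinuousMap.id _) := by
        ext1 t
        rw [prismSimplex_const, affineSimplex_vertices]
        rfl
      rw [hs, hs]
      congr 1
      have e : (H (n + 1) σ).comp ((ContinuousMap.const _ 0).prodMk (ContinuousMap.id _)) = σ :=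
        ContinuousMap.ext fun x => h0 _ σ hσ x
      rw [e]
      change ((b ^ displacement z (H (n + 1) σ) (0, vertexZero (n + 1)) (0, vertexZero (n + 1)) :
        ℂˣ) : ℂ) * c σ = c σ
      simp
    · intro v m
      simp [ψ, evalAt_apply]
  · intro n m v κ
    simp only [ψ, LinearMap.sub_apply, evalAt_apply, tupleCoboundary, smul_sub,
      Finset.sum_sub_distrib]
    rfl
  · intro n i m v κ
    rfl
  · intro n i m v
    rfl

/-- In degree `0`, deforming the points by a homotopy does not change a twisted cocycle. -/
theorem eq_of_homotopy_zero (c : C(Simplex 0, X) → ℂ) (hc : twistedCoboundary z b c = 0)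
    (F : C(unitInterval × Simplex 0, X)) :
    ((b ^ displacement z F (1, vertexZero 0) (0, vertexZero 0) : ℂˣ) : ℂ) *
        c (F.comp ((ContinuousMap.const _ 1).prodMk (ContinuousMap.id _))) =
      c (F.comp ((ContinuousMap.const _ 0).prodMk (ContinuousMap.id _))) := by
  have h := congrFun (tupleCoboundary_prismPullback z b F c) ![(0, vertexZero 0), (1, vertexZero 0)]
  rw [hc, tupleCoboundary_zero_apply] at h
  simp only [prismPullback, pullback, Pi.zero_apply, mul_zero] at h
  have hs (s : unitInterval) : prismSimplex (fun _ : Fin 1 => (s, vertexZero 0)) =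
      (ContinuousMap.const _ s).prodMk (ContinuousMap.id _) := by
    ext1 t
    rw [prismSimplex_const]
    exact Prod.ext rfl (Subsingleton.elim _ _)
  simp only [Matrix.cons_val_zero, Matrix.cons_val_one, hs] at h
  refine (eq_of_sub_eq_zero h).trans ?_
  change ((b ^ displacement z F (0, vertexZero 0) (0, vertexZero 0) : ℂˣ) : ℂ) * _ = _
  simp

end Twisted

/-! ### Barycentric subdivision and small simplices -/

section Within

/-- The value at a point of `Δⁿ` of the affine function with values `g` at the vertices. -/
def affineValue {n : ℕ} (g : Fin (n + 1) → ℝ) (p : Simplex n) : ℝ := ∑ k, p k * g k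

theorem affineValue_affineSimplex {m n : ℕ} (g : Fin (n + 1) → ℝ) (v : Fin (m + 1) → Simplex n)
    (t : Simplex m) : affineValue g (affineSimplex v t) = affineValue (fun i => affineValue g (v i)) t := by
  simp only [affineValue, affineSimplex_apply, Finset.sum_mul, Finset.mul_sum]
  rw [Finset.sum_comm]
  simp only [mul_assoc]

theorem affineValue_vertex {n : ℕ} (g : Fin (n + 1) → ℝ) (i : Fin (n + 1)) :
    affineValue g (stdSimplex.vertex i) = g i := by
  simp [affineValue, stdSimplex_vertex_apply]

theorem affineValue_neg {n : ℕ} (g : Fin (n + 1) → ℝ) (p : Simplex n) :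
    affineValue (fun i => -g i) p = -affineValue g p := by
  simp [affineValue]

theorem affineValue_sub_le {n : ℕ} {g : Fin (n + 1) → ℝ} {D : ℝ} (h : ∀ i j, g i - g j ≤ D)
    (p q : Simplex n) : affineValue g p - affineValue g q ≤ D := by
  have hp := stdSimplex.sum_eq_one p
  have hq := stdSimplex.sum_eq_one q
  have e : affineValue g p - affineValue g q = ∑ i, ∑ j, p i * q j * (g i - g j) := by
    have e₁ : affineValue g p = ∑ i, ∑ j, p i * q j * g i := by
      refine Finset.sum_congr rfl fun i _ => ?_
      rw [← Finset.sum_mul, ← Finset.mul_sum, hq, mul_one]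
    have e₂ : affineValue g q = ∑ i, ∑ j, p i * q j * g j := by
      rw [Finset.sum_comm]
      refine Finset.sum_congr rfl fun i _ => ?_
      rw [← Finset.sum_mul, ← Finset.sum_mul, hp, one_mul]
    rw [e₁, e₂]
    simp only [mul_sub, Finset.sum_sub_distrib]
  have e' : D = ∑ i, ∑ j, p i * q j * D := by
    simp only [← Finset.sum_mul, ← Finset.mul_sum, hq, mul_one, hp, one_mul]
  rw [e, e']
  exact Finset.sum_le_sum fun i _ => Finset.sum_le_sum fun j _ =>
    mul_le_mul_of_nonneg_left (h i j) (mul_nonneg (stdSimplex.zero_le p i) (stdSimplex.zero_le q j))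

theorem le_affineValue {n : ℕ} {g : Fin (n + 1) → ℝ} {a : ℝ} (h : ∀ i, a ≤ g i) (p : Simplex n) :
    a ≤ affineValue g p := by
  have e : a = ∑ i, p i * a := by rw [← Finset.sum_mul, stdSimplex.sum_eq_one, one_mul]
  rw [e]
  exact Finset.sum_le_sum fun i _ => mul_le_mul_of_nonneg_left (h i) (stdSimplex.zero_le p i)

/-- A tuple of points of `Δⁿ` is within `r` if each affine function of oscillation at most `D` on
`Δⁿ` has oscillation at most `r * D` on the tuple. This measure of size is submultiplicative under
composition of affine simplices. -/
def IsWithin {m n : ℕ} (r : ℝ) (u : Fin (m + 1) → Simplex n) : Prop :=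
  ∀ (g : Fin (n + 1) → ℝ) (D : ℝ), (∀ i j, g i - g j ≤ D) →
    ∀ i j, affineValue g (u i) - affineValue g (u j) ≤ r * D

theorem isWithin_one {m n : ℕ} (u : Fin (m + 1) → Simplex n) : IsWithin 1 u := fun g D h i j => by
  rw [one_mul]
  exact affineValue_sub_le h _ _

theorem IsWithin.comp {l m n : ℕ} {r s : ℝ} {v : Fin (m + 1) → Simplex n}
    {u : Fin (l + 1) → Simplex m} (hv : IsWithin r v) (hu : IsWithin s u) :
    IsWithin (s * r) (affineSimplex v ∘ u) := fun g D h i j => by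
  simp only [Function.comp_apply, affineValue_affineSimplex]
  rw [mul_assoc]
  exact hu _ _ (fun i j => hv g D h i j) i j

theorem le_affineValue_of_isSubdivision {m n : ℕ} {g : Fin (n + 1) → ℝ}
    {w v : Fin (m + 1) → Simplex n} (hw : IsSubdivision tupleBarycenter m w v) {a : ℝ}
    (h : ∀ i, a ≤ affineValue g (v i)) : ∀ j, a ≤ affineValue g (w j) := by
  induction hw with
  | zero v =>
    intro j
    rw [tupleBarycenter, affineValue_affineSimplex]
    exact le_affineValue h _
  | succ m v i w hw ih =>
    intro j
    refine Fin.cases ?_ (fun j => ?_) j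
    · rw [Fin.cons_zero, tupleBarycenter, affineValue_affineSimplex]
      exact le_affineValue h _
    · rw [Fin.cons_succ]
      exact ih (fun i => h _) j

theorem affineValue_tupleBarycenter_sub_le {m n : ℕ} {g : Fin (n + 1) → ℝ}
    {v : Fin (m + 1) → Simplex n} {D : ℝ}
    (h : ∀ i j, affineValue g (v i) - affineValue g (v j) ≤ D) (j : Fin (m + 1)) :
    affineValue g (tupleBarycenter m v) - affineValue g (v j) ≤ (m : ℝ) / (m + 1) * D := by
  have hm : (0 : ℝ) < m + 1 := by positivity
  have e : affineValue g (tupleBarycenter m v) = (∑ i, affineValue g (v i)) / (m + 1) := by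
    rw [tupleBarycenter, affineValue_affineSimplex, affineValue, Finset.sum_div]
    refine Finset.sum_congr rfl fun i _ => ?_
    change ((Fintype.card (Fin (m + 1)) : ℝ))⁻¹ * _ = _
    rw [Fintype.card_fin]
    push_cast
    field_simp
  have hs : ∑ i, (affineValue g (v i) - affineValue g (v j)) ≤ m * D := by
    rw [← Finset.add_sum_erase _ _ (Finset.mem_univ j), sub_self, zero_add]
    refine (Finset.sum_le_card_nsmul _ _ D fun i _ => h i j).trans_eq ?_
    rw [Finset.card_erase_of_mem (Finset.mem_univ j), Finset.card_univ, Fintype.card_fin]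
    simp
  rw [Finset.sum_sub_distrib, Finset.sum_const, Finset.card_univ, Fintype.card_fin,
    nsmul_eq_mul] at hs
  rw [e, div_mul_eq_mul_div, sub_le_iff_le_add, div_le_iff₀ hm, add_mul, div_mul_cancel₀ _ hm.ne']
  push_cast at hs
  linarith

/-- The simplices of the barycentric subdivision of an `m`-simplex are smaller by the factor
`m / (m + 1)`. -/
theorem affineValue_sub_le_of_isSubdivision {m n : ℕ} {w v : Fin (m + 1) → Simplex n}
    (hw : IsSubdivision tupleBarycenter m w v) : ∀ {g : Fin (n + 1) → ℝ} {D : ℝ},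
    (∀ i j, affineValue g (v i) - affineValue g (v j) ≤ D) → ∀ i j,
      affineValue g (w i) - affineValue g (w j) ≤ (m : ℝ) / (m + 1) * D := by
  induction hw with
  | zero v =>
    intro g D _ i j
    simp
  | succ m v l w hw ih =>
    have key {g : Fin (n + 1) → ℝ} {D : ℝ}
        (h : ∀ i j, affineValue g (v i) - affineValue g (v j) ≤ D) (j : Fin (m + 1)) :
        affineValue g (tupleBarycenter (m + 1) v) - affineValue g (w j) ≤
          ((m + 1 : ℕ) : ℝ) / ((m + 1 : ℕ) + 1) * D := by
      obtain ⟨i₀, hi₀⟩ := Finite.exists_min fun i => affineValue g (v i)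
      have h₁ := affineValue_tupleBarycenter_sub_le h i₀
      have h₂ := le_affineValue_of_isSubdivision hw (a := affineValue g (v i₀)) (fun i => hi₀ _) j
      linarith
    intro g D h i j
    have hD : 0 ≤ D := by simpa using h 0 0
    refine Fin.cases ?_ (fun i => ?_) i <;> refine Fin.cases ?_ (fun j => ?_) j
    · rw [sub_self]
      positivity
    · exact key h j
    · have := key (g := fun i => -g i) (D := D) (fun i j => by
        simp only [affineValue_neg]
        linarith [h j i]) i
      simp only [affineValue_neg] at this
      simp only [Fin.cons_succ, Fin.cons_zero]
      linarith
    · refine (ih (fun i j => h _ _) i j).trans (mul_le_mul_of_nonneg_right ?_ hD)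
      rw [div_le_div_iff₀ (by positivity) (by positivity)]
      push_cast
      nlinarith

theorem isWithin_of_isSubdivision {n : ℕ} {w : Fin (n + 1) → Simplex n}
    (hw : IsSubdivision tupleBarycenter n w (vertices n)) : IsWithin ((n : ℝ) / (n + 1)) w :=
  fun g D h => affineValue_sub_le_of_isSubdivision hw fun i j => by
    simpa only [vertices, affineValue_vertex] using h i j

end Within

section Small

variable {X : Type*} [PseudoMetricSpace X]

/-- The singular simplices all of whose points have mutual distance less than `ε`. -/
def smallSimplices (X : Type*) [PseudoMetricSpace X] (ε : ℝ) (n : ℕ) : Set C(Simplex n, X) :=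
  {σ | ∀ x y, dist (σ x) (σ y) < ε}

/-- The singular simplices whose affine subsimplices within `r` are small. -/
def smallWithin (X : Type*) [PseudoMetricSpace X] (ε r : ℝ) (n : ℕ) : Set C(Simplex n, X) :=
  {σ | ∀ m (u : Fin (m + 1) → Simplex n), IsWithin r u →
    σ.comp (affineSimplex u) ∈ smallSimplices X ε m}

variable {ε r s : ℝ} {m n : ℕ}

theorem smallSimplices_subset_smallWithin : smallSimplices X ε n ⊆ smallWithin X ε r n :=
  fun _ h _ _ _ _ _ => h _ _

theorem smallWithin_one : smallWithin X ε 1 n ⊆ smallSimplices X ε n := fun σ h => by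
  have := h n (vertices n) (isWithin_one _)
  rwa [affineSimplex_vertices] at this

theorem comp_mem_smallWithin {σ : C(Simplex n, X)} (hσ : σ ∈ smallWithin X ε (r * s) n)
    {v : Fin (m + 1) → Simplex n} (hv : IsWithin s v) :
    σ.comp (affineSimplex v) ∈ smallWithin X ε r m := fun l u hu => by
  rw [ContinuousMap.comp_assoc, affineSimplex_comp_affineSimplex]
  exact hσ _ _ (hv.comp hu)

theorem comp_mem_smallWithin' {σ : C(Simplex n, X)} (hσ : σ ∈ smallWithin X ε r n)
    (v : Fin (m + 1) → Simplex n) : σ.comp (affineSimplex v) ∈ smallWithin X ε r m :=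
  comp_mem_smallWithin (by rwa [mul_one]) (isWithin_one v)

theorem smallWithin_anti (h : r ≤ s) : smallWithin X ε s n ⊆ smallWithin X ε r n :=
  fun _ hσ m u hu => hσ m u fun g D hg i j => (hu g D hg i j).trans
    (mul_le_mul_of_nonneg_right h (by simpa using hg 0 0))

/-- Every singular simplex has small affine subsimplices. -/
theorem exists_mem_smallWithin (hε : 0 < ε) (σ : C(Simplex n, X)) :
    ∃ r > 0, σ ∈ smallWithin X ε r n := by
  obtain ⟨δ, hδ, h⟩ := Metric.uniformContinuous_iff.1
    (CompactSpace.uniformContinuous_of_continuous σ.continuous) ε hε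
  refine ⟨δ / 2, half_pos hδ, fun m u hu x y => h ?_⟩
  rw [Subtype.dist_eq, dist_pi_lt_iff hδ]
  intro k
  have key (x y : Simplex m) : affineSimplex u x k - affineSimplex u y k ≤ δ / 2 := by
    have := affineValue_sub_le (g := fun i => affineValue (Pi.single k 1) (u i)) (D := δ / 2 * 1)
      (fun i j => hu (Pi.single k 1) 1 (fun i j => by
        have h₁ : (Pi.single k 1 : Fin (n + 1) → ℝ) i ≤ 1 := by
          rw [Pi.single_apply]
          split_ifs <;> norm_num
        have h₂ : 0 ≤ (Pi.single k 1 : Fin (n + 1) → ℝ) j := by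
          rw [Pi.single_apply]
          split_ifs <;> norm_num
        linarith) i j) x y
    rw [← affineValue_affineSimplex, ← affineValue_affineSimplex, mul_one] at this
    simpa [affineValue, Pi.single_apply] using this
  rw [Real.dist_eq]
  have h₁ := key x y
  have h₂ := key y x
  refine lt_of_le_of_lt (abs_le.2 ⟨?_, h₁⟩) (half_lt_self hδ)
  change -(δ / 2) ≤ affineSimplex u x k - affineSimplex u y k
  linarith

end Small

/-! ### Extension of cochains from small simplices -/

section Extension

variable {X : Type*} [TopologicalSpace X] (z : singularCocycles X ℤ 1) (b : ℂˣ)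

theorem prismPullback_comp_snd {m n : ℕ} (σ : C(Simplex n, X)) (c : C(Simplex m, X) → ℂ)
    (w : Fin (m + 1) → unitInterval × Simplex n) :
    prismPullback z b (σ.comp ContinuousMap.snd) c w =
      ((b ^ displacement z σ (w 0).2 (vertexZero n) : ℂˣ) : ℂ) *
        c (σ.comp (affineSimplex fun i => (w i).2)) := by
  rw [prismPullback, pullback, displacement_comp, prismSimplex_vertex]
  rfl

theorem twistedCoboundary_twistedCoboundary {n : ℕ} (c : C(Simplex n, X) → ℂ) :
    twistedCoboundary z b (twistedCoboundary z b c) = 0 := by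
  funext σ
  have h := prismPullback_comp_snd z b σ (twistedCoboundary z b (twistedCoboundary z b c))
    (fun i => (0, vertices _ i))
  rw [← tupleCoboundary_prismPullback, ← tupleCoboundary_prismPullback,
    tupleCoboundary_tupleCoboundary] at h
  rw [affineSimplex_vertices] at h
  change (0 : ℂ) = ((b ^ displacement z σ (vertexZero (n + 1 + 1)) (vertexZero (n + 1 + 1)) : ℂˣ) : ℂ) *
    _ at h
  simpa using h.symm

theorem twistedCoboundary_sub {n : ℕ} (c d : C(Simplex n, X) → ℂ) :
    twistedCoboundary z b (c - d) = twistedCoboundary z b c - twistedCoboundary z b d := by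
  funext σ
  simp [twistedCoboundary, mul_sub, smul_sub, Finset.sum_sub_distrib]

/-- The chain homotopy between the identity and the barycentric subdivision, on twisted
cochains. -/
def subdivisionHomotopy {n : ℕ} (c : C(Simplex (n + 1), X) → ℂ) (σ : C(Simplex n, X)) : ℂ :=
  coneOperator (fun _ v => evalAt fun i => ((0 : unitInterval), v i))
    (fun m v => ((0 : unitInterval), tupleBarycenter m v)) n (vertices n)
    (prismPullback z b (σ.comp ContinuousMap.snd) c)

theorem subdivisionHomotopy_mem {n : ℕ} (c : C(Simplex (n + 1), X) → ℂ) (σ : C(Simplex n, X))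
    (N : AddSubgroup ℂ)
    (h : ∀ w, prismPullback z b (σ.comp ContinuousMap.snd) c w ∈ N) :
    subdivisionHomotopy z b c σ ∈ N :=
  coneOperator_mem N (fun _ _ _ h => h _) _ _ _ h

theorem twistedCoboundary_subdivisionHomotopy {n : ℕ} (c : C(Simplex (n + 1), X) → ℂ)
    (hc : twistedCoboundary z b c = 0) (σ : C(Simplex (n + 1), X))
    (hσ : ∀ w, IsSubdivision tupleBarycenter (n + 1) w (vertices (n + 1)) →
      c (σ.comp (affineSimplex w)) = 0) :
    twistedCoboundary z b (subdivisionHomotopy z b c) σ = c σ := by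
  have key := twistedCoboundary_coneOperator z b
    (fun n m v => evalAt fun i => ((0 : unitInterval), v i))
    (fun n m v => ((0 : unitInterval), tupleBarycenter m v)) (fun _ _ _ _ => rfl)
    (fun _ _ _ _ _ => rfl) ?_ (fun n τ => τ.comp ContinuousMap.snd) σ (fun _ => rfl) (fun _ => rfl) c
  · rw [hc] at key
    have hz : prismPullback z b (σ.comp ContinuousMap.snd) (0 : C(Simplex (n + 2), X) → ℂ) = 0 := by
      funext w
      simp [prismPullback, pullback]
    rw [hz, map_zero, add_zero,
      coneRemainder_eq_zero (fun p => ((0 : unitInterval), p)) (fun _ _ => rfl) (fun _ _ => rfl),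
      sub_zero] at key
    · refine key.trans ?_
      rw [evalAt_apply, prismPullback_comp_snd, affineSimplex_vertices]
      change ((b ^ displacement z σ (vertexZero (n + 1)) (vertexZero (n + 1)) : ℂˣ) : ℂ) * c σ = c σ
      simp
    · intro w hw
      rw [prismPullback_comp_snd]
      exact mul_eq_zero_of_right _ (hσ w hw)
  · intro n i m v
    refine Prod.ext rfl ?_
    change tupleBarycenter m (faceMap i ∘ v) = faceMap i (tupleBarycenter m v)
    rw [faceMap_eq_affineSimplex, tupleBarycenter_comp]

/-- The group generated by the values of a cochain on the affine subsimplices of `σ`, transported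
to the initial vertex of `σ`. -/
def valueGroup {n : ℕ} (k : C(Simplex n, X) → ℂ) (σ : C(Simplex n, X)) : AddSubgroup ℂ :=
  AddSubgroup.closure (Set.range fun u : Fin (n + 1) → Simplex n =>
    ((b ^ displacement z σ (u 0) (vertexZero n) : ℂˣ) : ℂ) * k (σ.comp (affineSimplex u)))

theorem self_mem_valueGroup {n : ℕ} (k : C(Simplex n, X) → ℂ) (σ : C(Simplex n, X)) :
    k σ ∈ valueGroup z b k σ := by
  refine AddSubgroup.subset_closure ⟨vertices n, ?_⟩
  dsimp only
  rw [affineSimplex_vertices]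
  change ((b ^ displacement z σ (vertexZero n) (vertexZero n) : ℂˣ) : ℂ) * k σ = k σ
  simp

theorem subdivisionHomotopy_mem_valueGroup {n : ℕ} (k : C(Simplex n, X) → ℂ)
    (σ : C(Simplex n, X)) :
    subdivisionHomotopy z b (twistedCoboundary z b k) σ ∈ valueGroup z b k σ := by
  refine subdivisionHomotopy_mem z b _ _ _ fun w => ?_
  rw [← tupleCoboundary_prismPullback]
  refine AddSubgroup.sum_mem _ fun i _ => AddSubgroup.zsmul_mem _ ?_ _
  rw [prismPullback_comp_snd]
  exact AddSubgroup.subset_closure ⟨fun j => ((w ∘ i.succAbove) j).2, rfl⟩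

theorem valueGroup_le {n : ℕ} {k k' : C(Simplex n, X) → ℂ}
    (h : ∀ σ, k' σ ∈ valueGroup z b k σ) (σ : C(Simplex n, X)) :
    valueGroup z b k' σ ≤ valueGroup z b k σ := by
  refine (AddSubgroup.closure_le _).2 ?_
  rintro _ ⟨u, rfl⟩
  have := h (σ.comp (affineSimplex u))
  dsimp only
  set β : ℂ := ((b ^ displacement z σ (u 0) (vertexZero n) : ℂˣ) : ℂ) with hβ
  suffices valueGroup z b k (σ.comp (affineSimplex u)) ≤
      (valueGroup z b k σ).comap (AddMonoidHom.mulLeft β) from this (h _)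
  refine (AddSubgroup.closure_le _).2 ?_
  rintro _ ⟨v, rfl⟩
  refine AddSubgroup.subset_closure ⟨affineSimplex u ∘ v, ?_⟩
  dsimp only
  rw [AddMonoidHom.coe_mulLeft, ← affineSimplex_comp_affineSimplex, displacement_comp, hβ]
  rw [← mul_assoc, ← Units.val_mul, ← zpow_add, add_comm (displacement z σ _ _),
    affineSimplex_vertex, displacement_add]
  rfl

end Extension

section Extension

variable {X : Type*} [PseudoMetricSpace X] (z : singularCocycles X ℤ 1) (b : ℂˣ)

/-- If a twisted cochain `k` satisfies `δk = c` on small simplices, where `c` is a cocycle, then `k`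
can be changed outside the small simplices such that `δk = c` everywhere. For `c = 0` this says
that cocycles extend from small simplices; in general that classes which vanish on small simplices
are zero. -/
theorem exists_extension {ε : ℝ} (hε : 0 < ε) {n : ℕ} (c : C(Simplex (n + 1), X) → ℂ)
    (hc : twistedCoboundary z b c = 0) (k : C(Simplex n, X) → ℂ)
    (hk : ∀ σ ∈ smallSimplices X ε (n + 1), twistedCoboundary z b k σ = c σ) :
    ∃ k' : C(Simplex n, X) → ℂ, twistedCoboundary z b k' = c ∧
      (∀ σ ∈ smallSimplices X ε n, k' σ = k σ) ∧ (c = 0 → ∀ σ, k' σ ∈ valueGroup z b k σ) := by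
  let step (k : C(Simplex n, X) → ℂ) : C(Simplex n, X) → ℂ :=
    k - subdivisionHomotopy z b (twistedCoboundary z b k - c)
  let q : ℝ := ((n + 1 : ℕ) : ℝ) / ((n + 1 : ℕ) + 1)
  have hq0 : 0 ≤ q := by positivity
  have hq1 : q < 1 := by
    rw [div_lt_one (by positivity)]
    exact lt_add_one _
  let K (j : ℕ) : C(Simplex n, X) → ℂ := step^[j] k
  have hK (j : ℕ) : K (j + 1) = K j - subdivisionHomotopy z b (twistedCoboundary z b (K j) - c) :=
    Function.iterate_succ_apply' step j k
  -- After `j` steps the equation holds on the simplices that become small after `j` subdivisions.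
  have hδ (j : ℕ) : ∀ σ ∈ smallWithin X ε (q ^ j) (n + 1), twistedCoboundary z b (K j) σ = c σ := by
    induction j with
    | zero => exact fun σ hσ => hk σ (smallWithin_one (by simpa using hσ))
    | succ j ih =>
      intro σ hσ
      have := twistedCoboundary_subdivisionHomotopy z b (twistedCoboundary z b (K j) - c) (by
        rw [twistedCoboundary_sub, twistedCoboundary_twistedCoboundary, hc, sub_zero]) σ
        fun w hw => by
          rw [Pi.sub_apply, ih _ (comp_mem_smallWithin (by rwa [pow_succ] at hσ)
            (isWithin_of_isSubdivision hw)), sub_self]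
      rw [hK, twistedCoboundary_sub, Pi.sub_apply, this, Pi.sub_apply, sub_sub_cancel]
  have hst (j : ℕ) : ∀ σ ∈ smallWithin X ε (q ^ j) n, K (j + 1) σ = K j σ := by
    intro σ hσ
    rw [hK, Pi.sub_apply, sub_eq_self]
    refine subdivisionHomotopy_mem z b _ σ ⊥ fun w => ?_
    rw [prismPullback_comp_snd, Pi.sub_apply, hδ j _ (comp_mem_smallWithin' hσ _), sub_self, mul_zero]
    exact AddSubgroup.zero_mem _
  have hst' (j i : ℕ) (σ) (hσ : σ ∈ smallWithin X ε (q ^ j) n) : K (j + i) σ = K j σ := by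
    induction i with
    | zero => rfl
    | succ i ih =>
      rw [← ih]
      exact hst (j + i) σ (smallWithin_anti (pow_le_pow_of_le_one hq0 hq1.le (Nat.le_add_right _ _)) hσ)
  have hex (m : ℕ) (σ : C(Simplex m, X)) : ∃ j, σ ∈ smallWithin X ε (q ^ j) m := by
    obtain ⟨r, hr, h⟩ := exists_mem_smallWithin hε σ
    obtain ⟨j, hj⟩ := exists_pow_lt_of_lt_one hr hq1
    exact ⟨j, smallWithin_anti hj.le h⟩
  choose N hN using hex n
  have hlim (j : ℕ) (σ) (hσ : σ ∈ smallWithin X ε (q ^ j) n) : K (N σ) σ = K j σ := by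
    rw [← hst' j (N σ) σ hσ, add_comm, hst' (N σ) j σ (hN σ)]
  refine ⟨fun σ => K (N σ) σ, ?_, ?_, ?_⟩
  · funext σ
    obtain ⟨j, hj⟩ := hex _ σ
    rw [← hδ j σ hj]
    refine Finset.sum_congr rfl fun i _ => ?_
    dsimp only
    rw [hlim j]
    rw [faceMap_eq_affineSimplex]
    exact comp_mem_smallWithin' hj _
  · intro σ hσ
    exact hlim 0 σ (smallSimplices_subset_smallWithin hσ)
  · rintro rfl σ
    have : ∀ j, ∀ σ, K j σ ∈ valueGroup z b k σ := by
      intro j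
      induction j with
      | zero => exact self_mem_valueGroup z b k
      | succ j ih =>
        intro σ
        rw [hK, Pi.sub_apply, sub_zero]
        exact AddSubgroup.sub_mem _ (ih σ)
          (valueGroup_le z b ih σ (subdivisionHomotopy_mem_valueGroup z b _ σ))
    exact this _ _

end Extension

/-! ### Homotopies and their rise -/

section Rise

variable {X : Type*} [TopologicalSpace X] (z : singularCocycles X ℤ 1) (g : X → ℝ)
variable {Y Y' : Type*} [TopologicalSpace Y] [TopologicalSpace Y']

/-- The track of the point `y` under a homotopy. -/
def track (H : C(unitInterval × Y, X)) (y : Y) : C(unitInterval, X) :=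
  H.comp ((ContinuousMap.id _).prodMk (ContinuousMap.const _ y))

/-- The map at the end of a homotopy. -/
def endMap (H : C(unitInterval × Y, X)) : C(Y, X) :=
  H.comp ((ContinuousMap.const _ 1).prodMk (ContinuousMap.id _))

/-- The real number by which the real cocycle `z - δg` changes along the track of `y`. If `z - δg`
is the integral of a closed one-form, this is its integral along the track. -/
def rise (H : C(unitInterval × Y, X)) (y : Y) : ℝ :=
  displacement z (track H y) 0 1 - (g (H (1, y)) - g (H (0, y)))

theorem displacement_const [SimplyConnectedSpace Y] (F : C(Y, X)) (h : ∀ p q, F p = F q)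
    (p q : Y) : displacement z F p q = 0 := by
  have e : F = (ContinuousMap.const PUnit (F p)).comp (ContinuousMap.const Y PUnit.unit) :=
    ContinuousMap.ext fun r => h r p
  rw [e, displacement_comp]
  exact displacement_self _ _ _

theorem rise_eq_zero (H : C(unitInterval × Y, X)) (y : Y) (h : ∀ t, H (t, y) = H (0, y)) :
    rise z g H y = 0 := by
  rw [rise, displacement_const z _ (fun s t => (h s).trans (h t).symm), h 1]
  simp

/-- The homotopy that first runs through `A` and then through `B`. -/
def concat (A B : C(unitInterval × Y, X)) (h : ∀ y, A (1, y) = B (0, y)) :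
    C(unitInterval × Y, X) :=
  ((⟨A, fun _ => rfl, fun _ => rfl⟩ : ContinuousMap.Homotopy
      (A.comp ((ContinuousMap.const _ 0).prodMk (ContinuousMap.id _))) (endMap A)).trans
    (⟨B, fun y => (h y).symm, fun _ => rfl⟩ :
      ContinuousMap.Homotopy (endMap A) (endMap B))).toContinuousMap

variable {A B : C(unitInterval × Y, X)} (h : ∀ y, A (1, y) = B (0, y))

theorem concat_apply (t : unitInterval) (y : Y) : concat A B h (t, y) =
    if ht : (t : ℝ) ≤ 1 / 2 then
      A (⟨2 * t, (unitInterval.mul_pos_mem_iff zero_lt_two).2 ⟨t.2.1, ht⟩⟩, y)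
    else B (⟨2 * t - 1, unitInterval.two_mul_sub_one_mem_iff.2 ⟨(not_le.1 ht).le, t.2.2⟩⟩, y) :=
  ContinuousMap.Homotopy.trans_apply _ _ _

theorem concat_zero (y : Y) : concat A B h (0, y) = A (0, y) := by
  rw [concat_apply, dif_pos (by norm_num)]
  congr 2
  ext
  simp

theorem concat_one (y : Y) : concat A B h (1, y) = B (1, y) := by
  rw [concat_apply, dif_neg (by norm_num)]
  congr 2
  ext
  simp
  norm_num

theorem concat_mem (t : unitInterval) (y : Y) :
    ∃ s, concat A B h (t, y) = A (s, y) ∨ concat A B h (t, y) = B (s, y) := by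
  rw [concat_apply]
  split_ifs
  · exact ⟨_, Or.inl rfl⟩
  · exact ⟨_, Or.inr rfl⟩

theorem concat_comp (f : C(Y', Y)) {A' B' : C(unitInterval × Y', X)}
    (hA : A' = A.comp ((ContinuousMap.id _).prodMap f))
    (hB : B' = B.comp ((ContinuousMap.id _).prodMap f)) (h' : ∀ y, A' (1, y) = B' (0, y)) :
    concat A' B' h' = (concat A B h).comp ((ContinuousMap.id _).prodMap f) := by
  subst hA hB
  ext1 ⟨t, y⟩
  change _ = concat A B h (t, f y)
  rw [concat_apply, concat_apply]
  rfl

theorem rise_concat (y : Y) : rise z g (concat A B h) y = rise z g A y + rise z g B y := by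
  let a : C(unitInterval, unitInterval) :=
    ⟨fun t => ⟨(t : ℝ) / 2, by constructor <;> linarith [t.2.1, t.2.2]⟩, by fun_prop⟩
  let b : C(unitInterval, unitInterval) :=
    ⟨fun t => ⟨((t : ℝ) + 1) / 2, by constructor <;> linarith [t.2.1, t.2.2]⟩, by fun_prop⟩
  have ha : track A y = (track (concat A B h) y).comp a := by
    ext1 t
    change A (t, y) = concat A B h (a t, y)
    have : ((a t : unitInterval) : ℝ) = t / 2 := rfl
    rw [concat_apply, dif_pos (by rw [this]; linarith [t.2.2])]
    congr 2
    ext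
    simp only [this]
    ring
  have hb : track B y = (track (concat A B h) y).comp b := by
    ext1 t
    change B (t, y) = concat A B h (b t, y)
    have e : ((b t : unitInterval) : ℝ) = (t + 1) / 2 := rfl
    rw [concat_apply]
    split_ifs with ht
    · have h0 : t = 0 := by
        ext
        rw [e] at ht
        have := t.2.1
        simp only [Set.Icc.coe_zero]
        linarith
      subst h0
      rw [← h]
      congr 2
      ext
      simp [e]
    · congr 2
      ext
      simp only [e]
      ring
  have e₁ : a 1 = b 0 := by
    ext
    change (1 : ℝ) / 2 = (0 + 1) / 2
    norm_num
  have e₀ : a 0 = 0 := by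
    ext
    change (0 : ℝ) / 2 = 0
    norm_num
  have e₂ : b 1 = 1 := by
    ext
    change ((1 : ℝ) + 1) / 2 = 1
    norm_num
  rw [rise, rise, rise, ha, hb, displacement_comp, displacement_comp, concat_zero, concat_one, h,
    ← displacement_add z (track (concat A B h) y) 0 (a 1) 1, e₀, e₁, e₂]
  push_cast
  ring

end Rise

/-! ### Charts adapted to a closed one-form without zeros -/

/-- A coordinate ball on which the cocycle `z` is, up to the coboundary of `g`, the coboundary of a
continuous function `height` that strictly increases in a constant direction. -/
structure HeightChart {X : Type*} [TopologicalSpace X] (z : singularCocycles X ℤ 1) (g : X → ℝ)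
    (E : Type*) [NormedAddCommGroup E] [NormedSpace ℝ E] where
  /-- the coordinates -/
  chart : OpenPartialHomeomorph X E
  /-- the centre of the ball -/
  center : E
  /-- the radius of the ball -/
  radius : ℝ
  radius_pos : 0 < radius
  target_eq : chart.target = Metric.ball center radius
  /-- the primitive of `z - δg` -/
  height : X → ℝ
  continuousOn_height : ContinuousOn height chart.source
  /-- a bound for the primitive -/
  bound : ℝ
  abs_height_le : ∀ x ∈ chart.source, |height x| ≤ bound
  /-- the direction in which the primitive increases -/
  dir : E
  norm_dir : ‖dir‖ ≤ 1
  height_lt : ∀ y ∈ chart.target, ∀ s : ℝ, 0 < s → y + s • dir ∈ chart.target →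
    height (chart.symm y) < height (chart.symm (y + s • dir))
  displacement_eq : ∀ γ : C(unitInterval, X), (∀ t, γ t ∈ chart.source) →
    (displacement z γ 0 1 : ℝ) = (height (γ 1) + g (γ 1)) - (height (γ 0) + g (γ 0))

namespace HeightChart

variable {X : Type*} [TopologicalSpace X] {z : singularCocycles X ℤ 1} {g : X → ℝ}
  {E : Type*} [NormedAddCommGroup E] [NormedSpace ℝ E] (k : HeightChart z g E)

/-- The concentric closed ball of half the radius. -/
def core : Set X := k.chart.symm '' Metric.closedBall k.center (k.radius / 2)

/-- The concentric open ball of half the radius. -/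
def openCore : Set X := k.chart.source ∩ k.chart ⁻¹' Metric.ball k.center (k.radius / 2)

theorem closedBall_subset : Metric.closedBall k.center (k.radius / 2) ⊆ k.chart.target := by
  rw [k.target_eq]
  exact Metric.closedBall_subset_ball (half_lt_self k.radius_pos)

theorem core_subset : k.core ⊆ k.chart.source := by
  rintro _ ⟨y, hy, rfl⟩
  exact k.chart.map_target (k.closedBall_subset hy)

theorem isCompact_core [ProperSpace E] : IsCompact k.core :=
  (isCompact_closedBall _ _).image_of_continuousOn
    (k.chart.continuousOn_symm.mono k.closedBall_subset)

theorem isOpen_openCore : IsOpen k.openCore :=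
  k.chart.isOpen_inter_preimage Metric.isOpen_ball

theorem mem_core {x : X} (hx : x ∈ k.chart.source)
    (h : ‖k.chart x - k.center‖ ≤ k.radius / 2) : x ∈ k.core :=
  ⟨k.chart x, by rwa [mem_closedBall_iff_norm], k.chart.left_inv hx⟩

theorem openCore_subset : k.openCore ⊆ k.core := fun _ hx =>
  k.mem_core hx.1 (mem_ball_iff_norm.1 hx.2).le

theorem rise_eq {Y : Type*} [TopologicalSpace Y] (H : C(unitInterval × Y, X)) (y : Y)
    (h : ∀ t, H (t, y) ∈ k.chart.source) :
    rise z g H y = k.height (H (1, y)) - k.height (H (0, y)) := by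
  rw [rise, k.displacement_eq (track H y) h]
  change k.height (H (1, y)) + g (H (1, y)) - (k.height (H (0, y)) + g (H (0, y))) - _ = _
  ring

theorem abs_rise_le {Y : Type*} [TopologicalSpace Y] (H : C(unitInterval × Y, X)) (y : Y)
    (h : ∀ t, H (t, y) ∈ k.chart.source) : |rise z g H y| ≤ 2 * k.bound := by
  rw [k.rise_eq H y h]
  have h₁ := abs_le.1 (k.abs_height_le _ (h 1))
  have h₀ := abs_le.1 (k.abs_height_le _ (h 0))
  exact abs_le.2 ⟨by linarith, by linarith⟩

/-! ### Moving upwards -/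

/-- The length of the move of `x` in the direction `dir`. -/
def moveLength (x : X) : ℝ := max 0 (k.radius / 2 - ‖k.chart x - k.center‖)

theorem moveLength_nonneg (x : X) : 0 ≤ k.moveLength x := le_max_left _ _

open Classical in
/-- The homotopy that moves the points of the core in the direction `dir`. -/
def moveFun (p : unitInterval × X) : X :=
  if p.2 ∈ k.core then k.chart.symm (k.chart p.2 + ((p.1 : ℝ) * k.moveLength p.2) • k.dir) else p.2

theorem add_mem_target {x : X} (hx : x ∈ k.chart.source) (t : unitInterval) :
    k.chart x + ((t : ℝ) * k.moveLength x) • k.dir ∈ k.chart.target := by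
  rw [k.target_eq, mem_ball_iff_norm, add_sub_right_comm]
  have h₀ : ‖k.chart x - k.center‖ < k.radius := by
    have := k.chart.map_source hx
    rwa [k.target_eq, mem_ball_iff_norm] at this
  have hm : 0 ≤ k.moveLength x := le_max_left _ _
  have h₁ : ‖((t : ℝ) * k.moveLength x) • k.dir‖ ≤ k.moveLength x := by
    rw [norm_smul, Real.norm_of_nonneg (mul_nonneg t.2.1 hm)]
    calc (t : ℝ) * k.moveLength x * ‖k.dir‖ ≤ 1 * k.moveLength x * 1 := by
          gcongr
          · exact t.2.2
          · exact k.norm_dir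
      _ = k.moveLength x := by ring
  refine (norm_add_le _ _).trans_lt ?_
  refine (add_le_add_right h₁ _).trans_lt ?_
  rw [moveLength, ← max_add_add_left]
  refine max_lt (by simpa using h₀) ?_
  linarith [k.radius_pos]

theorem moveFun_eq {t : unitInterval} {x : X} (hx : x ∈ k.chart.source) :
    k.moveFun (t, x) = k.chart.symm (k.chart x + ((t : ℝ) * k.moveLength x) • k.dir) := by
  rw [moveFun]
  split_ifs with h
  · rfl
  · have : k.moveLength x = 0 := by
      refine max_eq_left (not_lt.1 fun h' => h (k.mem_core hx ?_))
      linarith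
    simp [this, k.chart.left_inv hx]

theorem continuousOn_move : ContinuousOn k.moveFun (Set.univ ×ˢ k.chart.source) := by
  have hc : ContinuousOn (fun p : unitInterval × X => k.chart p.2) (Set.univ ×ˢ k.chart.source) :=
    k.chart.continuousOn.comp continuousOn_snd fun p hp => hp.2
  refine ContinuousOn.congr (f := fun p => k.chart.symm
    (k.chart p.2 + ((p.1 : ℝ) * k.moveLength p.2) • k.dir)) ?_ fun p hp => k.moveFun_eq hp.2
  refine k.chart.continuousOn_symm.comp ?_ fun p hp => k.add_mem_target hp.2 p.1
  refine hc.add (ContinuousOn.smul (ContinuousOn.mul ?_ ?_) continuousOn_const)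
  · exact (continuous_subtype_val.comp continuous_fst).continuousOn
  · exact continuousOn_const.sup (continuousOn_const.sub (hc.sub continuousOn_const).norm)

variable [ProperSpace E] [T2Space X]

theorem continuous_moveFun : Continuous k.moveFun := by
  rw [continuous_iff_continuousAt]
  rintro ⟨t, x⟩
  by_cases hx : x ∈ k.chart.source
  · exact k.continuousOn_move.continuousAt
      ((isOpen_univ.prod k.chart.open_source).mem_nhds ⟨trivial, hx⟩)
  · have ho : IsOpen k.coreᶜ := k.isCompact_core.isClosed.isOpen_compl
    have hx' : x ∈ k.coreᶜ := fun h => hx (k.core_subset h)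
    refine ContinuousAt.congr (f := Prod.snd) continuousAt_snd ?_
    filter_upwards [(isOpen_univ.prod ho).mem_nhds ⟨trivial, hx'⟩] with p hp
    exact (if_neg hp.2).symm

/-- `moveFun` as a homotopy; it is continuous because it fixes all points outside the core. -/
def move : C(unitInterval × X, X) := ⟨k.moveFun, k.continuous_moveFun⟩

theorem move_zero (x : X) : k.move (0, x) = x := by
  change k.moveFun (0, x) = x
  rw [moveFun]
  split_ifs with h
  · simp [k.chart.left_inv (k.core_subset h)]
  · rfl

theorem move_mem_source {x : X} (hx : x ∈ k.chart.source) (t : unitInterval) :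
    k.move (t, x) ∈ k.chart.source := by
  change k.moveFun (t, x) ∈ _
  rw [k.moveFun_eq hx]
  exact k.chart.map_target (k.add_mem_target hx t)

theorem move_of_notMem {x : X} (hx : x ∉ k.core) (t : unitInterval) : k.move (t, x) = x :=
  if_neg hx

theorem rise_move_of_mem {x : X} (hx : x ∈ k.chart.source) :
    rise z g k.move x = k.height (k.move (1, x)) - k.height x := by
  rw [k.rise_eq k.move x (k.move_mem_source hx), k.move_zero]

theorem rise_move_of_notMem {x : X} (hx : x ∉ k.core) : rise z g k.move x = 0 :=
  rise_eq_zero z g _ _ fun t => by rw [k.move_of_notMem hx, k.move_of_notMem hx]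

theorem continuous_rise_move : Continuous (rise z g k.move) := by
  rw [continuous_iff_continuousAt]
  intro x
  by_cases hx : x ∈ k.chart.source
  · have hs := k.chart.open_source.mem_nhds hx
    refine ContinuousAt.congr (f := fun x => k.height (k.move (1, x)) - k.height x) ?_ ?_
    · refine ContinuousAt.sub ?_ (k.continuousOn_height.continuousAt hs)
      refine ContinuousAt.comp (f := fun x => k.move (1, x)) ?_
        (k.move.continuous.comp (by fun_prop)).continuousAt
      exact k.continuousOn_height.continuousAt
        (k.chart.open_source.mem_nhds (k.move_mem_source hx 1))
    · filter_upwards [hs] with y hy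
      exact (k.rise_move_of_mem hy).symm
  · have ho : IsOpen k.coreᶜ := k.isCompact_core.isClosed.isOpen_compl
    have hx' : x ∈ k.coreᶜ := fun h => hx (k.core_subset h)
    refine ContinuousAt.congr (f := fun _ => 0) continuousAt_const ?_
    filter_upwards [ho.mem_nhds hx'] with y hy
    exact (k.rise_move_of_notMem hy).symm

theorem rise_move_pos {x : X} (hx : x ∈ k.chart.source) (h : 0 < k.moveLength x) :
    0 < rise z g k.move x := by
  rw [k.rise_move_of_mem hx, sub_pos]
  have hm : k.move (1, x) = _ := k.moveFun_eq hx
  have ht := k.add_mem_target hx 1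
  simp only [Set.Icc.coe_one, one_mul] at hm ht
  rw [hm]
  conv_lhs => rw [← k.chart.left_inv hx]
  exact k.height_lt _ (k.chart.map_source hx) _ h ht

theorem rise_move_pos_of_mem {x : X} (hx : x ∈ k.openCore) : 0 < rise z g k.move x := by
  refine k.rise_move_pos hx.1 (lt_max_of_lt_right ?_)
  have := hx.2
  rw [Set.mem_preimage, mem_ball_iff_norm] at this
  linarith

theorem rise_move_nonneg (x : X) : 0 ≤ rise z g k.move x := by
  by_cases hx : x ∈ k.core
  · rcases (k.moveLength_nonneg x).eq_or_lt with h | h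
    · refine (rise_eq_zero z g _ _ fun t => ?_).ge
      change k.moveFun _ = k.moveFun _
      rw [k.moveFun_eq (k.core_subset hx), k.moveFun_eq (k.core_subset hx), ← h]
      simp
    · exact (k.rise_move_pos (k.core_subset hx) h).le
  · exact (k.rise_move_of_notMem hx).ge

theorem move_eq_of_rise_eq_zero {x : X} (h : rise z g k.move x = 0) : k.move (1, x) = x := by
  by_cases hx : x ∈ k.core
  · rcases (k.moveLength_nonneg x).eq_or_lt with h' | h'
    · change k.moveFun _ = _
      rw [k.moveFun_eq (k.core_subset hx), ← h']
      simp [k.chart.left_inv (k.core_subset hx)]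
    · exact absurd h (k.rise_move_pos (k.core_subset hx) h').ne'
  · exact k.move_of_notMem hx 1

end HeightChart

section Raise

variable {X : Type*} [TopologicalSpace X] [T2Space X] {z : singularCocycles X ℤ 1} {g : X → ℝ}
  {E : Type*} [NormedAddCommGroup E] [NormedSpace ℝ E] [ProperSpace E]

/-- Performing the moves in a list of charts one after another. A point that does not rise does not
move, so it can still be moved by the later charts. -/
theorem exists_raise_list (l : List (HeightChart z g E)) :
    ∃ H : C(unitInterval × X, X), (∀ x, H (0, x) = x) ∧ Continuous (rise z g H) ∧
      (∀ x, 0 ≤ rise z g H x) ∧ (∀ x, rise z g H x = 0 → H (1, x) = x) ∧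
      ∀ k ∈ l, ∀ x ∈ k.openCore, 0 < rise z g H x := by
  induction l with
  | nil =>
    have h (x : X) : rise z g (ContinuousMap.snd : C(unitInterval × X, X)) x = 0 :=
      rise_eq_zero z g _ _ fun _ => rfl
    refine ⟨ContinuousMap.snd, fun _ => rfl, ?_, fun x => (h x).ge, fun _ _ => rfl, by simp⟩
    rw [show rise z g (ContinuousMap.snd : C(unitInterval × X, X)) = fun _ => 0 from funext h]
    exact continuous_const
  | cons k l ih =>
    obtain ⟨H, h0, hc, hnn, hz, hpos⟩ := ih
    have hcomp : ∀ x, k.move (1, x) =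
        (H.comp ((ContinuousMap.id _).prodMap (endMap k.move))) (0, x) := fun x => (h0 _).symm
    have hr (x : X) : rise z g (concat _ _ hcomp) x =
        rise z g k.move x + rise z g H (k.move (1, x)) := rise_concat z g hcomp x
    refine ⟨concat _ _ hcomp, fun x => ?_, ?_, fun x => ?_, fun x hx => ?_, ?_⟩
    · rw [concat_zero, k.move_zero]
    · rw [show rise z g (concat _ _ hcomp) = _ from funext hr]
      exact k.continuous_rise_move.add (hc.comp (k.move.continuous.comp (by fun_prop)))
    · rw [hr]
      exact add_nonneg (k.rise_move_nonneg x) (hnn _)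
    · rw [hr, add_eq_zero_iff_of_nonneg (k.rise_move_nonneg x) (hnn _)] at hx
      rw [concat_one]
      change H (1, k.move (1, x)) = x
      rw [hz _ hx.2, k.move_eq_of_rise_eq_zero hx.1]
    · intro k' hk' x hx
      rw [hr]
      rcases (k.rise_move_nonneg x).eq_or_lt with h | h
      · rcases List.mem_cons.1 hk' with rfl | hk'
        · exact absurd h (k'.rise_move_pos_of_mem hx).ne
        · rw [← h, zero_add, k.move_eq_of_rise_eq_zero h.symm]
          exact hpos k' hk' x hx
      · exact add_pos_of_pos_of_nonneg h (hnn _)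

variable [CompactSpace X]

/-- If the cores of finitely many height charts cover the compact space `X`, then there are
homotopies of the identity along which all points rise as much as one likes. -/
theorem exists_raise (l : List (HeightChart z g E)) (hl : ∀ x, ∃ k ∈ l, x ∈ k.openCore) (T : ℝ) :
    ∃ H : C(unitInterval × X, X), (∀ x, H (0, x) = x) ∧ ∀ x, T ≤ rise z g H x := by
  obtain ⟨H, h0, hc, hnn, -, hpos⟩ := exists_raise_list l
  obtain ⟨δ, hδ, hr⟩ : ∃ δ > 0, ∀ x, δ ≤ rise z g H x := by
    rcases isEmpty_or_nonempty X with hX | hX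
    · exact ⟨1, one_pos, fun x => hX.elim x⟩
    · obtain ⟨x₀, -, hx₀⟩ := isCompact_univ.exists_isMinOn Set.univ_nonempty hc.continuousOn
      obtain ⟨k, hk, hx⟩ := hl x₀
      exact ⟨_, hpos k hk x₀ hx, fun x => hx₀ (Set.mem_univ x)⟩
  have main (N : ℕ) : ∃ H : C(unitInterval × X, X), (∀ x, H (0, x) = x) ∧
      ∀ x, N * δ ≤ rise z g H x := by
    induction N with
    | zero => exact ⟨H, h0, fun x => by simpa using hnn x⟩
    | succ N ih =>
      obtain ⟨G, hG0, hG⟩ := ih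
      have hcomp : ∀ x, H (1, x) =
          (G.comp ((ContinuousMap.id _).prodMap (endMap H))) (0, x) := fun x => (hG0 _).symm
      refine ⟨concat _ _ hcomp, fun x => by rw [concat_zero, h0], fun x => ?_⟩
      rw [rise_concat]
      have h₁ := hr x
      have h₂ : (N : ℝ) * δ ≤ rise z g (G.comp ((ContinuousMap.id _).prodMap (endMap H))) x :=
        hG (H (1, x))
      push_cast
      linarith
  obtain ⟨N, hN⟩ := exists_nat_ge (T / δ)
  obtain ⟨G, hG0, hG⟩ := main N
  exact ⟨G, hG0, fun x => ((div_le_iff₀ hδ).1 hN).trans (hG x)⟩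

end Raise

/-! ### Straightening small simplices -/

theorem sum_faceMap_smul {n : ℕ} {M : Type*} [AddCommGroup M] [Module ℝ M] (i : Fin (n + 2))
    (x : Simplex n) (h : Fin (n + 2) → M) :
    ∑ j, (faceMap i x : Simplex (n + 1)) j • h j = ∑ j, x j • h (i.succAbove j) := by
  rw [faceMap_eq_affineSimplex]
  simp only [affineSimplex_apply, vertices, Function.comp_apply, stdSimplex_vertex_apply,
    Finset.sum_smul]
  rw [Finset.sum_comm]
  simp

section Straighten

variable {X : Type*} [MetricSpace X] {z : singularCocycles X ℤ 1} {g : X → ℝ}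
  {E : Type*} [NormedAddCommGroup E] [NormedSpace ℝ E]

/-- The points of the simplex `σ` are within distance `ε` of all the points `ν i`. -/
def IsClose (ε : ℝ) {n : ℕ} (σ : C(Simplex n, X)) (ν : Fin (n + 1) → X) : Prop :=
  ∀ x i, dist (σ x) (ν i) < ε

theorem IsClose.face {ε : ℝ} {n : ℕ} {σ : C(Simplex (n + 1), X)} {ν : Fin (n + 2) → X}
    (h : IsClose ε σ ν) (i : Fin (n + 2)) : IsClose ε (σ.comp (faceMap i)) (ν ∘ i.succAbove) :=
  fun _ _ => h _ _

/-- A natural family `H` of homotopies, starting at the simplices `σ` that are `ε`-close to a tuple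
`ν` and staying `ε'`-close to it, such that the rise along all tracks is bounded by `C` and, for
tuples in `good`, the simplex at the end depends on `ν` only. -/
structure IsStraightening (z : singularCocycles X ℤ 1) (g : X → ℝ) (ε ε' C : ℝ)
    (good : Set (Set X))
    (H : ∀ n, C(Simplex n, X) → (Fin (n + 1) → X) → C(unitInterval × Simplex n, X)) : Prop where
  zero : ∀ n σ ν, IsClose ε σ ν → ∀ x, H n σ ν (0, x) = σ x
  natural : ∀ n σ ν, IsClose ε σ ν → ∀ i,
    H n (σ.comp (faceMap i)) (ν ∘ i.succAbove) = (H (n + 1) σ ν).comp (prismFace i)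
  close : ∀ n σ ν, IsClose ε σ ν → ∀ t x i, dist (H n σ ν (t, x)) (ν i) < ε'
  rise_le : ∀ n σ ν, IsClose ε σ ν → ∀ x, |rise z g (H n σ ν) x| ≤ C
  end_eq : ∀ n σ σ' ν, IsClose ε σ ν → IsClose ε σ' ν → (∃ s ∈ good, ∀ i, ν i ∈ s) →
    ∀ x, H n σ ν (1, x) = H n σ' ν (1, x)

namespace HeightChart

variable (k : HeightChart z g E)

theorem exists_convex_nhd [ProperSpace E] {ε' : ℝ} (hε' : 0 < ε') :
    ∃ ε > 0, ε ≤ ε' ∧ ∀ p ∈ k.core, ∃ V : Set E, Convex ℝ V ∧ V ⊆ k.chart.target ∧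
      (∀ x, dist x p < ε → x ∈ k.chart.source ∧ k.chart x ∈ V) ∧
      ∀ y ∈ V, dist (k.chart.symm y) p < ε' := by
  have h (q : k.core) : ∃ δ > 0, Metric.ball (k.chart q) δ ⊆ k.chart.target ∧
      ∀ y ∈ Metric.ball (k.chart q) δ, dist (k.chart.symm y) q < ε' / 2 := by
    have hq := k.chart.map_source (k.core_subset q.2)
    have h₁ : k.chart.target ∈ nhds (k.chart q) := k.chart.open_target.mem_nhds hq
    have h₂ : k.chart.symm ⁻¹' Metric.ball (q : X) (ε' / 2) ∈ nhds (k.chart q) := by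
      refine (k.chart.continuousOn_symm.continuousAt h₁) ?_
      rw [k.chart.left_inv (k.core_subset q.2)]
      exact Metric.ball_mem_nhds _ (half_pos hε')
    obtain ⟨δ, hδ, h⟩ := Metric.mem_nhds_iff.1 (Filter.inter_mem h₁ h₂)
    exact ⟨δ, hδ, fun y hy => (h hy).1, fun y hy => (h hy).2⟩
  choose δ hδ ht hd using h
  obtain ⟨η, hη, hL⟩ := lebesgue_number_lemma_of_metric k.isCompact_core
    (c := fun q : k.core => k.chart.source ∩ k.chart ⁻¹' Metric.ball (k.chart q) (δ q))
    (fun q => k.chart.isOpen_inter_preimage Metric.isOpen_ball)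
    (fun q hq => Set.mem_iUnion.2 ⟨⟨q, hq⟩, k.core_subset hq, Metric.mem_ball_self (hδ _)⟩)
  refine ⟨min η ε', lt_min hη hε', min_le_right _ _, fun p hp => ?_⟩
  obtain ⟨q, hq⟩ := hL p hp
  refine ⟨Metric.ball (k.chart q) (δ q), convex_ball _ _, ht q, fun x hx => ?_, fun y hy => ?_⟩
  · exact hq (hx.trans_le (min_le_left _ _))
  · have hp' := hd q _ (hq (Metric.mem_ball_self hη)).2
    rw [k.chart.left_inv (k.core_subset hp), dist_comm] at hp'
    refine (dist_triangle _ (q : X) _).trans_lt ?_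
    linarith [hd q y hy]

open Classical in
/-- The total weight of the vertices in the core. -/
def weight {n : ℕ} (ν : Fin (n + 1) → X) (x : Simplex n) : ℝ :=
  ∑ i, x i • (if ν i ∈ k.core then 1 else 0)

/-- Straightening in one chart: the points of `σ` move linearly towards the affine simplex
with vertices `ν i`, by an amount that depends on the weight of the vertices in the core. -/
def straightenPoint {n : ℕ} (σ : C(Simplex n, X)) (ν : Fin (n + 1) → X)
    (p : unitInterval × Simplex n) : E :=
  k.chart (σ p.2) + ((p.1 : ℝ) * k.weight ν p.2) • (∑ j, p.2 j • k.chart (ν j) - k.chart (σ p.2))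

open Classical in
/-- The homotopy of `straightenPoint`, for simplices with a vertex in the core; the other simplices
are not moved. -/
def straightenFun {n : ℕ} (σ : C(Simplex n, X)) (ν : Fin (n + 1) → X)
    (p : unitInterval × Simplex n) : X :=
  if ∃ i, ν i ∈ k.core then k.chart.symm (k.straightenPoint σ ν p) else σ p.2

open Classical in
/-- `straightenFun` as a homotopy; it is continuous if `σ` is close to `ν`. -/
def straighten (n : ℕ) (σ : C(Simplex n, X)) (ν : Fin (n + 1) → X) :
    C(unitInterval × Simplex n, X) :=
  if h : Continuous (k.straightenFun σ ν) then ⟨_, h⟩ else σ.comp ContinuousMap.snd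

theorem weight_nonneg {n : ℕ} (ν : Fin (n + 1) → X) (x : Simplex n) : 0 ≤ k.weight ν x :=
  Finset.sum_nonneg fun i _ => mul_nonneg (stdSimplex.zero_le x i) (by split_ifs <;> norm_num)

theorem weight_le_one {n : ℕ} (ν : Fin (n + 1) → X) (x : Simplex n) : k.weight ν x ≤ 1 := by
  rw [← stdSimplex.sum_eq_one x]
  refine Finset.sum_le_sum fun i _ => mul_le_of_le_one_right (stdSimplex.zero_le x i) ?_
  split_ifs <;> norm_num

theorem continuous_weight {n : ℕ} (ν : Fin (n + 1) → X) : Continuous (k.weight ν) :=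
  continuous_finsetSum _ fun i _ =>
    ((continuous_apply i).comp continuous_subtype_val).smul continuous_const

theorem straightenPoint_mem {n : ℕ} {σ : C(Simplex n, X)} {ν : Fin (n + 1) → X} {V : Set E}
    (hV : Convex ℝ V) (hσ : ∀ x, k.chart (σ x) ∈ V) (hν : ∀ i, k.chart (ν i) ∈ V)
    (p : unitInterval × Simplex n) : k.straightenPoint σ ν p ∈ V := by
  have h₁ : ∑ j, p.2 j • k.chart (ν j) ∈ V :=
    hV.sum_mem (fun i _ => stdSimplex.zero_le p.2 i) (stdSimplex.sum_eq_one p.2) fun i _ => hν i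
  exact hV.add_smul_sub_mem (hσ _) h₁ ⟨mul_nonneg p.1.2.1 (k.weight_nonneg ν _),
    mul_le_one₀ p.1.2.2 (k.weight_nonneg ν _) (k.weight_le_one ν _)⟩

theorem straightenPoint_face {n : ℕ} (σ : C(Simplex (n + 1), X)) (ν : Fin (n + 2) → X)
    (i : Fin (n + 2)) (t : unitInterval) (x : Simplex n) :
    k.straightenPoint (σ.comp (faceMap i)) (ν ∘ i.succAbove) (t, x) =
      k.straightenPoint σ ν (t, faceMap i x) := by
  simp only [straightenPoint, weight, sum_faceMap_smul]
  rfl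

/-- Straightening in one chart makes those simplices depend on `ν` only for which all `ν i` lie in
the core. -/
theorem exists_isStraightening [ProperSpace E] {ε' : ℝ} (hε' : 0 < ε') :
    ∃ ε > 0, ε ≤ ε' ∧ IsStraightening z g ε ε' |2 * k.bound| {k.core} k.straighten := by
  obtain ⟨η, hη, hηε, hV⟩ := k.exists_convex_nhd (half_pos hε')
  refine ⟨η / 2, half_pos hη, by linarith, ?_⟩
  -- If some `ν i` lies in the core, then everything takes place in a convex set in the chart.
  have key {n : ℕ} {σ : C(Simplex n, X)} {ν : Fin (n + 1) → X} (hσ : IsClose (η / 2) σ ν)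
      (hi : ∃ i, ν i ∈ k.core) : ∃ p, (∀ i, dist p (ν i) < η) ∧ ∃ V : Set E, Convex ℝ V ∧
        V ⊆ k.chart.target ∧ (∀ x, σ x ∈ k.chart.source) ∧ (∀ x, k.chart (σ x) ∈ V) ∧
        (∀ i, k.chart (ν i) ∈ V) ∧ ∀ y ∈ V, dist (k.chart.symm y) p < ε' / 2 := by
    obtain ⟨i, hi⟩ := hi
    obtain ⟨V, hV₁, hV₂, hV₃, hV₄⟩ := hV _ hi
    have hν (j) : dist (ν j) (ν i) < η := by
      have h₁ := hσ (vertexZero n) i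
      have h₂ := hσ (vertexZero n) j
      have := dist_triangle_left (ν j) (ν i) (σ (vertexZero n))
      linarith
    exact ⟨ν i, fun j => by rw [dist_comm]; exact hν j, V, hV₁, hV₂,
      fun x => (hV₃ _ ((hσ x i).trans (half_lt_self hη))).1,
      fun x => (hV₃ _ ((hσ x i).trans (half_lt_self hη))).2, fun j => (hV₃ _ (hν j)).2, hV₄⟩
  have hcont {n : ℕ} {σ : C(Simplex n, X)} {ν : Fin (n + 1) → X} (hσ : IsClose (η / 2) σ ν) :
      Continuous (k.straightenFun σ ν) := by
    by_cases hi : ∃ i, ν i ∈ k.core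
    · obtain ⟨p, -, V, hV₁, hV₂, hs, hσV, hνV, -⟩ := key hσ hi
      have e : k.straightenFun σ ν = fun p => k.chart.symm (k.straightenPoint σ ν p) :=
        funext fun p => if_pos hi
      rw [e]
      have hc : Continuous fun p : unitInterval × Simplex n => k.chart (σ p.2) :=
        k.chart.continuousOn.comp_continuous (by fun_prop) fun p => hs _
      refine k.chart.continuousOn_symm.comp_continuous ?_
        fun p => hV₂ (k.straightenPoint_mem hV₁ hσV hνV p)
      refine hc.add (Continuous.smul (Continuous.mul (by fun_prop)
        ((k.continuous_weight ν).comp continuous_snd)) (Continuous.sub ?_ hc))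
      exact continuous_finsetSum _ fun i _ => Continuous.smul
        ((continuous_apply i).comp (continuous_subtype_val.comp continuous_snd)) continuous_const
    · have e : k.straightenFun σ ν = fun p => σ p.2 := funext fun p => if_neg hi
      rw [e]
      fun_prop
  have happ {n : ℕ} {σ : C(Simplex n, X)} {ν : Fin (n + 1) → X} (hσ : IsClose (η / 2) σ ν)
      (p) : k.straighten n σ ν p = k.straightenFun σ ν p := by
    rw [straighten, dif_pos (hcont hσ)]
    rfl
  have hpos {n : ℕ} {σ : C(Simplex n, X)} {ν : Fin (n + 1) → X} (hσ : IsClose (η / 2) σ ν)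
      (hi : ∃ i, ν i ∈ k.core) (p) :
      k.straighten n σ ν p = k.chart.symm (k.straightenPoint σ ν p) := by
    rw [happ hσ]
    exact if_pos hi
  have hneg {n : ℕ} {σ : C(Simplex n, X)} {ν : Fin (n + 1) → X} (hσ : IsClose (η / 2) σ ν)
      (hi : ¬ ∃ i, ν i ∈ k.core) (p) : k.straighten n σ ν p = σ p.2 := by
    rw [happ hσ]
    exact if_neg hi
  constructor
  · intro n σ ν hσ x
    by_cases hi : ∃ i, ν i ∈ k.core
    · obtain ⟨p, -, V, hV₁, hV₂, hs, hσV, hνV, -⟩ := key hσ hi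
      rw [hpos hσ hi]
      simp [straightenPoint, k.chart.left_inv (hs x)]
    · exact hneg hσ hi _
  · intro n σ ν hσ i
    ext1 ⟨t, x⟩
    change _ = k.straighten (n + 1) σ ν (t, faceMap i x)
    by_cases hi : ∃ j, ν j ∈ k.core
    · obtain ⟨p, -, V, hV₁, hV₂, hs, hσV, hνV, -⟩ := key hσ hi
      rw [hpos hσ hi, ← straightenPoint_face]
      by_cases hi' : ∃ j, (ν ∘ i.succAbove) j ∈ k.core
      · rw [hpos (hσ.face i) hi']
      · rw [hneg (hσ.face i) hi']
        have hw : k.weight (ν ∘ i.succAbove) x = 0 :=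
          Finset.sum_eq_zero fun j _ => by rw [if_neg fun h => hi' ⟨j, h⟩, smul_zero]
        simp only [straightenPoint, hw, mul_zero, zero_smul, add_zero]
        exact (k.chart.left_inv (hs _)).symm
    · rw [hneg hσ hi, hneg (hσ.face i) fun ⟨j, hj⟩ => hi ⟨_, hj⟩]
      rfl
  · intro n σ ν hσ t x i
    by_cases hi : ∃ j, ν j ∈ k.core
    · obtain ⟨p, hp, V, hV₁, hV₂, hs, hσV, hνV, hd⟩ := key hσ hi
      rw [hpos hσ hi]
      have h₁ := hd _ (k.straightenPoint_mem hV₁ hσV hνV (t, x))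
      refine (dist_triangle _ p _).trans_lt ?_
      linarith [hp i]
    · rw [hneg hσ hi]
      exact (hσ x i).trans_le (by linarith)
  · intro n σ ν hσ x
    by_cases hi : ∃ j, ν j ∈ k.core
    · obtain ⟨p, hp, V, hV₁, hV₂, hs, hσV, hνV, hd⟩ := key hσ hi
      refine (k.abs_rise_le _ _ fun t => ?_).trans (le_abs_self _)
      rw [hpos hσ hi]
      exact k.chart.map_target (hV₂ (k.straightenPoint_mem hV₁ hσV hνV _))
    · rw [rise_eq_zero z g _ _ fun t => by rw [hneg hσ hi, hneg hσ hi], abs_zero]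
      positivity
  · rintro n σ σ' ν hσ hσ' ⟨s, rfl, hs⟩ x
    rw [hpos hσ ⟨0, hs 0⟩, hpos hσ' ⟨0, hs 0⟩]
    have hw : k.weight ν x = 1 := by
      rw [weight, ← stdSimplex.sum_eq_one x]
      exact Finset.sum_congr rfl fun j _ => by simp [hs j]
    simp [straightenPoint, hw]

end HeightChart

open Classical in
theorem exists_isStraightening_list [ProperSpace E] (l : List (HeightChart z g E)) : ∃ C,
    ∀ ε' > 0, ∃ ε > 0, ε ≤ ε' ∧ ∃ H, IsStraightening z g ε ε' C {s | ∃ k ∈ l, k.core = s} H := by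
  induction l with
  | nil =>
    refine ⟨0, fun ε' hε' => ⟨ε', hε', le_rfl, fun n σ ν => σ.comp ContinuousMap.snd, ?_⟩⟩
    constructor
    · exact fun _ _ _ _ _ => rfl
    · exact fun _ _ _ _ _ => rfl
    · exact fun _ _ _ h _ _ _ => h _ _
    · intro n σ ν _ x
      rw [rise_eq_zero z g _ _ fun t => rfl, abs_zero]
    · rintro n σ σ' ν _ _ ⟨s, ⟨k, hk, -⟩, -⟩
      simp at hk
  | cons k l ih =>
    obtain ⟨C, ih⟩ := ih
    refine ⟨|2 * k.bound| + C, fun ε' hε' => ?_⟩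
    obtain ⟨ε₁, hε₁, hle₁, B, hB⟩ := ih ε' hε'
    obtain ⟨ε, hε, hle, hA⟩ := k.exists_isStraightening hε₁
    let A := k.straighten
    let B' (n : ℕ) (σ : C(Simplex n, X)) (ν : Fin (n + 1) → X) := B n (endMap (A n σ ν)) ν
    let H (n : ℕ) (σ : C(Simplex n, X)) (ν : Fin (n + 1) → X) : C(unitInterval × Simplex n, X) :=
      if h : ∀ y, A n σ ν (1, y) = B' n σ ν (0, y) then concat _ _ h else A n σ ν
    have hcl {n : ℕ} {σ : C(Simplex n, X)} {ν : Fin (n + 1) → X} (hσ : IsClose ε σ ν) :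
        IsClose ε₁ (endMap (A n σ ν)) ν := fun x i => hA.close n σ ν hσ 1 x i
    have hm {n : ℕ} {σ : C(Simplex n, X)} {ν : Fin (n + 1) → X} (hσ : IsClose ε σ ν) (y) :
        A n σ ν (1, y) = B' n σ ν (0, y) := (hB.zero n _ ν (hcl hσ) y).symm
    have hH {n : ℕ} {σ : C(Simplex n, X)} {ν : Fin (n + 1) → X} (hσ : IsClose ε σ ν) :
        H n σ ν = concat _ _ (hm hσ) := dif_pos _
    refine ⟨ε, hε, hle.trans hle₁, H, ?_⟩
    constructor
    · intro n σ ν hσ x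
      rw [hH hσ, concat_zero]
      exact hA.zero n σ ν hσ x
    · intro n σ ν hσ i
      rw [hH hσ, hH (hσ.face i)]
      have e := hA.natural n σ ν hσ i
      refine concat_comp (hm hσ) (faceMap i) e ?_ _
      change B n (endMap (k.straighten n (σ.comp (faceMap i)) (ν ∘ i.succAbove))) _ = _
      rw [e]
      exact hB.natural n _ ν (hcl hσ) i
    · intro n σ ν hσ t x i
      rw [hH hσ]
      obtain ⟨s, h | h⟩ := concat_mem (hm hσ) t x
      · rw [h]
        exact (hA.close n σ ν hσ s x i).trans_le hle₁
      · rw [h]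
        exact hB.close n _ ν (hcl hσ) s x i
    · intro n σ ν hσ x
      rw [hH hσ, rise_concat]
      exact (abs_add_le _ _).trans (add_le_add (hA.rise_le n σ ν hσ x) (hB.rise_le n _ ν (hcl hσ) x))
    · rintro n σ σ' ν hσ hσ' ⟨_, ⟨k', hk', rfl⟩, hs⟩ x
      rw [hH hσ, hH hσ', concat_one, concat_one]
      rcases List.mem_cons.1 hk' with rfl | hk'
      · have e : endMap (A n σ ν) = endMap (A n σ' ν) :=
          ContinuousMap.ext (hA.end_eq n σ σ' ν hσ hσ' ⟨_, rfl, hs⟩)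
        simp only [B', e]
      · exact hB.end_eq n _ _ ν (hcl hσ) (hcl hσ') ⟨_, ⟨k', hk', rfl⟩, hs⟩ x

variable [CompactSpace X]

/-- If the cores of finitely many height charts cover `X`, then there is a natural homotopy from the
simplices `σ` close to a tuple `ν` to simplices that depend on `ν` only, along which the rise is
bounded. -/
theorem exists_isStraightening_univ [ProperSpace E] (l : List (HeightChart z g E))
    (hl : ∀ x, ∃ k ∈ l, x ∈ k.openCore) :
    ∃ ε > 0, ∃ ε' C H, IsStraightening z g ε ε' C {Set.univ} H := by
  obtain ⟨η, hη, hL⟩ := lebesgue_number_lemma_of_metric isCompact_univ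
    (c := fun k : {k // k ∈ l} => k.1.openCore) (fun k => k.1.isOpen_openCore) fun x _ => by
      obtain ⟨k, hk, hx⟩ := hl x
      exact Set.mem_iUnion.2 ⟨⟨k, hk⟩, hx⟩
  obtain ⟨C, hC⟩ := exists_isStraightening_list l
  obtain ⟨ε, hε, hle, H, hH⟩ := hC (η / 2) (half_pos hη)
  refine ⟨ε, hε, η / 2, C, H, hH.zero, hH.natural, hH.close, hH.rise_le, ?_⟩
  intro n σ σ' ν hσ hσ' _
  refine hH.end_eq n σ σ' ν hσ hσ' ?_
  obtain ⟨k, hk⟩ := hL (ν 0) trivial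
  refine ⟨_, ⟨k.1, k.2, rfl⟩, fun i => k.1.openCore_subset (hk ?_)⟩
  have h₁ := hσ (vertexZero n) i
  have h₂ := hσ (vertexZero n) 0
  have := dist_triangle_left (ν i) (ν 0) (σ (vertexZero n))
  rw [Metric.mem_ball]
  linarith

end Straighten

section Bounded

variable {X : Type*} [TopologicalSpace X] {z : singularCocycles X ℤ 1} {g : X → ℝ}
  {E : Type*} [NormedAddCommGroup E] [NormedSpace ℝ E]

/-- The real cocycle `z - δg` is bounded on the straight paths in a singular simplex. -/
theorem exists_abs_displacement_le (h : ∀ x : X, ∃ k : HeightChart z g E, x ∈ k.chart.source) {n : ℕ}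
    (σ : C(Simplex n, X)) : ∃ C, ∀ p,
      |displacement z σ (vertexZero n) p - (g (σ p) - g (σ (vertexZero n)))| ≤ C := by
  suffices ∃ C, ∀ p ∈ (Set.univ : Set (Simplex n)),
      |displacement z σ (vertexZero n) p - (g (σ p) - g (σ (vertexZero n)))| ≤ C by
    simpa using this
  refine isCompact_univ.induction_on (p := fun s => ∃ C, ∀ p ∈ s,
    |displacement z σ (vertexZero n) p - (g (σ p) - g (σ (vertexZero n)))| ≤ C) ?_ ?_ ?_ ?_
  · exact ⟨0, by simp⟩
  · rintro s t hst ⟨C, hC⟩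
    exact ⟨C, fun p hp => hC p (hst hp)⟩
  · rintro s t ⟨C, hC⟩ ⟨D, hD⟩
    refine ⟨max C D, fun p hp => ?_⟩
    rcases hp with hp | hp
    · exact (hC p hp).trans (le_max_left _ _)
    · exact (hD p hp).trans (le_max_right _ _)
  · rintro p -
    obtain ⟨k, hk⟩ := h (σ p)
    obtain ⟨r, hr, hball⟩ := Metric.mem_nhds_iff.1
      (σ.continuous.continuousAt.preimage_mem_nhds (k.chart.open_source.mem_nhds hk))
    refine ⟨Metric.ball p r, mem_nhdsWithin_of_mem_nhds (Metric.ball_mem_nhds p hr),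
      |displacement z σ (vertexZero n) p - (g (σ p) - g (σ (vertexZero n)))| + 2 * k.bound,
      fun q hq => ?_⟩
    have hseg (t : unitInterval) : σ (segmentPath p q t) ∈ k.chart.source := by
      refine hball ?_
      rw [Metric.mem_ball, Subtype.dist_eq]
      have hc : ((segmentPath p q t : Simplex n) : Fin (n + 1) → ℝ) ∈
          Metric.ball (p : Fin (n + 1) → ℝ) r :=
        (convex_ball _ _) (Metric.mem_ball_self hr) hq (sub_nonneg.2 t.2.2) t.2.1 (by ring)
      exact hc
    have e : displacement z σ p q =
        displacement z (σ.comp (segmentPath p q).toContinuousMap) 0 1 := by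
      rw [displacement_comp]
      change _ = displacement z σ (segmentPath p q 0) (segmentPath p q 1)
      rw [Path.source, Path.target]
    have h₁ := k.displacement_eq (σ.comp (segmentPath p q).toContinuousMap) hseg
    rw [← e] at h₁
    change (displacement z σ p q : ℝ) = k.height (σ (segmentPath p q 1)) +
      g (σ (segmentPath p q 1)) - (k.height (σ (segmentPath p q 0)) + g (σ (segmentPath p q 0))) at h₁
    rw [Path.source, Path.target] at h₁
    have hq' := abs_le.1 (k.abs_height_le (σ q) (hball hq))
    have hp' := abs_le.1 (k.abs_height_le (σ p) hk)
    rw [← displacement_add z σ _ p q]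
    push_cast
    rw [h₁, show (displacement z σ (vertexZero n) p : ℝ) + (k.height (σ q) + g (σ q) -
      (k.height (σ p) + g (σ p))) - (g (σ q) - g (σ (vertexZero n))) =
      (displacement z σ (vertexZero n) p - (g (σ p) - g (σ (vertexZero n)))) +
        (k.height (σ q) - k.height (σ p)) by ring]
    refine (abs_add_le _ _).trans (add_le_add le_rfl ?_)
    exact abs_le.2 ⟨by linarith, by linarith⟩

end Bounded

/-! ### The lattice argument -/

section Lattice

theorem isIntegral_inv_of_mem_adjoin {b : ℂ} (hb : b ≠ 0) (h : b⁻¹ ∈ Algebra.adjoin ℤ {b}) :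
    IsIntegral ℤ b⁻¹ := by
  rw [Algebra.adjoin_singleton_eq_range_aeval] at h
  obtain ⟨p, hp⟩ := h
  refine ⟨Polynomial.X ^ (p.natDegree + 1) - p.reverse, Polynomial.monic_X_pow_sub ?_, ?_⟩
  · refine Polynomial.degree_le_of_natDegree_le p.reverse_natDegree_le |>.trans_lt ?_
    exact_mod_cast Nat.lt_succ_self _
  · have : Invertible b := invertibleOfNonzero hb
    have h₁ := Polynomial.eval₂_reverse_mul_pow (algebraMap ℤ ℂ) b p
    have hp' : Polynomial.eval₂ (algebraMap ℤ ℂ) b p = b⁻¹ := hp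
    rw [hp', invOf_eq_inv] at h₁
    rw [Polynomial.eval₂_sub, Polynomial.eval₂_X_pow, sub_eq_zero, pow_succ]
    refine (congrArg ((b⁻¹) ^ p.natDegree * ·) h₁.symm).trans ?_
    rw [inv_pow]
    field_simp

variable {Z H : Type*} [AddCommGroup Z] [Module ℂ Z] [AddCommGroup H] [Module ℂ H]

/-- Let the class `π c` of an element `c` be determined by finitely many complex numbers `R c`, and
suppose that every class is `b` times a class whose numbers lie in the `ℤ[b]`-module generated by
those of the given class. If `b⁻¹` is not integral, then all classes are zero: the classes whose
numbers lie in a fixed finitely generated `ℤ[b]`-module `L ⊆ ℂ` form a finitely generated module `Q`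
with `Q = bQ`, so by Nakayama's lemma `Q` is killed by some `r ∈ 1 + b ℤ[b]`, and `r ≠ 0`. -/
theorem class_eq_zero_of_lattice (π : Z →ₗ[ℂ] H) {J : Type*} [Finite J] (R : Z →ₗ[ℂ] (J → ℂ))
    {b : ℂ} (hb : b ≠ 0) (hint : ¬ IsIntegral ℤ b⁻¹) (h₁ : ∀ c, R c = 0 → π c = 0)
    (h₂ : ∀ c, ∃ c', π c = b • π c' ∧
      ∀ j, R c' j ∈ Submodule.span (Algebra.adjoin ℤ {b}) (Set.range (R c))) (c : Z) :
    π c = 0 := by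
  set A := Algebra.adjoin ℤ {b} with hA
  have : Algebra.FiniteType ℤ A := by
    rw [← Subalgebra.fg_iff_finiteType]
    exact ⟨{b}, by simp [hA]⟩
  have : IsNoetherianRing A := Algebra.FiniteType.isNoetherianRing ℤ A
  let L : Submodule A ℂ := Submodule.span A (Set.range (R c))
  have hL : L.FG := Submodule.fg_span (Set.finite_range _)
  have hpi : (Submodule.pi Set.univ fun _ : J => L).FG := Submodule.fg_pi fun _ => hL
  let R' : Z →ₗ[A] (J → ℂ) := R.restrictScalars A
  let π' : Z →ₗ[A] H := π.restrictScalars A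
  let N : Submodule A Z := (Submodule.pi Set.univ fun _ : J => L).comap R'
  have hN {c : Z} : c ∈ N ↔ ∀ j, R c j ∈ L := by simp [N, R', Submodule.mem_pi]
  let f : N →ₗ[A] (Submodule.pi Set.univ fun _ : J => L) :=
    (R'.comp N.subtype).codRestrict _ fun c => c.2
  let p : N →ₗ[A] H := π'.comp N.subtype
  have hker : f.ker ≤ p.ker := fun c hc => by
    refine h₁ _ ?_
    exact congrArg Subtype.val (LinearMap.mem_ker.1 hc)
  have : Module.Finite A (Submodule.pi Set.univ fun _ : J => L) := Module.Finite.iff_fg.2 hpi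
  have : IsNoetherian A (Submodule.pi Set.univ fun _ : J => L) := inferInstance
  have : IsNoetherian A (N ⧸ f.ker) :=
    isNoetherian_of_injective (f.ker.liftQ f le_rfl)
      (LinearMap.ker_eq_bot.1 (Submodule.ker_liftQ_eq_bot _ _ _ le_rfl))
  have hQ : p.range.FG := by
    rw [← Submodule.range_liftQ f.ker p hker]
    exact Module.Finite.iff_fg.1 inferInstance
  let β : A := ⟨b, Algebra.self_mem_adjoin_singleton ℤ b⟩
  have hle : p.range ≤ Ideal.span {β} • p.range := by
    rintro _ ⟨⟨d, hd⟩, rfl⟩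
    obtain ⟨d', hd', hR⟩ := h₂ d
    have hd'N : d' ∈ N := hN.2 fun j =>
      Submodule.span_le.2 (by rintro _ ⟨i, rfl⟩; exact hN.1 hd i) (hR j)
    have e : p ⟨d, hd⟩ = β • p ⟨d', hd'N⟩ := hd'
    rw [e]
    exact Submodule.smul_mem_smul (Ideal.mem_span_singleton_self β) ⟨_, rfl⟩
  obtain ⟨r, hr, hr'⟩ := Submodule.exists_sub_one_mem_and_smul_eq_zero_of_fg_of_le_smul _ _ hQ hle
  have hr0 : (r : ℂ) ≠ 0 := by
    intro h0
    obtain ⟨s, hs⟩ := Ideal.mem_span_singleton.1 hr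
    have hs' : (r : ℂ) - 1 = b * s := congrArg Subtype.val hs
    rw [h0, zero_sub] at hs'
    refine hint (isIntegral_inv_of_mem_adjoin hb ?_)
    have : b⁻¹ = ((-s : A) : ℂ) := by
      refine inv_eq_of_mul_eq_one_right ?_
      push_cast
      linear_combination hs'
    rw [this]
    exact (-s).2
  have hc : c ∈ N := hN.2 fun j => Submodule.subset_span ⟨j, rfl⟩
  have := hr' (p ⟨c, hc⟩) ⟨_, rfl⟩
  exact (smul_eq_zero.1 (show (r : ℂ) • π c = 0 from this)).resolve_left hr0

end Lattice

/-! ### Vanishing of the twisted cohomology -/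

section Vanishing

variable {X : Type*} [TopologicalSpace X] (z : singularCocycles X ℤ 1) (b : ℂˣ)

/-- The twisted coboundary as a linear map. -/
def twistedCoboundaryLinear (n : ℕ) :
    (C(Simplex n, X) → ℂ) →ₗ[ℂ] (C(Simplex (n + 1), X) → ℂ) where
  toFun := twistedCoboundary z b
  map_add' c d := by
    funext σ
    simp [twistedCoboundary, mul_add, Finset.sum_add_distrib]
  map_smul' r c := by
    funext σ
    simp only [twistedCoboundary, Pi.smul_apply, smul_eq_mul, RingHom.id_apply, Finset.mul_sum,
      zsmul_eq_mul]
    exact Finset.sum_congr rfl fun _ _ => by ring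

/-- The twisted coboundaries in degree `n`. -/
def twistedBoundaries : ∀ n, Submodule ℂ (C(Simplex n, X) → ℂ)
  | 0 => ⊥
  | n + 1 => LinearMap.range (twistedCoboundaryLinear z b n)

theorem twistedCoboundary_of_mem_boundaries {n : ℕ} {e : C(Simplex n, X) → ℂ}
    (he : e ∈ twistedBoundaries z b n) : twistedCoboundary z b e = 0 := by
  cases n with
  | zero =>
    rw [(Submodule.mem_bot ℂ).1 he]
    exact (twistedCoboundaryLinear z b 0).map_zero
  | succ n =>
    obtain ⟨k, rfl⟩ := he
    exact twistedCoboundary_twistedCoboundary z b k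

/-- The pull-back of a twisted cochain along a family of homotopies. -/
def homotopyPullback {n : ℕ} (H : C(Simplex n, X) → C(unitInterval × Simplex n, X))
    (c : C(Simplex n, X) → ℂ) (σ : C(Simplex n, X)) : ℂ :=
  ((b ^ displacement z (H σ) (1, vertexZero n) (0, vertexZero n) : ℂˣ) : ℂ) * c (endMap (H σ))

theorem exists_mem_boundaries_of_homotopy {S : ∀ n, Set C(Simplex n, X)}
    (H : ∀ n, C(Simplex n, X) → C(unitInterval × Simplex n, X))
    (hnat : ∀ n, ∀ σ ∈ S (n + 1), ∀ i,
      H n (σ.comp (faceMap i)) = (H (n + 1) σ).comp (prismFace i))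
    (h0 : ∀ n, ∀ σ ∈ S n, ∀ x, H n σ (0, x) = σ x) {n : ℕ} (c : C(Simplex n, X) → ℂ)
    (hc : twistedCoboundary z b c = 0) :
    ∃ e ∈ twistedBoundaries z b n, ∀ σ ∈ S n, homotopyPullback z b (H n) c σ = c σ + e σ := by
  cases n with
  | zero =>
    refine ⟨0, Submodule.zero_mem _, fun σ hσ => ?_⟩
    rw [Pi.zero_apply, add_zero]
    refine (eq_of_homotopy_zero z b c hc (H 0 σ)).trans (congrArg c ?_)
    exact ContinuousMap.ext (h0 0 σ hσ)
  | succ n =>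
    obtain ⟨k, hk⟩ := exists_twistedCoboundary_of_homotopy z b H hnat h0 c hc
    refine ⟨_, ⟨k, rfl⟩, fun σ hσ => ?_⟩
    change _ = c σ + twistedCoboundary z b k σ
    rw [hk σ hσ, add_sub_cancel]
    rfl

end Vanishing

section Vanishing

variable {X : Type*} [MetricSpace X] (z : singularCocycles X ℤ 1) (b : ℂˣ)

/-- A cocycle that agrees with a coboundary on small simplices is a coboundary. -/
theorem mem_boundaries_of_small {ε : ℝ} (hε : 0 < ε) {n : ℕ} {d e : C(Simplex n, X) → ℂ}
    (hd : twistedCoboundary z b d = 0) (he : e ∈ twistedBoundaries z b n)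
    (h : ∀ σ ∈ smallSimplices X ε n, d σ = e σ) : d ∈ twistedBoundaries z b n := by
  cases n with
  | zero =>
    have : d = e := funext fun σ => h σ fun x y => by rwa [Subsingleton.elim x y, dist_self]
    rwa [this]
  | succ n =>
    obtain ⟨k, rfl⟩ := he
    obtain ⟨k', hk', -⟩ := exists_extension z b hε d hd k fun σ hσ => (h σ hσ).symm
    exact ⟨k', hk'⟩

open Classical in
/-- A cocycle is cohomologous to the extension of its pull-back along homotopies of small
simplices. -/
theorem exists_cohomologous_of_small {ε : ℝ} (hε : 0 < ε)
    (H : ∀ n, C(Simplex n, X) → C(unitInterval × Simplex n, X))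
    (hnat : ∀ n, ∀ σ ∈ smallSimplices X ε (n + 1), ∀ i,
      H n (σ.comp (faceMap i)) = (H (n + 1) σ).comp (prismFace i))
    (h0 : ∀ n, ∀ σ ∈ smallSimplices X ε n, ∀ x, H n σ (0, x) = σ x) {n : ℕ}
    (c : C(Simplex n, X) → ℂ) (hc : twistedCoboundary z b c = 0) :
    ∃ c' : C(Simplex n, X) → ℂ, twistedCoboundary z b c' = 0 ∧ c' - c ∈ twistedBoundaries z b n ∧
      ∀ σ, c' σ ∈ valueGroup z b
        (fun τ => if τ ∈ smallSimplices X ε n then homotopyPullback z b (H n) c τ else 0) σ := by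
  obtain ⟨e, he, hce⟩ := exists_mem_boundaries_of_homotopy z b H hnat h0 c hc
  obtain ⟨c', hc', hs, hv⟩ := exists_extension z b hε (0 : C(Simplex (n + 1), X) → ℂ)
    ((twistedCoboundaryLinear z b (n + 1)).map_zero)
    (fun τ => if τ ∈ smallSimplices X ε n then homotopyPullback z b (H n) c τ else 0) (by
      intro σ hσ
      have h₁ : twistedCoboundary z b (c + e) = 0 := by
        refine ((twistedCoboundaryLinear z b n).map_add c e).trans ?_
        change twistedCoboundary z b c + twistedCoboundary z b e = 0
        rw [hc, twistedCoboundary_of_mem_boundaries z b he, add_zero]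
      rw [← h₁]
      refine Finset.sum_congr rfl fun i _ => ?_
      have hf : σ.comp (faceMap i) ∈ smallSimplices X ε n := fun x y => hσ _ _
      dsimp only
      rw [if_pos hf, hce _ hf]
      rfl)
  refine ⟨c', hc', mem_boundaries_of_small z b hε ?_ he fun σ hσ => ?_, hv rfl⟩
  · rw [twistedCoboundary_sub, hc, hc', sub_zero]
  · rw [Pi.sub_apply, hs σ hσ, if_pos hσ, hce σ hσ, add_sub_cancel_left]

end Vanishing

section Vanishing

variable {X : Type*} [TopologicalSpace X] (z : singularCocycles X ℤ 1) (g : X → ℝ)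
  {Y : Type*} [TopologicalSpace Y]

theorem displacement_track [ContractibleSpace Y] (H : C(unitInterval × Y, X)) (y : Y) :
    displacement z (track H y) 0 1 = displacement z H (0, y) (1, y) :=
  displacement_comp z _ _ _ _

theorem displacement_eq_rise [ContractibleSpace Y] (H : C(unitInterval × Y, X)) (y : Y) :
    (displacement z H (0, y) (1, y) : ℝ) = rise z g H y + (g (H (1, y)) - g (H (0, y))) := by
  rw [rise, displacement_track, sub_add_cancel]

theorem displacement_symm [ContractibleSpace Y] (F : C(Y, X)) (p q : Y) :
    displacement z F p q = -displacement z F q p := by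
  have := displacement_add z F p q p
  rw [displacement_self] at this
  omega

/-- The homotopy `G ∘ σ`. -/
def homotopyComp (G : C(unitInterval × X, X)) (σ : C(Y, X)) : C(unitInterval × Y, X) :=
  G.comp ((ContinuousMap.id _).prodMap σ)

theorem rise_homotopyComp (G : C(unitInterval × X, X)) (σ : C(Y, X)) (y : Y) :
    rise z g (homotopyComp G σ) y = rise z g G (σ y) := rfl

/-- The change of the cocycle on going up along `G` and then along the image of `σ`, computed by
going along `σ` first. -/
theorem displacement_square [ContractibleSpace Y] {G : C(unitInterval × X, X)}
    (hG : ∀ x, G (0, x) = x) (σ : C(Y, X)) (p q : Y) :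
    displacement z (homotopyComp G σ) (0, p) (1, p) +
      displacement z (endMap (homotopyComp G σ)) p q =
    displacement z σ p q + displacement z (homotopyComp G σ) (0, q) (1, q) := by
  have h₁ : displacement z (endMap (homotopyComp G σ)) p q =
      displacement z (homotopyComp G σ) (1, p) (1, q) := displacement_comp z _ _ _ _
  have h₂ : displacement z σ p q = displacement z (homotopyComp G σ) (0, p) (0, q) := by
    have e : σ = (homotopyComp G σ).comp ((ContinuousMap.const _ 0).prodMk (ContinuousMap.id _)) :=
      ContinuousMap.ext fun y => (hG _).symm
    conv_lhs => rw [e, displacement_comp]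
    rfl
  rw [h₁, h₂, displacement_add, displacement_add]

end Vanishing

section Vanishing

variable {X : Type*} [MetricSpace X] [CompactSpace X] {z : singularCocycles X ℤ 1} {g : X → ℝ}
  {E : Type*} [NormedAddCommGroup E] [NormedSpace ℝ E] [ProperSpace E]

/-- If `X` is covered by height charts and `b` is not an algebraic integer, then the cohomology of
`X` with coefficients in the line bundle with parallel transport `b ^ z` vanishes. -/
theorem mem_twistedBoundaries (hcov : ∀ x, ∃ k : HeightChart z g E, x ∈ k.openCore) (b : ℂˣ)
    (hb : ¬ IsIntegral ℤ (b : ℂ)) {n : ℕ} (c : C(Simplex n, X) → ℂ)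
    (hc : twistedCoboundary z b c = 0) : c ∈ twistedBoundaries z b n := by
  classical
  choose k hk using hcov
  obtain ⟨l, hl⟩ : ∃ l : List (HeightChart z g E), ∀ x, ∃ k ∈ l, x ∈ k.openCore := by
    obtain ⟨t, ht⟩ := isCompact_univ.elim_finite_subcover (fun x => (k x).openCore)
      (fun x => (k x).isOpen_openCore) fun x _ => Set.mem_iUnion.2 ⟨x, hk x⟩
    refine ⟨t.toList.map k, fun x => ?_⟩
    obtain ⟨y, hy, hx⟩ := Set.mem_iUnion₂.1 (ht (Set.mem_univ x))
    exact ⟨k y, List.mem_map.2 ⟨y, Finset.mem_toList.2 hy, rfl⟩, hx⟩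
  obtain ⟨ε, hε, ε', C, H, hH⟩ := exists_isStraightening_univ l hl
  obtain ⟨N, -, hNfin, hN⟩ := finite_cover_balls_of_compact (isCompact_univ (X := X))
    (half_pos hε)
  have hnear (x : X) : ∃ p : N, dist x p < ε / 2 := by
    obtain ⟨p, hp, hx⟩ := Set.mem_iUnion₂.1 (hN (Set.mem_univ x))
    exact ⟨⟨p, hp⟩, hx⟩
  choose near hnear using hnear
  have : Finite N := hNfin
  -- The vertices of a small simplex are replaced by nearby points of the finite set `N`.
  let ν (m : ℕ) (σ : C(Simplex m, X)) (i : Fin (m + 1)) : N := near (σ (vertices m i))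
  have hclose {m : ℕ} {σ : C(Simplex m, X)} (hσ : σ ∈ smallSimplices X (ε / 2) m) :
      IsClose ε σ fun i => (ν m σ i : X) := fun x i => by
    have h₁ := hσ x (vertices m i)
    have h₂ := hnear (σ (vertices m i))
    have := dist_triangle (σ x) (σ (vertices m i)) (ν m σ i)
    exact this.trans_lt (by linarith)
  let K (m : ℕ) (σ : C(Simplex m, X)) : C(unitInterval × Simplex m, X) := H m σ fun i => ν m σ i
  have hKnat (m : ℕ) : ∀ σ ∈ smallSimplices X (ε / 2) (m + 1), ∀ i,
      K m (σ.comp (faceMap i)) = (K (m + 1) σ).comp (prismFace i) := fun σ hσ i => by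
    rw [← hH.natural m σ _ (hclose hσ) i]
    change H m _ _ = H m _ _
    congr 1
    funext j
    change (near (σ (faceMap i (vertices m j))) : X) = near (σ (vertices (m + 1) (i.succAbove j)))
    rw [show faceMap i (vertices m j) = _ from congrFun (faceMap_vertices i) j]
    rfl
  have hK0 (m : ℕ) : ∀ σ ∈ smallSimplices X (ε / 2) m, ∀ x, K m σ (0, x) = σ x :=
    fun σ hσ x => hH.zero m σ _ (hclose hσ) x
  -- The finitely many straight simplices.
  let J := {u : Fin (n + 1) → N // ∃ σ : C(Simplex n, X), IsClose ε σ fun i => (u i : X)}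
  choose τ hτ using fun u : J => u.2
  let s (u : J) : C(Simplex n, X) := endMap (H n (τ u) fun i => u.1 i)
  have hs {σ : C(Simplex n, X)} (hσ : σ ∈ smallSimplices X (ε / 2) n) :
      ∃ u : J, endMap (K n σ) = s u := by
    let u : J := ⟨ν n σ, σ, hclose hσ⟩
    exact ⟨u, ContinuousMap.ext fun x =>
      hH.end_eq n σ (τ u) _ (hclose hσ) (hτ u) ⟨_, rfl, fun _ => trivial⟩ x⟩
  have hsrc (x : X) : ∃ k : HeightChart z g E, x ∈ k.chart.source :=
    ⟨k x, (hk x).1⟩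
  choose D hD using fun u : J => exists_abs_displacement_le hsrc (s u)
  obtain ⟨D₀, hD₀⟩ : ∃ D₀, ∀ u, D u ≤ D₀ := by
    obtain ⟨D₀, h⟩ := (Set.finite_range D).bddAbove
    exact ⟨D₀, fun u => h ⟨u, rfl⟩⟩
  obtain ⟨g₀, hg₀⟩ : ∃ g₀, ∀ u : J, |g (s u (vertexZero n))| ≤ g₀ := by
    obtain ⟨g₀, h⟩ := (Set.finite_range fun u : J => |g (s u (vertexZero n))|).bddAbove
    exact ⟨g₀, fun u => h ⟨u, rfl⟩⟩
  obtain ⟨G, hG0, hG⟩ := exists_raise l hl (1 + C + D₀ + 2 * g₀)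
  have hst := fun c hc => exists_cohomologous_of_small z b (half_pos hε) K hKnat hK0 (n := n) c hc
  let Z := LinearMap.ker (twistedCoboundaryLinear z b n)
  let π : Z →ₗ[ℂ] (C(Simplex n, X) → ℂ) ⧸ twistedBoundaries z b n :=
    (Submodule.mkQ _).comp Z.subtype
  let R : Z →ₗ[ℂ] (J → ℂ) := (LinearMap.funLeft ℂ ℂ s).comp Z.subtype
  have key := class_eq_zero_of_lattice π R (b := ((b⁻¹ : ℂˣ) : ℂ)) (Units.ne_zero _)
    (by rwa [Units.val_inv_eq_inv_val, inv_inv]) ?_ ?_ ⟨c, hc⟩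
  · exact (Submodule.Quotient.mk_eq_zero _).1 key
  · rintro ⟨c, hc⟩ hR
    obtain ⟨c', -, hcc', hv⟩ := hst c hc
    have h0 : c' = 0 := funext fun σ => by
      have hz : (fun τ => if τ ∈ smallSimplices X (ε / 2) n then
          homotopyPullback z b (K n) c τ else 0) = 0 := by
        funext σ
        rw [Pi.zero_apply, ite_eq_right_iff]
        intro hσ
        obtain ⟨u, hu⟩ := hs hσ
        rw [homotopyPullback, hu, show c (s u) = 0 from congrFun hR u, mul_zero]
      have := hv σ
      rw [hz, valueGroup] at this
      simpa [AddSubgroup.closure_singleton_zero] using this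
    rw [h0, zero_sub] at hcc'
    exact (Submodule.Quotient.mk_eq_zero _).2 (neg_mem_iff.1 hcc')
  · rintro ⟨c, hc⟩
    obtain ⟨c', hc', hcc', hv⟩ := hst c hc
    obtain ⟨e, he, hG'⟩ := exists_mem_boundaries_of_homotopy z b (S := fun _ => Set.univ)
      (fun m σ => homotopyComp G σ) (fun _ _ _ _ => rfl) (fun _ σ _ x => hG0 (σ x)) c' hc'
    have hG'' : homotopyPullback z b (homotopyComp G) c' = c' + e :=
      funext fun σ => hG' σ trivial
    have hcoc : twistedCoboundaryLinear z b n (c' + e) = 0 := by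
      rw [map_add]
      change twistedCoboundary z b c' + twistedCoboundary z b e = 0
      rw [hc', twistedCoboundary_of_mem_boundaries z b he, add_zero]
    refine ⟨⟨(b : ℂ) • (c' + e), Submodule.smul_mem _ _ hcoc⟩, ?_, fun u => ?_⟩
    · refine (Submodule.Quotient.eq _).2 ?_
      change c - ((b⁻¹ : ℂˣ) : ℂ) • (b : ℂ) • (c' + e) ∈ _
      rw [smul_smul, Units.inv_mul, one_smul, ← sub_sub, ← neg_sub c' c]
      exact Submodule.sub_mem _ (Submodule.neg_mem _ hcc') he
    · change (b : ℂ) • (c' + e) (s u) ∈ _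
      rw [← hG'', homotopyPullback, smul_eq_mul, ← mul_assoc, ← Units.val_mul]
      set β : ℂ := ((b * b ^ displacement z (homotopyComp G (s u)) (1, vertexZero n)
        (0, vertexZero n) : ℂˣ) : ℂ) with hβ
      set M := Submodule.span (Algebra.adjoin ℤ {((b⁻¹ : ℂˣ) : ℂ)}) (Set.range (R ⟨c, hc⟩)) with hM
      refine (?_ : valueGroup z b _ (endMap (homotopyComp G (s u))) ≤
        M.toAddSubgroup.comap (AddMonoidHom.mulLeft β)) (hv _)
      refine (AddSubgroup.closure_le _).2 ?_
      rintro _ ⟨w, rfl⟩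
      change β * (_ * ite _ _ _) ∈ M
      split_ifs with hσ
      swap
      · rw [mul_zero, mul_zero]
        exact M.zero_mem
      set σ := (endMap (homotopyComp G (s u))).comp (affineSimplex w) with hσdef
      obtain ⟨u', hu'⟩ := hs hσ
      -- The total exponent of `b⁻¹`; it is positive because the rise along `G` is large.
      set p := w 0
      have hσ0 : σ (vertexZero n) = G (1, s u p) := by
        change endMap (homotopyComp G (s u)) (affineSimplex w (vertexZero n)) = _
        rw [affineSimplex_vertex]
        rfl
      have e₁ := displacement_square z hG0 (s u) (vertexZero n) p
      have e₂ : (displacement z (homotopyComp G (s u)) (0, p) (1, p) : ℝ) =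
          rise z g G (s u p) + (g (G (1, s u p)) - g (s u p)) := by
        rw [displacement_eq_rise z g, rise_homotopyComp]
        change _ + (g (G (1, s u p)) - g (G (0, s u p))) = _
        rw [hG0]
      have e₃ := displacement_eq_rise z g (K n σ) (vertexZero n)
      rw [hK0 n σ hσ, hσ0, show K n σ (1, vertexZero n) = s u' (vertexZero n) from
        congrArg (fun f => f (vertexZero n)) hu'] at e₃
      have h₁ := abs_le.1 (hH.rise_le n σ _ (hclose hσ) (vertexZero n))
      have h₂ := abs_le.1 (hD u p)
      have h₃ := abs_le.1 (hg₀ u)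
      have h₄ := abs_le.1 (hg₀ u')
      have h₅ := hG (s u p)
      have h₆ := hD₀ u
      obtain ⟨m, hm⟩ : ∃ m : ℕ, displacement z (homotopyComp G (s u)) (0, vertexZero n)
          (1, vertexZero n) + displacement z (endMap (homotopyComp G (s u))) (vertexZero n) p +
          displacement z (K n σ) (0, vertexZero n) (1, vertexZero n) = 1 + m := by
        have : (1 : ℝ) ≤ displacement z (s u) (vertexZero n) p +
            displacement z (homotopyComp G (s u)) (0, p) (1, p) +
            displacement z (K n σ) (0, vertexZero n) (1, vertexZero n) := by
          have h₁' : -C ≤ rise z g (K n σ) (vertexZero n) := h₁.1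
          rw [e₂, e₃]
          linarith [h₂.1, h₃.1, h₃.2, h₄.1, h₄.2]
        rw [e₁]
        obtain ⟨m, hm⟩ := Int.le.dest (show (1 : ℤ) ≤ _ by exact_mod_cast this)
        exact ⟨m, hm.symm⟩
      have hval : β * (((b ^ displacement z (endMap (homotopyComp G (s u))) p (vertexZero n) : ℂˣ) :
          ℂ) * homotopyPullback z b (K n) c σ) = ((b⁻¹ : ℂˣ) : ℂ) ^ m * c (s u') := by
        rw [homotopyPullback, hu', hβ, ← mul_assoc, ← mul_assoc, ← Units.val_mul, ← Units.val_mul,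
          ← Units.val_pow_eq_pow_val]
        congr 2
        rw [mul_assoc, mul_assoc, ← zpow_add, ← zpow_add, ← zpow_one_add, inv_pow, ← zpow_natCast,
          ← zpow_neg]
        congr 1
        rw [displacement_symm z _ (1, vertexZero n), displacement_symm z _ p,
          displacement_symm z _ (1, vertexZero n)]
        omega
      rw [hval]
      have hmem : ((b⁻¹ : ℂˣ) : ℂ) ^ m ∈ Algebra.adjoin ℤ {((b⁻¹ : ℂˣ) : ℂ)} :=
        pow_mem (Algebra.self_mem_adjoin_singleton ℤ _) m
      exact M.smul_mem ⟨_, hmem⟩ (Submodule.subset_span ⟨u', rfl⟩)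

end Vanishing

/-! ### Closed one-forms in coordinates -/

section Coordinates

variable {n : ℕ} {X : Type*} [TopologicalSpace X] [ChartedSpace (EuclideanSpace ℝ (Fin n)) X]
  [IsManifold (𝓡 n) ∞ X]

/-- Smoothness of a section of the cotangent bundle means smoothness of its coordinate expression:
the latter is the expression in the trivialization of the bundle induced by the chart. -/
theorem OneForm.contDiffOn_inChart (θ : OneForm n X) (x₀ : X) :
    ContDiffOn ℝ ∞ (θ.inChart x₀) (extChartAt (𝓡 n) x₀).target := by
  have h1 := (Bundle.Trivialization.contMDiffOn_section_baseSet_iff (IB := 𝓡 n) (n := ∞)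
    (s := fun x => θ x) (trivializationAt (EuclideanSpace ℝ (Fin n) →L[ℝ] ℝ)
      (fun x : X => TangentSpace (𝓡 n) x →L[ℝ] Bundle.Trivial X ℝ x) x₀)).1
    θ.contMDiff.contMDiffOn
  have h2 := h1.comp (contMDiffOn_extChartAt_symm (I := 𝓡 n) (n := ∞) x₀) (by
    intro y hy
    have := (extChartAt (𝓡 n) x₀).map_target hy
    simpa [hom_trivializationAt_baseSet] using this)
  refine (contMDiffOn_iff_contDiffOn.1 h2).congr fun y hy => ?_
  have hx := (extChartAt (𝓡 n) x₀).map_target hy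
  rw [extChartAt_source] at hx
  have e := TangentBundle.symmL_trivializationAt (I := 𝓡 n) hx
  rw [(extChartAt (𝓡 n) x₀).right_inv hy] at e
  ext v
  have e' := DFunLike.congr_fun e v
  change (θ ((extChartAt (𝓡 n) x₀).symm y))
      (mfderiv (𝓡 n) (𝓡 n) (extChartAt (𝓡 n) x₀).symm y v) =
    ContinuousLinearMap.inCoordinates (EuclideanSpace ℝ (Fin n))
      (fun x : X => TangentSpace (𝓡 n) x) ℝ (Bundle.Trivial X ℝ) x₀
      ((extChartAt (𝓡 n) x₀).symm y) x₀ ((extChartAt (𝓡 n) x₀).symm y)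
      (θ ((extChartAt (𝓡 n) x₀).symm y)) v
  rw [ContinuousLinearMap.inCoordinates, ContinuousLinearMap.comp_apply,
    ContinuousLinearMap.comp_apply]
  erw [e']
  simp [mfderivWithin_univ]
  rfl

theorem OneForm.inChart_ne_zero (θ : OneForm n X) {x₀ : X} (h : θ x₀ ≠ 0) :
    θ.inChart x₀ (extChartAt (𝓡 n) x₀ x₀) ≠ 0 := by
  intro h0
  apply h
  have hx := mem_extChartAt_source (I := 𝓡 n) x₀
  have e := mfderivWithin_extChartAt_symm_comp_mfderiv_extChartAt' (I := 𝓡 n) hx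
  rw [ModelWithCorners.range_eq_univ, mfderivWithin_univ] at e
  unfold OneForm.inChart at h0
  rw [(extChartAt (𝓡 n) x₀).left_inv hx] at h0
  ext v
  have e' := DFunLike.congr_fun e v
  have h1 := DFunLike.congr_fun h0 (mfderiv (𝓡 n) (𝓡 n) (extChartAt (𝓡 n) x₀) x₀ v)
  refine Eq.trans ?_ h1
  change θ x₀ v = θ x₀ _
  congr 1
  exact e'.symm

/-- Near a point where it does not vanish, a closed form has a primitive on a coordinate ball, and
the primitive has positive derivative in some fixed direction. -/
theorem OneForm.IsClosed.exists_primitive {θ : OneForm n X} (hθ : θ.IsClosed) {x₀ : X}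
    (h : θ x₀ ≠ 0) : ∃ r > 0,
      Metric.ball (extChartAt (𝓡 n) x₀ x₀) r ⊆ (extChartAt (𝓡 n) x₀).target ∧
      ∃ F : EuclideanSpace ℝ (Fin n) → ℝ, ∃ v : EuclideanSpace ℝ (Fin n), ‖v‖ ≤ 1 ∧
        ∀ y ∈ Metric.ball (extChartAt (𝓡 n) x₀ x₀) r,
          HasFDerivAt F (θ.inChart x₀ y) y ∧ 0 < θ.inChart x₀ y v := by
  set p := extChartAt (𝓡 n) x₀ x₀
  have ht : IsOpen (extChartAt (𝓡 n) x₀).target := isOpen_extChartAt_target x₀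
  have hp : p ∈ (extChartAt (𝓡 n) x₀).target := mem_extChartAt_target x₀
  obtain ⟨v, hv, hpos⟩ : ∃ v : EuclideanSpace ℝ (Fin n), ‖v‖ ≤ 1 ∧ 0 < θ.inChart x₀ p v := by
    obtain ⟨w, hw⟩ : ∃ w, θ.inChart x₀ p w ≠ 0 := by
      by_contra! h0
      exact θ.inChart_ne_zero h (ContinuousLinearMap.ext h0)
    have hw0 : w ≠ 0 := by
      rintro rfl
      exact hw (map_zero _)
    have hn : 0 < ‖w‖ := norm_pos_iff.2 hw0
    refine ⟨((SignType.sign (θ.inChart x₀ p w) : ℝ) * ‖w‖⁻¹) • w, ?_, ?_⟩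
    · rw [norm_smul, norm_mul, norm_inv, norm_norm, mul_assoc, inv_mul_cancel₀ hn.ne', mul_one]
      rcases lt_or_gt_of_ne hw with h' | h' <;> simp [h']
    · rw [map_smul, smul_eq_mul, mul_right_comm, sign_mul_self]
      positivity
  have hc : ContinuousOn (fun y => θ.inChart x₀ y v) (extChartAt (𝓡 n) x₀).target :=
    (θ.contDiffOn_inChart x₀).continuousOn.clm_apply continuousOn_const
  have hev : ∀ᶠ y in nhds p, y ∈ (extChartAt (𝓡 n) x₀).target ∧ 0 < θ.inChart x₀ y v :=
    (ht.eventually_mem hp).and ((hc.continuousAt (ht.mem_nhds hp)).eventually (lt_mem_nhds hpos))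
  obtain ⟨r, hr, hb⟩ := Metric.eventually_nhds_iff_ball.1 hev
  obtain ⟨F, hF⟩ := (convex_ball p r).exists_forall_hasFDerivAt_of_fderiv_symmetric
    Metric.isOpen_ball
    (((θ.contDiffOn_inChart x₀).differentiableOn (by simp)).mono fun y hy => (hb y hy).1)
    (fun y hy u w => sub_eq_zero.1 (hθ x₀ y (hb y hy).1 u w))
  exact ⟨r, hr, fun y hy => (hb y hy).1, F, v, hv, fun y hy => ⟨hF y hy, (hb y hy).2⟩⟩

end Coordinates

/-! ### Primitives of one-forms along paths -/

section Primitives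

variable {n : ℕ} {X : Type*} [TopologicalSpace X] [ChartedSpace (EuclideanSpace ℝ (Fin n)) X]
  [IsManifold (𝓡 n) ∞ X]

/-- The value of a one-form on a tangent vector given in the model space, with which the fibres of
the tangent bundle are identified. -/
def OneForm.eval (θ : OneForm n X) (x : X) (v : EuclideanSpace ℝ (Fin n)) : ℝ := θ x v

/-- The curve `γ` is smooth at time `t`, and `G` is there a primitive of the pullback `γ^*θ`. -/
structure OneForm.IsPrimitiveAt (θ : OneForm n X) (γ : ℝ → X) (G : ℝ → ℝ) (t : ℝ) : Prop where
  contMDiffAt : ContMDiffAt 𝓘(ℝ, ℝ) (𝓡 n) ∞ γ t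
  contDiffAt : ContDiffAt ℝ 1 G t
  deriv_eq : deriv G t = θ.eval (γ t) (mfderiv 𝓘(ℝ, ℝ) (𝓡 n) γ t (1 : ℝ))

namespace OneForm

variable {θ : OneForm n X} {γ γ' : ℝ → X} {G G' : ℝ → ℝ} {t : ℝ}

theorem IsPrimitiveAt.congr (h : θ.IsPrimitiveAt γ G t) (hγ : γ' =ᶠ[nhds t] γ)
    {c : ℝ} (hG : G' =ᶠ[nhds t] fun s => c + G s) : θ.IsPrimitiveAt γ' G' t where
  contMDiffAt := h.contMDiffAt.congr_of_eventuallyEq hγ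
  contDiffAt := (contDiffAt_const.add h.contDiffAt).congr_of_eventuallyEq hG
  deriv_eq := by
    rw [hG.deriv_eq, deriv_const_add, h.deriv_eq]
    have e1 := hγ.eq_of_nhds
    have e2 := hγ.mfderiv_eq (I := 𝓘(ℝ, ℝ)) (I' := 𝓡 n)
    exact congrArg₂ θ.eval e1.symm (DFunLike.congr_fun e2.symm (1 : ℝ))

theorem IsPrimitiveAt.comp_affine (a b : ℝ) (h : θ.IsPrimitiveAt γ G (a * t + b)) :
    θ.IsPrimitiveAt (fun s => γ (a * s + b)) (fun s => G (a * s + b)) t := by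
  have hA : ContDiff ℝ ∞ (fun s : ℝ => a * s + b) := by fun_prop
  have hd : HasDerivAt (fun s : ℝ => a * s + b) a t := by
    simpa using ((hasDerivAt_id t).const_mul a).add_const b
  refine ⟨h.contMDiffAt.comp t hA.contMDiff.contMDiffAt,
    h.contDiffAt.comp t (hA.of_le (by simp)).contDiffAt, ?_⟩
  have hG : HasDerivAt G (deriv G (a * t + b)) (a * t + b) :=
    (h.contDiffAt.differentiableAt (by simp)).hasDerivAt
  refine (hG.comp t hd).deriv.trans ?_
  rw [h.deriv_eq]
  have hm := mfderiv_comp_apply (I := 𝓘(ℝ, ℝ)) (I' := 𝓘(ℝ, ℝ)) (I'' := 𝓡 n) t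
    (h.contMDiffAt.mdifferentiableAt (by simp))
    (hd.differentiableAt.mdifferentiableAt) (1 : ℝ)
  rw [mfderiv_eq_fderiv, hd.hasFDerivAt.fderiv] at hm
  change _ = θ.eval (γ (a * t + b)) _
  refine Eq.trans ?_ (congrArg (θ.eval (γ (a * t + b))) hm.symm)
  change _ = θ (γ (a * t + b)) (mfderiv 𝓘(ℝ, ℝ) (𝓡 n) γ (a * t + b) ((1 : ℝ) * a))
  rw [one_mul, ← mul_one a, ← smul_eq_mul a 1]
  erw [map_smul, map_smul]
  simp [OneForm.eval, mul_comm]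

theorem isPrimitiveAt_const (x : X) (c : ℝ) : θ.IsPrimitiveAt (fun _ => x) (fun _ => c) t where
  contMDiffAt := contMDiffAt_const
  contDiffAt := contDiffAt_const
  deriv_eq := by
    rw [deriv_const, mfderiv_const]
    exact (map_zero (θ x)).symm

/-- A primitive in coordinates gives a primitive along each curve in the chart. -/
theorem isPrimitiveAt_chart {x₀ : X} {F : EuclideanSpace ℝ (Fin n) → ℝ}
    {U : Set (EuclideanSpace ℝ (Fin n))} (hU : IsOpen U) (hUt : U ⊆ (extChartAt (𝓡 n) x₀).target)
    (hF : ∀ y ∈ U, HasFDerivAt F (θ.inChart x₀ y) y) {l : ℝ → EuclideanSpace ℝ (Fin n)}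
    (hl : ContDiffAt ℝ ∞ l t) (ht : l t ∈ U) :
    θ.IsPrimitiveAt (fun s => (extChartAt (𝓡 n) x₀).symm (l s)) (fun s => F (l s)) t := by
  have hF1 : ContDiffAt ℝ 1 F (l t) := contDiffAt_one_iff.2 ⟨θ.inChart x₀, U, hU.mem_nhds ht,
    (θ.contDiffOn_inChart x₀).continuousOn.mono hUt, hF⟩
  have hs : ContMDiffAt (𝓡 n) (𝓡 n) ∞ (extChartAt (𝓡 n) x₀).symm (l t) :=
    (contMDiffOn_extChartAt_symm (I := 𝓡 n) (n := ∞) x₀).contMDiffAt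
      (Filter.mem_of_superset (hU.mem_nhds ht) hUt)
  refine ⟨hs.comp t hl.contMDiffAt, hF1.comp t (hl.of_le (by simp)), ?_⟩
  have hd : HasDerivAt l (deriv l t) t := (hl.differentiableAt (by simp)).hasDerivAt
  refine ((hF _ ht).comp_hasDerivAt t hd).deriv.trans ?_
  have hm := mfderiv_comp_apply (I := 𝓘(ℝ, ℝ)) (I' := 𝓡 n) (I'' := 𝓡 n) t
    (hs.mdifferentiableAt (by simp)) (hd.differentiableAt.mdifferentiableAt) (1 : ℝ)
  rw [mfderiv_eq_fderiv] at hm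
  refine Eq.trans ?_ (congrArg (θ.eval ((extChartAt (𝓡 n) x₀).symm (l t))) hm.symm)
  change _ = θ _ (mfderiv (𝓡 n) (𝓡 n) (extChartAt (𝓡 n) x₀).symm (l t) (fderiv ℝ l t 1))
  rw [fderiv_apply_one_eq_deriv]
  rfl

/-- A smooth curve from `x` to `y`, parametrized by `[0, 1]` and constant near the ends, along which
`θ` has the integral `w`: there is a primitive `G` of `θ` along it which rises from `0` to `w`.
Being constant near the ends makes such curves stable under concatenation. -/
structure IsFlatCurve (θ : OneForm n X) (x y : X) (w : ℝ) (γ : C(ℝ, X)) (G : ℝ → ℝ) : Prop where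
  isPrimitiveAt : ∀ t, θ.IsPrimitiveAt γ G t
  left : ∃ ε > 0, ∀ t ≤ ε, γ t = x ∧ G t = 0
  right : ∃ ε > 0, ∀ t ≥ 1 - ε, γ t = y ∧ G t = w

namespace IsFlatCurve

variable {x y u : X} {w w' : ℝ} {γ γ' : C(ℝ, X)} {G G' : ℝ → ℝ}

theorem apply_of_nonpos (h : θ.IsFlatCurve x y w γ G) {t : ℝ} (ht : t ≤ 0) : γ t = x ∧ G t = 0 := by
  obtain ⟨ε, hε, h⟩ := h.left
  exact h t (ht.trans hε.le)

theorem apply_of_one_le (h : θ.IsFlatCurve x y w γ G) {t : ℝ} (ht : 1 ≤ t) : γ t = y ∧ G t = w := by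
  obtain ⟨ε, hε, h⟩ := h.right
  exact h t (by linarith)

/-- The restriction to `[0, 1]`. -/
def path (h : θ.IsFlatCurve x y w γ G) : Path x y where
  toFun t := γ t
  continuous_toFun := γ.continuous.comp continuous_subtype_val
  source' := (h.apply_of_nonpos le_rfl).1
  target' := (h.apply_of_one_le le_rfl).1

theorem extend_path (h : θ.IsFlatCurve x y w γ G) : h.path.extend = γ := by
  ext t
  rcases le_total t 0 with h0 | h0
  · rw [Path.extend_of_le_zero _ h0, (h.apply_of_nonpos h0).1]
  rcases le_total 1 t with h1 | h1
  · rw [Path.extend_of_one_le _ h1, (h.apply_of_one_le h1).1]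
  · rw [Path.extend_apply _ ⟨h0, h1⟩]
    rfl

theorem isSmoothPath (h : θ.IsFlatCurve x y w γ G) : IsSmoothPath n h.path := by
  unfold IsSmoothPath
  rw [h.extend_path]
  exact fun t _ => (h.isPrimitiveAt t).contMDiffAt.contMDiffWithinAt

theorem pathIntegral_eq (h : θ.IsFlatCurve x y w γ G) : θ.pathIntegral h.path = w := by
  have key : ∀ δ : ℝ → X, δ = γ → ∫ t in (0 : ℝ)..1, (θ (δ t)
      (mfderivWithin 𝓘(ℝ, ℝ) (𝓡 n) δ (Set.Icc 0 1) t (1 : ℝ)) : ℝ) = w := by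
    rintro _ rfl
    have hG : ∀ t, ContDiffAt ℝ 1 G t := fun t => (h.isPrimitiveAt t).contDiffAt
    have e : ∀ t ∈ Set.uIcc (0 : ℝ) 1, (θ (γ t)
        (mfderivWithin 𝓘(ℝ, ℝ) (𝓡 n) γ (Set.Icc 0 1) t (1 : ℝ)) : ℝ) = deriv G t := by
      intro t ht
      rw [Set.uIcc_of_le zero_le_one] at ht
      rw [(h.isPrimitiveAt t).deriv_eq, mfderivWithin_eq_mfderiv
        ((uniqueDiffOn_Icc zero_lt_one t ht).uniqueMDiffWithinAt)
        ((h.isPrimitiveAt t).contMDiffAt.mdifferentiableAt (by simp))]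
      rfl
    rw [intervalIntegral.integral_congr e, intervalIntegral.integral_deriv_eq_sub
      (fun t _ => (hG t).differentiableAt (by simp))
      ((contDiff_iff_contDiffAt.2 hG).continuous_deriv le_rfl).continuousOn.intervalIntegrable,
      (h.apply_of_one_le le_rfl).2, (h.apply_of_nonpos le_rfl).2, sub_zero]
  exact key _ (congrArg DFunLike.coe h.extend_path)

protected theorem refl (x : X) :
    θ.IsFlatCurve x x 0 (ContinuousMap.const ℝ x) (fun _ => 0) where
  isPrimitiveAt _ := isPrimitiveAt_const x 0
  left := ⟨1, one_pos, fun _ _ => ⟨rfl, rfl⟩⟩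
  right := ⟨1, one_pos, fun _ _ => ⟨rfl, rfl⟩⟩

protected theorem symm (h : θ.IsFlatCurve x y w γ G) :
    ∃ γ' G', θ.IsFlatCurve y x (-w) γ' G' := by
  refine ⟨⟨fun t => γ (-1 * t + 1), by fun_prop⟩, fun t => -w + G (-1 * t + 1), fun t => ?_, ?_, ?_⟩
  · exact ((h.isPrimitiveAt _).comp_affine (-1) 1).congr (.refl _ _) (.refl _ _)
  · obtain ⟨ε, hε, hr⟩ := h.right
    refine ⟨ε, hε, fun t ht => ?_⟩
    obtain ⟨h1, h2⟩ := hr (-1 * t + 1) (by linarith)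
    exact ⟨h1, by rw [h2, neg_add_cancel]⟩
  · obtain ⟨ε, hε, hl⟩ := h.left
    refine ⟨ε, hε, fun t ht => ?_⟩
    obtain ⟨h1, h2⟩ := hl (-1 * t + 1) (by linarith)
    exact ⟨h1, by rw [h2, add_zero]⟩

protected theorem trans (h : θ.IsFlatCurve x y w γ G) (h' : θ.IsFlatCurve y u w' γ' G') :
    ∃ γ'' G'', ∃ h'' : θ.IsFlatCurve x u (w + w') γ'' G'', h''.path = h.path.trans h'.path := by
  have hm : γ (2 * (1 / 2) + 0) = γ' (2 * (1 / 2) + -1) := by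
    rw [(h.apply_of_one_le (by norm_num)).1, (h'.apply_of_nonpos (by norm_num)).1]
  let δ : C(ℝ, X) := ⟨fun t => if t ≤ 1 / 2 then γ (2 * t + 0) else γ' (2 * t + -1),
    Continuous.if_le (by fun_prop) (by fun_prop) continuous_id continuous_const
      (by rintro t rfl; exact hm)⟩
  have hδ : ∀ t, δ t = if t ≤ 1 / 2 then γ (2 * t + 0) else γ' (2 * t + -1) := fun _ => rfl
  obtain ⟨ε, hε, hl⟩ := h.left
  obtain ⟨ε', hε', hr⟩ := h.right
  obtain ⟨η, hη, hl'⟩ := h'.left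
  obtain ⟨η', hη', hr'⟩ := h'.right
  -- `G` is constant after time `1` and `G'` vanishes before time `0`, so no case distinction is
  -- needed for the primitive.
  let D : ℝ → ℝ := fun t => G (2 * t + 0) + G' (2 * t + -1)
  have hδ1 : ∀ t, 2 * t + -1 ≤ η → δ t = γ (2 * t + 0) ∧ D t = 0 + G (2 * t + 0) := by
    intro t ht
    refine ⟨?_, by simp only [D]; rw [(hl' _ ht).2, add_zero, zero_add]⟩
    rw [hδ]
    split_ifs with h0
    · rfl
    · rw [(hl' _ ht).1, (h.apply_of_one_le (by linarith)).1]
  have hδ2 : ∀ t, 2 * t + 0 ≥ 1 - ε' → δ t = γ' (2 * t + -1) ∧ D t = w + G' (2 * t + -1) := by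
    intro t ht
    refine ⟨?_, by simp only [D]; rw [(hr _ ht).2]⟩
    rw [hδ]
    split_ifs with h0
    · rw [(hr _ ht).1, (h'.apply_of_nonpos (by linarith)).1]
    · rfl
  refine ⟨δ, D, ⟨fun t => ?_, ?_, ?_⟩, ?_⟩
  · rcases le_or_gt t (1 / 2) with h0 | h0
    · have hev : ∀ᶠ s in nhds t, 2 * s + -1 ≤ η := by
        filter_upwards [Iio_mem_nhds (show t < (1 + η) / 2 by linarith)] with s hs
        have : s < (1 + η) / 2 := hs
        linarith
      exact ((h.isPrimitiveAt _).comp_affine 2 0).congr (hev.mono fun s hs => (hδ1 s hs).1)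
        (hev.mono fun s hs => (hδ1 s hs).2)
    · have hev : ∀ᶠ s in nhds t, 2 * s + 0 ≥ 1 - ε' := by
        filter_upwards [Ioi_mem_nhds (show (1 - ε') / 2 < t by linarith)] with s hs
        have : (1 - ε') / 2 < s := hs
        linarith
      exact ((h'.isPrimitiveAt _).comp_affine 2 (-1)).congr (hev.mono fun s hs => (hδ2 s hs).1)
        (hev.mono fun s hs => (hδ2 s hs).2)
  · refine ⟨min (ε / 2) (1 / 2), by positivity, fun t ht => ?_⟩
    have h1 := ht.trans (min_le_left _ _)
    have h2 := ht.trans (min_le_right _ _)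
    obtain ⟨e1, e2⟩ := hδ1 t (by linarith)
    obtain ⟨e3, e4⟩ := hl (2 * t + 0) (by linarith)
    exact ⟨e1.trans e3, by rw [e2, e4, add_zero]⟩
  · refine ⟨min (η' / 2) (1 / 2), by positivity, fun t ht => ?_⟩
    have h1 := min_le_left (η' / 2) (1 / 2)
    have h2 := min_le_right (η' / 2) (1 / 2)
    obtain ⟨e1, e2⟩ := hδ2 t (by linarith)
    obtain ⟨e3, e4⟩ := hr' (2 * t + -1) (by linarith)
    exact ⟨e1.trans e3, by rw [e2, e4]⟩
  · ext t
    rw [Path.trans_apply]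
    change δ t = _
    rw [hδ]
    split_ifs with h0
    · change _ = γ _
      rw [add_zero]
    · change _ = γ' _
      rw [← sub_eq_add_neg]

/-- The segment between two points of a convex set of coordinates, run through with stops near the
ends. -/
theorem exists_segment {x₀ : X} {F : EuclideanSpace ℝ (Fin n) → ℝ}
    {U : Set (EuclideanSpace ℝ (Fin n))} (hU : IsOpen U) (hc : Convex ℝ U)
    (hUt : U ⊆ (extChartAt (𝓡 n) x₀).target)
    (hF : ∀ y ∈ U, HasFDerivAt F (θ.inChart x₀ y) y) {p q : EuclideanSpace ℝ (Fin n)}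
    (hp : p ∈ U) (hq : q ∈ U) :
    ∃ (l : C(ℝ, U)) (γ : C(ℝ, X)) (G : ℝ → ℝ), (l 0 : EuclideanSpace ℝ (Fin n)) = p ∧
      (l 1 : EuclideanSpace ℝ (Fin n)) = q ∧ (∀ t, γ t = (extChartAt (𝓡 n) x₀).symm (l t)) ∧
      θ.IsFlatCurve ((extChartAt (𝓡 n) x₀).symm p) ((extChartAt (𝓡 n) x₀).symm q) (F q - F p)
        γ G := by
  let τ : ℝ → ℝ := fun t => Real.smoothTransition (3 * t - 1)
  have hτ : ContDiff ℝ ∞ τ := Real.smoothTransition.contDiff.comp (by fun_prop)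
  have hτ0 : ∀ t ≤ 1 / 3, τ t = 0 := fun t ht =>
    Real.smoothTransition.zero_of_nonpos (by linarith)
  have hτ1 : ∀ t ≥ 1 - 1 / 3, τ t = 1 := fun t ht =>
    Real.smoothTransition.one_of_one_le (by linarith)
  let l : ℝ → EuclideanSpace ℝ (Fin n) := fun t => p + τ t • (q - p)
  have hl : ContDiff ℝ ∞ l := contDiff_const.add (hτ.smul contDiff_const)
  have hlU : ∀ t, l t ∈ U := fun t => hc.add_smul_sub_mem hp hq
    ⟨Real.smoothTransition.nonneg _, Real.smoothTransition.le_one _⟩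
  have hl0 : ∀ t ≤ 1 / 3, l t = p := fun t ht => by simp [l, hτ0 t ht]
  have hl1 : ∀ t ≥ 1 - 1 / 3, l t = q := fun t ht => by simp [l, hτ1 t ht]
  have hprim := fun t => isPrimitiveAt_chart (θ := θ) (t := t) hU hUt hF hl.contDiffAt (hlU t)
  refine ⟨⟨fun t => ⟨l t, hlU t⟩, hl.continuous.subtype_mk _⟩,
    ⟨fun t => (extChartAt (𝓡 n) x₀).symm (l t),
      continuous_iff_continuousAt.2 fun t => (hprim t).contMDiffAt.continuousAt⟩,
    fun t => -F p + F (l t), hl0 0 (by norm_num), hl1 1 (by norm_num), fun _ => rfl,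
    fun t => (hprim t).congr (.refl _ _) (.refl _ _), ⟨1 / 3, by norm_num, fun t ht => ?_⟩,
    ⟨1 / 3, by norm_num, fun t ht => ?_⟩⟩
  · simp [hl0 t ht]
  · simp [hl1 t ht, sub_eq_neg_add]

end IsFlatCurve

end OneForm

end Primitives

/-! ### Height charts of a closed one-form without zeros -/

section Heights

variable {n : ℕ} {X : Type*} [TopologicalSpace X] [ChartedSpace (EuclideanSpace ℝ (Fin n)) X]
  [IsManifold (𝓡 n) ∞ X]

/-- If `θ` lies in the class `ξ`, then the integrals of `θ` and the values of a cocycle representing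
`ξ` differ by a coboundary `δg`: both have the same values on smooth loops, so their difference
on a smooth path depends only on the end points. No continuity is claimed for `g`. -/
theorem OneForm.LiesIn.exists_potential {θ : OneForm n X} {ξ : SingularCohomology X ℤ 1}
    (hθ : θ.LiesIn ξ) : ∃ g : X → ℝ, ∀ (x y : X) (w : ℝ) (γ : C(ℝ, X)) (G : ℝ → ℝ)
      (h : θ.IsFlatCurve x y w γ G), (ξ.out.1 (pathSimplex h.path) : ℝ) = w + g y - g x := by
  let R : X → X → ℝ → Prop := fun x y v => ∃ (w : ℝ) (γ : C(ℝ, X)) (G : ℝ → ℝ)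
    (h : θ.IsFlatCurve x y w γ G), v = ξ.out.1 (pathSimplex h.path) - w
  have hrefl : ∀ x, ∃ v, R x x v := fun x => ⟨_, _, _, _, .refl x, rfl⟩
  have hsymm : ∀ {x y v}, R x y v → ∃ v', R y x v' := by
    rintro x y _ ⟨w, γ, G, h, rfl⟩
    obtain ⟨γ', G', h'⟩ := h.symm
    exact ⟨_, _, _, _, h', rfl⟩
  have htrans : ∀ {x y u v v'}, R x y v → R y u v' → R x u (v + v') := by
    rintro x y u _ _ ⟨w, γ, G, h, rfl⟩ ⟨w', γ', G', h', rfl⟩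
    obtain ⟨γ'', G'', h'', e⟩ := h.trans h'
    refine ⟨_, _, _, h'', ?_⟩
    rw [e, cocycle_trans]
    push_cast
    ring
  have hloop : ∀ {x v}, R x x v → v = 0 := by
    rintro x _ ⟨w, γ, G, h, rfl⟩
    have e : pairing ξ h.path = ξ.out.1 (pathSimplex h.path) := by
      conv_lhs => rw [← QuotientAddGroup.out_eq' ξ]
      rfl
    rw [← e, ← hθ x h.path h.isSmoothPath, h.pathIntegral_eq, sub_self]
  let S : Setoid X :=
    { r := fun x y => ∃ v, R x y v
      iseqv := ⟨hrefl, fun ⟨_, h⟩ => hsymm h, fun ⟨_, h⟩ ⟨_, h'⟩ => ⟨_, htrans h h'⟩⟩ }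
  let base : X → X := fun x => (Quotient.mk S x).out
  have hbase : ∀ x, ∃ v, R (base x) x v := fun x => Quotient.exact (s := S) (Quotient.out_eq _)
  choose g hg using hbase
  refine ⟨g, fun x y w γ G h => ?_⟩
  have hR : R x y (ξ.out.1 (pathSimplex h.path) - w) := ⟨_, _, _, h, rfl⟩
  have hxy : base x = base y := congrArg Quotient.out (Quotient.sound (s := S) ⟨_, hR⟩)
  have hy := hg y
  rw [← hxy] at hy
  obtain ⟨v, hv⟩ := hsymm hy
  have h1 := hloop (htrans hy hv)
  have h2 := hloop (htrans (htrans (hg x) hR) hv)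
  linarith

/-- A closed form that is `z - δg` on smooth paths has a height chart at every point where it does not
vanish. -/
theorem OneForm.IsClosed.exists_heightChart {θ : OneForm n X} (hc : θ.IsClosed)
    {z : singularCocycles X ℤ 1} {g : X → ℝ}
    (hg : ∀ (x y : X) (w : ℝ) (γ : C(ℝ, X)) (G : ℝ → ℝ)
      (h : θ.IsFlatCurve x y w γ G), (z.1 (pathSimplex h.path) : ℝ) = w + g y - g x)
    {x₀ : X} (h : θ x₀ ≠ 0) :
    ∃ k : HeightChart z g (EuclideanSpace ℝ (Fin n)), x₀ ∈ k.openCore := by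
  obtain ⟨r, hr, hb, F, v, hv, hF⟩ := hc.exists_primitive h
  set φ := chartAt (EuclideanSpace ℝ (Fin n)) x₀
  set p : EuclideanSpace ℝ (Fin n) := φ x₀
  have hsub : Metric.closedBall p (r / 2) ⊆ Metric.ball p r :=
    Metric.closedBall_subset_ball (half_lt_self hr)
  have hsub' : Metric.ball p (r / 2) ⊆ Metric.ball p r := Metric.ball_subset_closedBall.trans hsub
  have htar : Metric.ball p r ⊆ φ.target := by
    intro y hy
    have := hb hy
    rwa [extChartAt_target, ModelWithCorners.range_eq_univ, Set.inter_univ] at this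
  have hFc : ContinuousOn F (Metric.ball p r) :=
    fun y hy => (hF y hy).1.continuousAt.continuousWithinAt
  -- On the ball of half the radius the primitive is bounded.
  obtain ⟨B, hB⟩ := (isCompact_closedBall p (r / 2)).exists_bound_of_continuousOn (hFc.mono hsub)
  let ψ := (φ.symm.restrOpen (Metric.ball p (r / 2)) Metric.isOpen_ball).symm
  have hψt : ψ.target = Metric.ball p (r / 2) := Set.inter_eq_right.2 (hsub'.trans htar)
  have hψ : ∀ x ∈ ψ.source, ψ x ∈ Metric.ball p (r / 2) := fun x hx => hψt ▸ ψ.map_source hx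
  have hx₀ : x₀ ∈ ψ.source := by
    have h1 : p ∈ ψ.target := by
      rw [hψt]
      exact Metric.mem_ball_self (half_pos hr)
    have h2 := ψ.map_target h1
    have h3 : ψ.symm p = x₀ := φ.left_inv (mem_chart_source _ x₀)
    rwa [h3] at h2
  refine ⟨{
    chart := ψ
    center := p
    radius := r / 2
    radius_pos := half_pos hr
    target_eq := hψt
    height := fun x => F (ψ x)
    continuousOn_height := hFc.comp ψ.continuousOn fun x hx => hsub' (hψ x hx)
    bound := B
    abs_height_le := fun x hx => hB _ (Metric.ball_subset_closedBall (hψ x hx))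
    dir := v
    norm_dir := hv
    height_lt := ?_
    displacement_eq := ?_ }, hx₀, Metric.mem_ball_self (half_pos (half_pos hr))⟩
  · intro y hy s hs hys
    rw [ψ.right_inv hy, ψ.right_inv hys]
    rw [hψt] at hy hys
    -- the derivative of `F` along the segment in the direction `v` is positive
    have hseg : ∀ t ∈ Set.Icc (0 : ℝ) s, y + t • v ∈ Metric.ball p r := by
      intro t ht
      have h1 := (convex_ball p (r / 2)).add_smul_mem (x := y) (y := s • v) hy hys
        (t := t / s) ⟨div_nonneg ht.1 hs.le, (div_le_one hs).2 ht.2⟩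
      rw [smul_smul, div_mul_cancel₀ _ hs.ne'] at h1
      exact hsub' h1
    have hd : ∀ t ∈ Set.Icc (0 : ℝ) s,
        HasDerivAt (fun t : ℝ => F (y + t • v)) (θ.inChart x₀ (y + t • v) v) t := by
      intro t ht
      have h1 : HasDerivAt (fun t : ℝ => y + t • v) v t := by
        simpa using ((hasDerivAt_id t).smul_const v).const_add y
      exact ((hF _ (hseg t ht)).1).comp_hasDerivAt t h1
    have hmono := strictMonoOn_of_deriv_pos (convex_Icc (0 : ℝ) s)
      (fun t ht => (hd t ht).continuousAt.continuousWithinAt) (fun t ht => by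
        rw [(hd t (interior_subset ht)).deriv]
        exact (hF _ (hseg t (interior_subset ht))).2)
    simpa using hmono (Set.left_mem_Icc.2 hs.le) (Set.right_mem_Icc.2 hs.le) hs
  -- The ball is simply connected, so `z` takes the same value on `γ` as on the smooth segment
  -- with the same end points.
  · intro γ hγ
    let Y := Metric.ball p (r / 2)
    have : ContractibleSpace Y := (convex_ball p (r / 2)).contractibleSpace
      ⟨p, Metric.mem_ball_self (half_pos hr)⟩
    let S : C(Y, X) := ⟨fun y => φ.symm y, (φ.continuousOn_symm.mono
      (hsub'.trans htar)).comp_continuous continuous_subtype_val fun y => y.2⟩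
    let A : C(unitInterval, Y) := ⟨fun t => ⟨ψ (γ t), hψ _ (hγ t)⟩,
      (ψ.continuousOn.comp_continuous γ.continuous hγ).subtype_mk _⟩
    have hSA : S.comp A = γ := ContinuousMap.ext fun t => ψ.left_inv (hγ t)
    obtain ⟨l, γ', G, hl0, hl1, hγ', hcurve⟩ := OneForm.IsFlatCurve.exists_segment (θ := θ)
      (x₀ := x₀) (F := F) (Metric.isOpen_ball (x := p) (ε := r / 2))
      (convex_ball p (r / 2))
      (hsub'.trans hb) (fun y hy => (hF y (hsub' hy)).1) (A 0).2 (A 1).2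
    let δ : Path (A 0) (A 1) :=
      { toFun := fun t => l t
        continuous_toFun := l.continuous.comp continuous_subtype_val
        source' := Subtype.ext hl0
        target' := Subtype.ext hl1 }
    have e1 : displacement z γ 0 1 = z.1 (pathSimplex hcurve.path) := by
      rw [← hSA, displacement_comp, displacement_eq z S δ]
      exact congrArg z.1 (ContinuousMap.ext fun s => (hγ' _).symm)
    have e2 := hg _ _ _ _ _ hcurve
    have e3 : ∀ t, (extChartAt (𝓡 n) x₀).symm (A t) = γ t := fun t => ψ.left_inv (hγ t)
    rw [e1, e2, e3, e3]
    change F (ψ (γ 1)) - F (ψ (γ 0)) + g (γ 1) - g (γ 0) = _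
    ring

end Heights

/-! ### Vanishing of the cohomology of the flat line bundle -/

namespace HeightChart

variable {X : Type*} [TopologicalSpace X] {z : singularCocycles X ℤ 1} {g : X → ℝ}
  {E : Type*} [NormedAddCommGroup E] [NormedSpace ℝ E]

/-- The height chart with the height turned upside down, for the opposite cocycle. -/
def neg (k : HeightChart z g E) : HeightChart (-z) (-g) E where
  chart := k.chart
  center := k.center
  radius := k.radius
  radius_pos := k.radius_pos
  target_eq := k.target_eq
  height x := -k.height x
  continuousOn_height := k.continuousOn_height.neg
  bound := k.bound
  abs_height_le x hx := by
    rw [abs_neg]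
    exact k.abs_height_le x hx
  dir := -k.dir
  norm_dir := by
    rw [norm_neg]
    exact k.norm_dir
  height_lt y hy s hs hys := by
    have h := k.height_lt (y + s • -k.dir) hys s hs
    rw [smul_neg, neg_add_cancel_right] at h
    rw [smul_neg]
    exact neg_lt_neg (h hy)
  displacement_eq γ hγ := by
    have h := k.displacement_eq γ hγ
    have e : displacement (-z) γ 0 1 = -displacement z γ 0 1 := rfl
    rw [e]
    push_cast
    rw [h]
    simp only [Pi.neg_apply]
    ring

end HeightChart

section FlatLineBundle

variable {X : Type*} [TopologicalSpace X]

theorem flatLineBundle_coboundary (ξ : SingularCohomology X ℤ 1) (a : ℂˣ) (n : ℕ)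
    (c : SingularCochain X ℂ n) :
    (flatLineBundle ξ a).coboundary n c = twistedCoboundary ξ.out a c := by
  funext s
  have e : ∀ i : Fin (n + 2),
      displacement ξ.out s (faceMap i (vertexZero n)) (vertexZero (n + 1)) =
      ξ.out.1 (pathSimplex ((segmentPath (faceMap i (vertexZero n)) (vertexZero (n + 1))).map
        s.continuous)) := fun i => displacement_eq _ _ _
  simp only [twistedCoboundary, e]
  rfl

theorem twistedCoboundary_neg_inv (z : singularCocycles X ℤ 1) (b : ℂˣ) {n : ℕ}
    (c : SingularCochain X ℂ n) : twistedCoboundary (-z) b⁻¹ c = twistedCoboundary z b c := by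
  funext s
  refine Finset.sum_congr rfl fun i _ => ?_
  have e : ∀ p q, displacement (-z) s p q = -displacement z s p q := fun _ _ => rfl
  rw [e, inv_zpow', neg_neg]

/-- The cohomology of `E_a` vanishes if it does so for the twisted cochains of either of the pairs
`(z, a)` and `(-z, a⁻¹)`, which have the same coboundary. -/
theorem subsingleton_cohomology {ξ : SingularCohomology X ℤ 1} {a : ℂˣ}
    {z : singularCocycles X ℤ 1} {b : ℂˣ}
    (hd : ∀ (n : ℕ) (c : SingularCochain X ℂ n),
      (flatLineBundle ξ a).coboundary n c = twistedCoboundary z b c)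
    (h : ∀ (n : ℕ) (c : SingularCochain X ℂ n), twistedCoboundary z b c = 0 →
      c ∈ twistedBoundaries z b n) (i : ℕ) :
    Subsingleton ((flatLineBundle ξ a).Cohomology i) := by
  rw [Submodule.Quotient.subsingleton_iff, eq_top_iff]
  rintro ⟨c, hc⟩ -
  have hc' : twistedCoboundary z b c = 0 := (hd i c).symm.trans (LinearMap.mem_ker.1 hc)
  have h' := h i c hc'
  change c ∈ (flatLineBundle ξ a).coboundaries i
  cases i with
  | zero => exact h'
  | succ n =>
    obtain ⟨d, hdc⟩ := h'
    exact ⟨d, (hd n d).trans hdc⟩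

end FlatLineBundle

end FlatLine

end

theorem corollary1p3 {n : ℕ} {X : Type*} [TopologicalSpace X] [T2Space X] [CompactSpace X]
    [ChartedSpace (EuclideanSpace ℝ (Fin n)) X] [IsManifold (𝓡 n) ∞ X]
    (ξ : FlatLine.SingularCohomology X ℤ 1) (a : ℂˣ) (ha : ¬ FlatLine.IsDirichletUnit (a : ℂ))
    (hH : ∃ i : ℕ, Nontrivial ((FlatLine.flatLineBundle ξ a).Cohomology i))
    (θ : FlatLine.OneForm n X) (hclosed : θ.IsClosed) (hθ : θ.LiesIn ξ) :
    ∃ p : X, θ.IsCriticalPoint p := by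
  by_contra! hne
  have : SecondCountableTopology X :=
    ChartedSpace.secondCountable_of_sigmaCompact (EuclideanSpace ℝ (Fin n)) X
  let : MetricSpace X := TopologicalSpace.metrizableSpaceMetric X
  obtain ⟨i, hi⟩ := hH
  rw [← not_subsingleton_iff_nontrivial] at hi
  apply hi
  obtain ⟨g, hg⟩ := hθ.exists_potential
  have hcov : ∀ x, ∃ k : FlatLine.HeightChart ξ.out g (EuclideanSpace ℝ (Fin n)),
      x ∈ k.openCore := fun x => hclosed.exists_heightChart hg (hne x)
  by_cases hint : IsIntegral ℤ (a : ℂ)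
  · have hinv : ¬ IsIntegral ℤ ((a⁻¹ : ℂˣ) : ℂ) := fun h =>
      ha ⟨a.ne_zero, hint, by rwa [← Units.val_inv_eq_inv_val]⟩
    refine FlatLine.subsingleton_cohomology (z := -ξ.out) (b := a⁻¹) (fun m c => ?_)
      (fun m c hc => FlatLine.mem_twistedBoundaries (g := -g)
        (E := EuclideanSpace ℝ (Fin n)) (fun x => ?_) _ hinv c hc) i
    · rw [FlatLine.twistedCoboundary_neg_inv]
      exact FlatLine.flatLineBundle_coboundary ξ a m c
    · obtain ⟨k, hk⟩ := hcov x
      exact ⟨k.neg, hk⟩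
  · exact FlatLine.subsingleton_cohomology (FlatLine.flatLineBundle_coboundary ξ a)
      (fun n c hc => FlatLine.mem_twistedBoundaries hcov _ hint c hc) i
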